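/- **Setting.** Consider Bayesian persuasion with states of nature $\mathcal Y=\{0,1\}$, a finite non-empty strategy space $\mathcal S$ with $n=|\mathcal S|$, Receiver (Agent) utility $u(s,y)\in[0,1]$ and Sender (Principal) utility $v(s)\in[0,1]$. Assume that every strategy is strictly optimal for some belief: for every $s\in\mathcal S$ there is $\mu\in[0,1]$ with $u(s,\mu)>u(s',\mu)$ for all $s'\neq s$, where $u(s,\mu)=(1-\mu)u(s,0)+\mu u(s,1)$. A policy is a signaling scheme $p(\cdot\mid y)\in\Delta(\mathcal S)$, $y\in\{0,1\}$; an action of the Agent is a map $a:\mathcal S\to\mathcal S$ from signals to strategies; $U(a,p,y)=\mathbb E_{s\sim p(\cdot|y)}u(a(s),y)$, $V(a,p,y)=\mathbb E_{s\sim p(\cdot|y)}v(a(s))$, and $U(a,p,\pi)$, $V(a,p,\pi)$ are their expectations over $y\sim\pi\in\Delta(\mathcal Y)$. Let $a^*(p,\pi)$ be an action maximizing $U(\cdot,p,\pi)$ and, among the maximizers, $V(\cdot,p,\pi)$ (remaining ties are broken arbitrarily); let $a^*(p,\pi,\epsilon)$ maximize $V(\cdot,p,\pi)$ among the actions with $U(a,p,\pi)\ge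 U(a^*(p,\pi),p,\pi)-\epsilon$. Given a set $\mathcal P_0$ of benchmark policies, a *$(c,\epsilon,\beta,\gamma)$-optimal stable oracle* with output space $\mathcal P_{\mathcal O}$ is a map $O:\Delta(\mathcal Y)\to\mathcal P_{\mathcal O}$ such that for every $\pi$ the policy $p=O(\pi)$ satisfies: (i) for every $a\ne a^*(p,\pi)$, $U(a,p,\pi)\le U(a^*(p,\pi),p,\pi)-\beta$ or $V(a,p,\pi)\ge V(a^*(p,\pi),p,\pi)-\gamma$; (ii) $V(a^*(p,\pi),p,\pi)\ge V(a^*(p_0,\pi,\epsilon),p_0,\pi)-c$ for all $p_0\in\mathcal P_0$. **Part 1.** There are positive constants $C,c_1,c_2$ (depending only on the game) such that for every $\mathcal P_0$ and all $\beta\in[0,C/4)$, $\epsilon,x\in[0,1]$ and $0<\delta\le\beta^2/16$ there is a $$\Big(\tfrac{3\beta}{C}+c_2\sqrt\epsilon+2\sqrt\delta,\ \epsilon,\ \tfrac{x c_1\beta}{2},\ \max(x,\sqrt\delta)\Big)\text{-optimal stable oracle}$$ whose output space satisfies $|\mathcal P_{\mathcal O}|\le K_0\,n^2/\delta^2$,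 where $K_0$ is an absolute constant. **Repeated game.** In rounds $t=1,\dots,T$ a randomized forecasting algorithm $\mathcal F$ produces $\pi_t\in\Delta(\mathcal Y)$ from the past states and forecasts; the mechanism $\sigma^\dagger=(\mathcal F,O)$ offers $p_t=O(\pi_t)$ and recommends $r_t=a^*(p_t,\pi_t)$; the Agent draws $a_t$ from a distribution given by a learning algorithm $\mathcal L$ from the past states and actions and the policies and recommendations up to round $t$; then $y_t$ is revealed, where $y_{1:T}$ is an arbitrary sequence. The constant mechanism of $p_0\in\mathcal P_0$ offers $p_0$ and recommends $r_t^{p_0}=a^*(p_0,\pi_t)$ in all rounds, and $a^{p_0}_{1:T}$ are the actions that $\mathcal L$ then plays. The Principal's regret is $$\mathrm{PR}(\sigma^\dagger,\mathcal L,y_{1:T})=\mathbb E_{\pi_{1:T}}\max_{p_0\in\mathcal P_0}\mathbb E_{\mathcal L}\ \frac1T\sum_{t=1}^T\big(V(a_t^{p_0},p_0,y_t)-V(a_t,p_t,y_t)\big).$$ The Agent *obtains swap regret* $\epsilon_{\rm swap}$ if, under $\sigma^\dagger$ and under each constant mechanism, the expectation of $\max_h\frac1T\sum_t\big(U(h(p_t,r_t,a_t),p_t,y_t)-U(a_t,p_t,y_t)\big)$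 over actions and forecasts is at most $\epsilon_{\rm swap}$, the maximum being over maps $h$ from (policy, recommendation, action) to actions. The Agent has *no secret information* if, under $\sigma^\dagger$ and under each constant mechanism, along every forecast sequence of positive probability, for every $(p,r)$ with $I=\{t:(p_t,r_t)=(p,r)\}\neq\emptyset$ and $\hat\mu$ the empirical distribution of $(a_t)_{t\in I}$, $\frac1{|I|}\mathbb E\big|\sum_{t\in I}(U(a_t,p,y_t)-U(\hat\mu,p,y_t))\big|=O(|I|^{-1/2})$, and likewise for $V$. Let $(p^{\rm opt}(\pi),a^{\rm opt}(\pi))$ maximize $V(a,p_0,\pi)$ over $p_0\in\mathcal P_0$ and $\epsilon$-best responses $a$ to $(p_0,\pi)$, and let $\mathcal E$ consist of the events $\{O(\pi_t)=p,\ a^*(O(\pi_t),\pi_t)=r\}$ ($p\in\mathcal P_{\mathcal O}$), $\{p^{\rm opt}(\pi_t)=p,\ a^{\rm opt}(\pi_t)=a\}$ ($p\in\mathcal P_0$) and $\{a^*(p_0,\pi_t)=a\}$ ($p_0\in\mathcal P_0$), where $r,a$ range over all actions. Say that $\mathcal F$ has *low bias* conditional on $\mathcal E$ if for all $y_{1:T}$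 and $E\in\mathcal E$, with $\ell=\ln(|\mathcal Y||\mathcal E|T)$ and states written as one-hot vectors, $$\mathbb E\,\frac1T\Big\|\sum_{t}\mathbf 1_E(\pi_t)(\pi_t-y_t)\Big\|_1\le O\Big(\mathbb E\Big[\frac{|\mathcal Y|\,\ell+|\mathcal Y|\sqrt{\ell\,|\{t:\mathbf 1_E(\pi_t)=1\}|}}{T}\Big]\Big).$$ **Part 2.** Let $\mathcal P_0$ be finite and non-empty, and put $\epsilon=T^{-1/5}$, $x=\beta=\sqrt\epsilon$, $\delta=\beta^2/16$, with $T\ge2$ so large that $\beta<C/4$. For every oracle $O$ as in Part 1 with these parameters, a forecasting algorithm with low bias conditional on $\mathcal E$ exists (with an absolute constant in the bound), and for each such algorithm $\mathcal F$, every $y_{1:T}$ and every Agent with no secret information who obtains swap regret $\epsilon_{\rm swap}=O(\sqrt{|\mathcal P_{\mathcal O}|/T})$, $$\mathrm{PR}(\sigma^\dagger,\mathcal L,y_{1:T})=\tilde O\big(T^{-1/10}\big),$$ i.e. it is at most $K\,T^{-1/10}(\ln T)^k$, where $k$ depends only on the game and $\mathcal P_0$, and $K$ only on these and on the constants in the bounds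 on bias, swap regret and secret information. -/

import Mathlib

/-! # Repeated Principal-Agent games without a common prior, and binary-state Bayesian persuasion

Rounds are numbered `0, …, T - 1`. Distributions over a finite type are points of the standard
simplex. `A` is the set of actions, `P` the set of policies, `Y` the set of states of nature. -/

noncomputable section

/-! ## The stage game -/

/-- The utility functions `U(a,p,y)` of the Agent and `V(a,p,y)` of the Principal. -/
structure StageGame (A P Y : Type*) where
  agentUtil : A → P → Y → ℝ
  principalUtil : A → P → Y → ℝ

namespace StageGame

variable {A P Y : Type*} [Fintype Y]

/-- `U(a,p,π) = 𝔼_{y ∼ π} U(a,p,y)`. -/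
def U (G : StageGame A P Y) (a : A) (p : P) (π : stdSimplex ℝ Y) : ℝ :=
  ∑ y, π y * G.agentUtil a p y

/-- `V(a,p,π) = 𝔼_{y ∼ π} V(a,p,y)`. -/
def V (G : StageGame A P Y) (a : A) (p : P) (π : stdSimplex ℝ Y) : ℝ :=
  ∑ y, π y * G.principalUtil a p y

/-- `a` is a best response `a^*(p,π)`: it maximizes the Agent's expected utility and, among the
maximizers, the Principal's expected utility. -/
def IsBestResponse (G : StageGame A P Y) (p : P) (π : stdSimplex ℝ Y) (a : A) : Prop :=
  (∀ b, G.U b p π ≤ G.U a p π) ∧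
    ∀ b, (∀ b', G.U b' p π ≤ G.U b p π) → G.V b p π ≤ G.V a p π

/-- `aStar` selects a best response `a^*(p,π)` for all `p` and `π` (remaining ties are broken
arbitrarily). -/
def IsBestResponseRule (G : StageGame A P Y) (aStar : P → stdSimplex ℝ Y → A) : Prop :=
  ∀ p π, G.IsBestResponse p π (aStar p π)

/-- The set `𝓑(p,π,ε)` of `ε`-best responses of the Agent. -/
def epsBestResponses (G : StageGame A P Y) (aStar : P → stdSimplex ℝ Y → A)
    (p : P) (π : stdSimplex ℝ Y) (ε : ℝ) : Set A :=
  {a | G.U (aStar p π) p π - ε ≤ G.U a p π}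

/-- `p` is `(β,γ)`-stable under `π`. -/
def IsStable (G : StageGame A P Y) (aStar : P → stdSimplex ℝ Y → A)
    (β γ : ℝ) (π : stdSimplex ℝ Y) (p : P) : Prop :=
  ∀ a, a ≠ aStar p π →
    G.U a p π ≤ G.U (aStar p π) p π - β ∨ G.V (aStar p π) p π - γ ≤ G.V a p π

/-- `p` is a `(c,ε,β,γ)`-optimal stable policy under `π`, for the benchmark set `P₀`. The value
`V(a^*(p₀,π,ε),p₀,π)` is the maximum of `V(a,p₀,π)` over the `ε`-best responses `a`. -/
def IsOptimalStable (G : StageGame A P Y) (aStar : P → stdSimplex ℝ Y → A) (P₀ : Set P)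
    (c ε β γ : ℝ) (π : stdSimplex ℝ Y) (p : P) : Prop :=
  G.IsStable aStar β γ π p ∧
    ∀ p₀ ∈ P₀, ∀ a ∈ G.epsBestResponses aStar p₀ π ε,
      G.V a p₀ π - c ≤ G.V (aStar p π) p π

/-- `O` is a `(c,ε,β,γ)`-optimal stable policy oracle with output space `PO`. -/
def IsOptimalStableOracle (G : StageGame A P Y) (aStar : P → stdSimplex ℝ Y → A) (P₀ : Set P)
    (c ε β γ : ℝ) (PO : Finset P) (O : stdSimplex ℝ Y → P) : Prop :=
  ∀ π, O π ∈ PO ∧ G.IsOptimalStable aStar P₀ c ε β γ π (O π)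

/-- `pOpt π` and `aOpt π` are the optimistic policy `argmax_{p₀ ∈ P₀} V(a^*(p₀,π,ε),p₀,π)` and the
optimistic action `a^*(pOpt π,π,ε)` (ties are broken arbitrarily). -/
def IsOptimisticRule (G : StageGame A P Y) (aStar : P → stdSimplex ℝ Y → A) (P₀ : Set P)
    (ε : ℝ) (pOpt : stdSimplex ℝ Y → P) (aOpt : stdSimplex ℝ Y → A) : Prop :=
  ∀ π, pOpt π ∈ P₀ ∧ aOpt π ∈ G.epsBestResponses aStar (pOpt π) π ε ∧
    ∀ p₀ ∈ P₀, ∀ a ∈ G.epsBestResponses aStar p₀ π ε, G.V a p₀ π ≤ G.V (aOpt π) (pOpt π) π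

end StageGame

/-! ## Learning algorithms and the laws they generate -/

/-- Expectation of `f` under a discrete probability distribution. -/
def expect {X : Type*} (μ : PMF X) (f : X → ℝ) : ℝ := ∑' x, (μ x).toReal * f x

/-- A randomized forecasting algorithm: in round `t` it maps the past states and the past forecasts
to a distribution of the forecast of round `t`. It does not see the Agent's actions. -/
abbrev Forecaster (Y : Type*) [Fintype Y] :=
  (t : ℕ) → (Fin t → Y) → (Fin t → stdSimplex ℝ Y) → PMF (stdSimplex ℝ Y)

/-- The law of the forecasts of the first `T` rounds when the states of nature are `y`. -/
def forecastLaw {Y : Type*} [Fintype Y] (F : Forecaster Y) (y : ℕ → Y) :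
    (T : ℕ) → PMF (Fin T → stdSimplex ℝ Y)
  | 0 => PMF.pure Fin.elim0
  | T + 1 => (forecastLaw F y T).bind fun π =>
      (F T (fun i => y i) π).map (Fin.snoc (α := fun _ => stdSimplex ℝ Y) π)

/-- A learning algorithm of the Agent: in round `t` it maps the past states, the past actions, and
the recommendations and policies up to and including round `t` to a distribution over actions. -/
abbrev Learner (A P Y : Type*) :=
  (t : ℕ) → (Fin t → Y) → (Fin t → A) → (Fin (t + 1) → A) → (Fin (t + 1) → P) → PMF A

/-- The law of the Agent's actions in the first `T` rounds, when the states of nature are `y`, the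
recommendations are `r` and the policies are `p`. -/
def actionLaw {A P Y : Type*} (L : Learner A P Y) (y : ℕ → Y) :
    (T : ℕ) → (Fin T → A) → (Fin T → P) → PMF (Fin T → A)
  | 0, _, _ => PMF.pure Fin.elim0
  | T + 1, r, p =>
      (actionLaw L y T (fun i => r i.castSucc) (fun i => p i.castSucc)).bind fun a =>
        (L T (fun i => y i) a r p).map (Fin.snoc (α := fun _ => A) a)

namespace StageGame

variable {A P Y : Type*}

/-! ## Behavioral assumptions -/

/-- The Agent's contextual swap regret `SwapReg(y_{1:T},p_{1:T},r_{1:T})`. -/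
def swapReg (G : StageGame A P Y) (L : Learner A P Y) (y : ℕ → Y) (T : ℕ)
    (r : Fin T → A) (p : Fin T → P) : ℝ :=
  expect (actionLaw L y T r p) fun a =>
    ⨆ h : P → A → A → A, (1 / (T : ℝ)) *
      ∑ t : Fin T, (G.agentUtil (h (p t) (r t) (a t)) (p t) (y t) - G.agentUtil (a t) (p t) (y t))

open Classical in
/-- The rounds `t` with `(p_t,r_t) = (p',r')`. -/
def roundsWith {T : ℕ} (r : Fin T → A) (p : Fin T → P) (r' : A) (p' : P) : Finset (Fin T) :=
  Finset.univ.filter fun t => p t = p' ∧ r t = r'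

open Classical in
/-- The empirical distribution of the actions `a` over the rounds in `I`. -/
def empirical {T : ℕ} (I : Finset (Fin T)) (a : Fin T → A) (b : A) : ℝ :=
  ((I.filter fun t => a t = b).card : ℝ) / (I.card : ℝ)

/-- No secret information along given policies and recommendations: for all `(p',r')`, with `I` the
set of rounds in which `(p_t,r_t) = (p',r')` and `n` its cardinality,
`(1/n) 𝔼|∑_{t ∈ I} (U(a_t,p',y_t) - U(μ̂,p',y_t))| ≤ K/√n`, where `μ̂` is the empirical distribution
of the actions on `I`, and likewise for `V`. (Both sides are multiplied by `n`.) -/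
def NoSecretInfo [Fintype A] (G : StageGame A P Y) (L : Learner A P Y) (y : ℕ → Y) (T : ℕ)
    (r : Fin T → A) (p : Fin T → P) (K : ℝ) : Prop :=
  ∀ (p' : P) (r' : A),
    let I := roundsWith r p r' p'
    expect (actionLaw L y T r p) (fun a => |∑ t ∈ I, (G.agentUtil (a t) p' (y t) -
        ∑ b, empirical I a b * G.agentUtil b p' (y t))|) ≤ K * √(I.card : ℝ) ∧
    expect (actionLaw L y T r p) (fun a => |∑ t ∈ I, (G.principalUtil (a t) p' (y t) -
        ∑ b, empirical I a b * G.principalUtil b p' (y t))|) ≤ K * √(I.card : ℝ)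

variable [Fintype Y]

/-- The recommendations `a^*(p_t,π_t)`. -/
def recommend (aStar : P → stdSimplex ℝ Y → A) {T : ℕ} (p : Fin T → P)
    (π : Fin T → stdSimplex ℝ Y) : Fin T → A :=
  fun t => aStar (p t) (π t)

/-- No contextual swap regret. The forecasts are produced by `F`; under the deployed mechanism,
which offers `p_t = O(π_t)`, and under each constant mechanism offering `p₀ ∈ P₀`, the swap regret
of the Agent, averaged over the forecasts, is at most `εswap`. (This is implied by the same bound
for each realized sequence of forecasts.) -/
def NoSwapRegret (G : StageGame A P Y) (aStar : P → stdSimplex ℝ Y → A) (P₀ : Finset P)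
    (O : stdSimplex ℝ Y → P) (F : Forecaster Y) (L : Learner A P Y) (y : ℕ → Y) (T : ℕ)
    (εswap : ℝ) : Prop :=
  expect (forecastLaw F y T) (fun π =>
      G.swapReg L y T (recommend aStar (fun t => O (π t)) π) (fun t => O (π t))) ≤ εswap ∧
  ∀ p₀ ∈ P₀, expect (forecastLaw F y T) (fun π =>
      G.swapReg L y T (recommend aStar (fun _ => p₀) π) (fun _ => p₀)) ≤ εswap

/-- No secret information, with constant `K`, for the deployed mechanism and for the constant
mechanisms, along each sequence of forecasts that `F` produces with positive probability. -/
def NoSecretInformation [Fintype A] (G : StageGame A P Y) (aStar : P → stdSimplex ℝ Y → A)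
    (P₀ : Finset P) (O : stdSimplex ℝ Y → P) (F : Forecaster Y) (L : Learner A P Y) (y : ℕ → Y)
    (T : ℕ) (K : ℝ) : Prop :=
  ∀ π ∈ (forecastLaw F y T).support,
    G.NoSecretInfo L y T (recommend aStar (fun t => O (π t)) π) (fun t => O (π t)) K ∧
    ∀ p₀ ∈ P₀, G.NoSecretInfo L y T (recommend aStar (fun _ => p₀) π) (fun _ => p₀) K

/-! ## The Principal's regret -/

/-- Expected average utility of the Principal when she offers the policies `p`, recommends
`a^*(p_t,π_t)`, and the Agent runs `L`. -/
def avgPrincipalUtil (G : StageGame A P Y) (aStar : P → stdSimplex ℝ Y → A) (L : Learner A P Y)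
    (y : ℕ → Y) (T : ℕ) (π : Fin T → stdSimplex ℝ Y) (p : Fin T → P) : ℝ :=
  expect (actionLaw L y T (recommend aStar p π) p) fun a =>
    (1 / (T : ℝ)) * ∑ t : Fin T, G.principalUtil (a t) (p t) (y t)

/-- The Principal's policy regret `PR(O,π_{1:T},L,y_{1:T})` against the benchmark set `P₀`. -/
def policyRegret (G : StageGame A P Y) (aStar : P → stdSimplex ℝ Y → A) (P₀ : Finset P)
    (hP₀ : P₀.Nonempty) (O : stdSimplex ℝ Y → P) (L : Learner A P Y) (y : ℕ → Y) (T : ℕ)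
    (π : Fin T → stdSimplex ℝ Y) : ℝ :=
  P₀.sup' hP₀ fun p₀ =>
    G.avgPrincipalUtil aStar L y T π (fun _ => p₀) -
      G.avgPrincipalUtil aStar L y T π (fun t => O (π t))

/-- The Principal's regret `PR(σ†,L,y_{1:T})` of the mechanism `σ† = (F,O)`: the expectation of the
policy regret over the forecasts generated by `F`. -/
def principalRegret (G : StageGame A P Y) (aStar : P → stdSimplex ℝ Y → A) (P₀ : Finset P)
    (hP₀ : P₀.Nonempty) (O : stdSimplex ℝ Y → P) (F : Forecaster Y) (L : Learner A P Y)
    (y : ℕ → Y) (T : ℕ) : ℝ :=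
  expect (forecastLaw F y T) fun π => G.policyRegret aStar P₀ hP₀ O L y T π

/-! ## Forecasts that are unbiased conditional on events -/

/-- The events `(p_t,r_t) = (p,r)` for `p ∈ PO`, the events `(p_t^{opt},a_t^{opt}) = (p,a)` for
`p ∈ P₀`, and the events `a^*(p₀,π_t) = a` for `p₀ ∈ P₀`, as sets of forecasts. -/
def events (aStar : P → stdSimplex ℝ Y → A) (P₀ PO : Finset P)
    (O : stdSimplex ℝ Y → P) (pOpt : stdSimplex ℝ Y → P) (aOpt : stdSimplex ℝ Y → A) :
    ((PO × A) ⊕ (P₀ × A)) ⊕ (P₀ × A) → Set (stdSimplex ℝ Y)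
  | .inl (.inl (p, r)) => {π | O π = p ∧ aStar (O π) π = r}
  | .inl (.inr (p, a)) => {π | pOpt π = p ∧ aOpt π = a}
  | .inr (p₀, a) => {π | aStar p₀ π = a}

end StageGame

open Classical in
/-- Over `T` rounds and for every sequence of states, the forecasts of `F` have expected bias
`𝔼 (1/T) ‖∑_t E(π_t)(π_t - y_t)‖₁` conditional on each event `E` of the family `𝓔` at most
`K (|Y| ln(|Y||𝓔|T)/T + |Y| √(ln(|Y||𝓔|T) |{t : E(π_t) = 1}|)/T)` in expectation. -/
def HasLowBias {Y ι : Type*} [Fintype Y] [Fintype ι] (F : Forecaster Y)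
    (𝓔 : ι → Set (stdSimplex ℝ Y)) (T : ℕ) (K : ℝ) : Prop :=
  ∀ (y : ℕ → Y) (i : ι),
    let ℓ : ℝ := Real.log ((Fintype.card Y : ℝ) * (Fintype.card ι : ℝ) * (T : ℝ))
    expect (forecastLaw F y T) (fun π => (1 / (T : ℝ)) * ∑ z : Y,
        |∑ t : Fin T, if π t ∈ 𝓔 i then π t z - (if y t = z then 1 else 0) else 0|) ≤
      expect (forecastLaw F y T) (fun π => K * ((Fintype.card Y : ℝ) * ℓ / T +
        (Fintype.card Y : ℝ) *
          √(ℓ * ((Finset.univ.filter fun t : Fin T => π t ∈ 𝓔 i).card : ℝ)) / T))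

/-! ## Binary-state Bayesian persuasion -/

/-- Signaling schemes with signal space `S`: a distribution over signals for each state. -/
abbrev SignalScheme (S : Type*) [Fintype S] := Fin 2 → stdSimplex ℝ S

/-- Bayesian persuasion with states `{0,1}`, finite strategy space `S`, Receiver's utility `u(s,y)`
and Sender's utility `v(s)`: the Principal's policies are signaling schemes, the Agent's actions are
maps from signals to strategies. -/
def persuasionGame {S : Type*} [Fintype S] (u : S → Fin 2 → ℝ) (v : S → ℝ) :
    StageGame (S → S) (SignalScheme S) (Fin 2) where
  agentUtil a p y := ∑ s, p y s * u (a s) y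
  principalUtil a p y := ∑ s, p y s * v (a s)

/-- Every strategy is the strict optimum of the Receiver for some prior `Ber(μ)`. -/
def EveryStrategyStrictlyOptimal {S : Type*} (u : S → Fin 2 → ℝ) : Prop :=
  ∀ s, ∃ μ ∈ Set.Icc (0 : ℝ) 1, ∀ s', s' ≠ s →
    (1 - μ) * u s' 0 + μ * u s' 1 < (1 - μ) * u s 0 + μ * u s 1

end

/-!
If the forecasts are nearly unbiased conditional on the rounds in which a given policy and
recommendation occur, then over those rounds the realized states can be replaced by the forecasts.
Swap regret and the absence of secret information make the Agent's empirical mixture of actions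
almost a best response to these forecasts. Under the stable oracle, each action that loses the
Agent less than `β` costs the Principal at most `γ`, so her loss from the Agent's deviations is at
most `γ` plus the learning error divided by `β`; under a constant mechanism an Agent who is
`ε`-optimal gives the Principal at most the optimistic benchmark, up to the learning error divided
by `ε`. Optimality of the oracle compares the two benchmarks.

A forecaster with low bias exists because in the binary case one can always randomize between two
adjacent grid forecasts, or play one, so that the drift of an exponential potential over all events,
signs and learning rates is nonpositive up to the mesh of the grid.

For the oracle, take an `ε`-best response to a benchmark scheme and group the signals by the
strategy played. At each of these signals the weight of one state is lowered until the strategy is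
optimal by a margin `β`, and the mass removed is sent to the best strategy of its state; this costs
the Principal `O(β + ε)`. By Carathéodory two signals suffice, and rounding their probabilities to
multiples of about `δ` leaves `O(n² / δ²)` schemes, in which only signals of probability below `√δ`
can lose the margin.
-/

/-! ## Expectations of bounded functions -/

section Expect

variable {X : Type*} {f g : X → ℝ}

/-- Boundedness of a real function, the condition under which `expect` (a `tsum`, hence `0` when
the series diverges) is monotone and additive for every distribution. -/
def IsBoundedFun (f : X → ℝ) : Prop := ∃ M, ∀ x, |f x| ≤ M

namespace IsBoundedFun

lemma of_mem_Icc {a b : ℝ} (h : ∀ x, f x ∈ Set.Icc a b) : IsBoundedFun f :=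
  ⟨max |a| |b|, fun x => abs_le_max_abs_abs (h x).1 (h x).2⟩

lemma of_finite [Finite X] (f : X → ℝ) : IsBoundedFun f := by
  obtain ⟨M, hM⟩ := (Set.finite_range fun x => |f x|).bddAbove
  exact ⟨M, fun x => hM ⟨x, rfl⟩⟩

lemma const (c : ℝ) : IsBoundedFun fun _ : X => c := ⟨|c|, fun _ => le_rfl⟩

lemma comp {Z : Type*} (hf : IsBoundedFun f) (φ : Z → X) : IsBoundedFun fun z => f (φ z) := by
  obtain ⟨M, hM⟩ := hf
  exact ⟨M, fun z => hM (φ z)⟩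

lemma add (hf : IsBoundedFun f) (hg : IsBoundedFun g) : IsBoundedFun fun x => f x + g x := by
  obtain ⟨M, hM⟩ := hf
  obtain ⟨N, hN⟩ := hg
  exact ⟨M + N, fun x => (abs_add_le _ _).trans (add_le_add (hM x) (hN x))⟩

lemma const_mul (c : ℝ) (hf : IsBoundedFun f) : IsBoundedFun fun x => c * f x := by
  obtain ⟨M, hM⟩ := hf
  exact ⟨|c| * M, fun x => by
    rw [abs_mul]; exact mul_le_mul_of_nonneg_left (hM x) (abs_nonneg c)⟩

lemma sum {ι : Type*} (s : Finset ι) {f : ι → X → ℝ} (hf : ∀ i ∈ s, IsBoundedFun (f i)) :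
    IsBoundedFun fun x => ∑ i ∈ s, f i x := by
  classical
  induction s using Finset.induction_on with
  | empty => simpa using const 0
  | insert i s hi ih =>
    simp only [Finset.sum_insert hi]
    exact (hf i (by simp)).add (ih fun j hj => hf j (by simp [hj]))

lemma summable (hf : IsBoundedFun f) (μ : PMF X) : Summable fun x => (μ x).toReal * f x := by
  obtain ⟨M, hM⟩ := hf
  refine ((ENNReal.summable_toReal μ.tsum_coe_ne_top).mul_right M).of_norm_bounded fun x => ?_
  rw [norm_mul, Real.norm_eq_abs, Real.norm_eq_abs, abs_of_nonneg ENNReal.toReal_nonneg]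
  exact mul_le_mul_of_nonneg_left (hM x) ENNReal.toReal_nonneg

end IsBoundedFun

variable (μ : PMF X)

lemma expect_const (c : ℝ) : expect μ (fun _ => c) = c := by
  rw [expect, tsum_mul_right, ← ENNReal.tsum_toReal_eq fun x => μ.apply_ne_top x, μ.tsum_coe,
    ENNReal.toReal_one, one_mul]

lemma expect_mono (hf : IsBoundedFun f) (hg : IsBoundedFun g) (h : ∀ x ∈ μ.support, f x ≤ g x) :
    expect μ f ≤ expect μ g := by
  refine (hf.summable μ).tsum_le_tsum (fun x => ?_) (hg.summable μ)
  by_cases hx : μ x = 0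
  · simp [hx]
  · exact mul_le_mul_of_nonneg_left (h x ((μ.mem_support_iff x).2 hx)) ENNReal.toReal_nonneg

lemma expect_add (hf : IsBoundedFun f) (hg : IsBoundedFun g) :
    expect μ (fun x => f x + g x) = expect μ f + expect μ g := by
  simp only [expect, mul_add]
  exact (hf.summable μ).tsum_add (hg.summable μ)

lemma expect_const_mul (c : ℝ) (f : X → ℝ) : expect μ (fun x => c * f x) = c * expect μ f := by
  simp only [expect, ← tsum_mul_left]
  exact tsum_congr fun x => mul_left_comm _ _ _

lemma expect_sum {ι : Type*} (s : Finset ι) {f : ι → X → ℝ} (hf : ∀ i ∈ s, IsBoundedFun (f i)) :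
    expect μ (fun x => ∑ i ∈ s, f i x) = ∑ i ∈ s, expect μ (f i) := by
  simp only [expect, Finset.mul_sum]
  exact Summable.tsum_finsetSum fun i hi => (hf i hi).summable μ

lemma expect_mem_Icc {a b : ℝ} (h : ∀ x, f x ∈ Set.Icc a b) : expect μ f ∈ Set.Icc a b := by
  have hf := IsBoundedFun.of_mem_Icc h
  constructor
  · rw [← expect_const μ a]
    exact expect_mono μ (.const a) hf fun x _ => (h x).1
  · rw [← expect_const μ b]
    exact expect_mono μ hf (.const b) fun x _ => (h x).2

end Expect

lemma average_mem_Icc {T : ℕ} {f : Fin T → ℝ} (hf : ∀ t, f t ∈ Set.Icc (0 : ℝ) 1) :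
    (1 / (T : ℝ)) * ∑ t, f t ∈ Set.Icc (0 : ℝ) 1 := by
  refine ⟨mul_nonneg (by positivity) (Finset.sum_nonneg fun t _ => (hf t).1), ?_⟩
  have hsum : ∑ t, f t ≤ T := by
    simpa using Finset.sum_le_card_nsmul Finset.univ f 1 fun t _ => (hf t).2
  rw [one_div_mul_eq_div]
  exact div_le_one_of_le₀ hsum T.cast_nonneg

lemma sum_sqrt_le_sqrt_card_mul_sum {ι : Type*} (s : Finset ι) {f : ι → ℝ}
    (hf : ∀ i ∈ s, 0 ≤ f i) : ∑ i ∈ s, √(f i) ≤ √((s.card : ℝ) * ∑ i ∈ s, f i) := by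
  refine Real.le_sqrt_of_sq_le (sq_sum_le_card_mul_sum_sq.trans_eq ?_)
  rw [Finset.sum_congr rfl fun i hi => Real.sq_sqrt (hf i hi)]

/-! ## Payoffs under nearly unbiased forecasts -/

section Rounds

variable {τ A Y : Type*} [Fintype Y]

lemma sum_weight_mul_le {X : Type*} [Fintype X] {m : X → ℝ} (hm : m ∈ stdSimplex ℝ X) {f : X → ℝ}
    {c : ℝ} (hf : ∀ x, f x ≤ c) : ∑ x, m x * f x ≤ c :=
  calc ∑ x, m x * f x ≤ ∑ x, m x * c :=
        Finset.sum_le_sum fun x _ => mul_le_mul_of_nonneg_left (hf x) (hm.1 x)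
    _ = c := by rw [← Finset.sum_mul, hm.2, one_mul]

lemma abs_sum_weight_mul_le {X : Type*} [Fintype X] {m : X → ℝ} (hm : m ∈ stdSimplex ℝ X)
    {f : X → ℝ} {c : ℝ} (hf : ∀ x, |f x| ≤ c) : |∑ x, m x * f x| ≤ c := by
  refine (Finset.abs_sum_le_sum_abs _ _).trans ?_
  simp only [abs_mul, abs_of_nonneg (hm.1 _)]
  exact sum_weight_mul_le hm hf

open Classical in
/-- The `ℓ¹` norm of the total bias `∑_t (π_t - y_t)` of the forecasts over the rounds in `I`. -/
noncomputable def forecastBias (I : Finset τ) (π : τ → stdSimplex ℝ Y) (y : τ → Y) : ℝ :=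
  ∑ z, |∑ t ∈ I, (π t z - if y t = z then 1 else 0)|

lemma forecastBias_nonneg (I : Finset τ) (π : τ → stdSimplex ℝ Y) (y : τ → Y) :
    0 ≤ forecastBias I π y :=
  Finset.sum_nonneg fun _ _ => abs_nonneg _

lemma forecastBias_le_card_mul_card (I : Finset τ) (π : τ → stdSimplex ℝ Y) (y : τ → Y) :
    forecastBias I π y ≤ Fintype.card Y * I.card := by
  classical
  have hround : ∀ z, ∀ t ∈ I, |π t z - if y t = z then 1 else 0| ≤ 1 := fun z t _ => by
    have h0 : 0 ≤ π t z := (π t).2.1 z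
    have h1 : π t z ≤ 1 := stdSimplex.le_one (π t) z
    split_ifs <;> rw [abs_le] <;> constructor <;> linarith
  calc forecastBias I π y ≤ ∑ _z : Y, (I.card : ℝ) := Finset.sum_le_sum fun z _ =>
        (Finset.abs_sum_le_sum_abs _ _).trans <| by
          simpa using Finset.sum_le_card_nsmul I _ 1 (hround z)
    _ = Fintype.card Y * I.card := by simp

lemma abs_sum_forecast_sub_le (I : Finset τ) (π : τ → stdSimplex ℝ Y) (y : τ → Y) {f : Y → ℝ}
    {M : ℝ} (hf : ∀ z, |f z| ≤ M) :
    |∑ t ∈ I, (∑ z, π t z * f z - f (y t))| ≤ M * forecastBias I π y := by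
  classical
  have hexchange : ∑ t ∈ I, (∑ z, π t z * f z - f (y t)) =
      ∑ z, f z * ∑ t ∈ I, (π t z - if y t = z then 1 else 0) := by
    simp only [Finset.mul_sum]
    rw [Finset.sum_comm]
    refine Finset.sum_congr rfl fun t _ => ?_
    simp only [mul_sub, Finset.sum_sub_distrib, mul_comm (f _) (π t _), mul_ite, mul_one, mul_zero,
      Finset.sum_ite_eq, Finset.mem_univ, if_true]
  rw [hexchange, forecastBias, Finset.mul_sum]
  refine (Finset.abs_sum_le_sum_abs _ _).trans (Finset.sum_le_sum fun z _ => ?_)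
  rw [abs_mul]
  exact mul_le_mul_of_nonneg_right (hf z) (abs_nonneg _)

lemma sum_payoff_le_sum_target [Fintype A] (I : Finset τ) (π : τ → stdSimplex ℝ Y) (y : τ → Y)
    (a : τ → A) {φ : A → Y → ℝ} {M : ℝ} (hφ : ∀ b z, |φ b z| ≤ M) {m : A → ℝ}
    (hm : m ∈ stdSimplex ℝ A) {W : τ → ℝ} (h : ∀ t ∈ I, ∀ b, ∑ z, π t z * φ b z ≤ W t) :
    ∑ t ∈ I, φ (a t) (y t) ≤ ∑ t ∈ I, W t +
      |∑ t ∈ I, (φ (a t) (y t) - ∑ b, m b * φ b (y t))| + M * forecastBias I π y := by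
  have hmean : ∀ t ∈ I, ∑ z, π t z * ∑ b, m b * φ b z ≤ W t := fun t ht => by
    have hswap : ∑ z, π t z * ∑ b, m b * φ b z = ∑ b, m b * ∑ z, π t z * φ b z := by
      simp only [Finset.mul_sum, mul_left_comm (m _)]
      exact Finset.sum_comm
    rw [hswap]
    exact sum_weight_mul_le hm (h t ht)
  have hbias := abs_le.1 (abs_sum_forecast_sub_le I π y fun z =>
    abs_sum_weight_mul_le hm fun b => hφ b z)
  have htarget := Finset.sum_le_sum hmean
  have hgap := le_abs_self (∑ t ∈ I, (φ (a t) (y t) - ∑ b, m b * φ b (y t)))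
  simp only [Finset.sum_sub_distrib] at hbias hgap ⊢
  linarith

end Rounds

namespace StageGame

variable {A P Y : Type*}

/-! ## Information gaps and contexts -/

section Contexts

variable {T : ℕ}

lemma roundsWith_eq_filter [DecidableEq P] [DecidableEq A] (r : Fin T → A) (p : Fin T → P)
    (x : P × A) :
    roundsWith r p x.2 x.1 = Finset.univ.filter fun t => (p t, r t) = x := by
  ext t; simp [roundsWith, Prod.ext_iff]

variable [Fintype A]

lemma empirical_mem_stdSimplex {I : Finset (Fin T)} (hI : I.Nonempty) (a : Fin T → A) :
    empirical I a ∈ stdSimplex ℝ A := by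
  classical
  refine ⟨fun b => by unfold empirical; positivity, ?_⟩
  simp only [empirical]
  rw [← Finset.sum_div, div_eq_one_iff_eq (by exact_mod_cast hI.card_pos.ne')]
  norm_cast
  rw [Finset.card_eq_sum_card_fiberwise (f := a) (t := Finset.univ) (by simp)]

/-- How much the total of `f` over the rounds in `I` deviates from its value when the actions are
replaced by their empirical distribution: the quantity that `NoSecretInfo` bounds. -/
noncomputable def infoGap (f : A → Y → ℝ) (y : ℕ → Y) (I : Finset (Fin T)) (a : Fin T → A) : ℝ :=
  |∑ t ∈ I, (f (a t) (y t) - ∑ b, empirical I a b * f b (y t))|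

lemma infoGap_neg (f : A → Y → ℝ) (y : ℕ → Y) (I : Finset (Fin T)) (a : Fin T → A) :
    infoGap (fun b z => -f b z) y I a = infoGap f y I a := by
  rw [infoGap, infoGap, ← abs_neg, ← Finset.sum_neg_distrib]
  refine congrArg abs (Finset.sum_congr rfl fun t _ => ?_)
  simp only [mul_neg, Finset.sum_neg_distrib]
  ring

lemma infoGap_add_const_mul_le (f g : A → Y → ℝ) {k : ℝ} (hk : 0 ≤ k) (y : ℕ → Y)
    (I : Finset (Fin T)) (a : Fin T → A) :
    infoGap (fun b z => f b z + k * g b z) y I a ≤ infoGap f y I a + k * infoGap g y I a := by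
  have hsplit : ∑ t ∈ I, (f (a t) (y t) + k * g (a t) (y t) -
        ∑ b, empirical I a b * (f b (y t) + k * g b (y t))) =
      ∑ t ∈ I, (f (a t) (y t) - ∑ b, empirical I a b * f b (y t)) +
        k * ∑ t ∈ I, (g (a t) (y t) - ∑ b, empirical I a b * g b (y t)) := by
    rw [Finset.mul_sum, ← Finset.sum_add_distrib]
    refine Finset.sum_congr rfl fun t _ => ?_
    simp only [mul_add, Finset.sum_add_distrib, mul_sub, Finset.mul_sum, mul_left_comm k]
    ring
  simp only [infoGap]
  rw [hsplit]
  refine (abs_add_le _ _).trans_eq ?_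
  rw [abs_mul, abs_of_nonneg hk]

lemma sum_sqrt_card_roundsWith_le (Q : Finset P) (r : Fin T → A) (p : Fin T → P) :
    ∑ x ∈ Q ×ˢ (Finset.univ : Finset A), √((roundsWith r p x.2 x.1).card : ℝ) ≤
      √((Q.card * Fintype.card A : ℝ) * T) := by
  classical
  refine (sum_sqrt_le_sqrt_card_mul_sum _ fun _ _ => by positivity).trans (Real.sqrt_le_sqrt ?_)
  rw [Finset.card_product, Finset.card_univ, Nat.cast_mul]
  refine mul_le_mul_of_nonneg_left ?_ (by positivity)
  norm_cast
  simp only [roundsWith_eq_filter]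
  rw [Finset.sum_card_fiberwise_eq_card_filter]
  exact (Finset.card_filter_le _ _).trans (by simp)

lemma sum_roundsWith {Q : Finset P} (r : Fin T → A) {p : Fin T → P} (hp : ∀ t, p t ∈ Q)
    (f : Fin T → ℝ) :
    ∑ x ∈ Q ×ˢ (Finset.univ : Finset A), ∑ t ∈ roundsWith r p x.2 x.1, f t = ∑ t, f t := by
  classical
  simp only [roundsWith_eq_filter]
  exact Finset.sum_fiberwise_of_maps_to (by simp [hp]) f

end Contexts

/-! ## The learning Agent -/

section LearningAgent

variable {G : StageGame A P Y} {L : Learner A P Y} {y : ℕ → Y} {T : ℕ}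

lemma average_deviationGain_le_one (hU : ∀ a p y, G.agentUtil a p y ∈ Set.Icc (0 : ℝ) 1)
    (r : Fin T → A) (p : Fin T → P) (a : Fin T → A) (h : P → A → A → A) :
    (1 / (T : ℝ)) * ∑ t : Fin T,
      (G.agentUtil (h (p t) (r t) (a t)) (p t) (y t) - G.agentUtil (a t) (p t) (y t)) ≤ 1 := by
  have hdev := (average_mem_Icc fun t : Fin T => hU (h (p t) (r t) (a t)) (p t) (y t)).2
  have hplay := (average_mem_Icc fun t : Fin T => hU (a t) (p t) (y t)).1
  rw [Finset.sum_sub_distrib, mul_sub]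
  linarith

lemma average_deviationGain_le_iSup (hU : ∀ a p y, G.agentUtil a p y ∈ Set.Icc (0 : ℝ) 1)
    (r : Fin T → A) (p : Fin T → P) (a : Fin T → A) (h : P → A → A → A) :
    (1 / (T : ℝ)) * ∑ t : Fin T,
        (G.agentUtil (h (p t) (r t) (a t)) (p t) (y t) - G.agentUtil (a t) (p t) (y t)) ≤
      ⨆ h : P → A → A → A, (1 / (T : ℝ)) * ∑ t : Fin T,
        (G.agentUtil (h (p t) (r t) (a t)) (p t) (y t) - G.agentUtil (a t) (p t) (y t)) := by
  refine le_ciSup_of_le ⟨1, ?_⟩ h le_rfl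
  rintro _ ⟨h', rfl⟩
  exact average_deviationGain_le_one hU r p a h'

lemma swapReg_mem_Icc (hU : ∀ a p y, G.agentUtil a p y ∈ Set.Icc (0 : ℝ) 1) (r : Fin T → A)
    (p : Fin T → P) : G.swapReg L y T r p ∈ Set.Icc (0 : ℝ) 1 := by
  refine expect_mem_Icc _ fun a => ⟨?_, ?_⟩
  · simpa using average_deviationGain_le_iSup (y := y) hU r p a fun _ _ b => b
  · have : Nonempty (P → A → A → A) := ⟨fun _ _ b => b⟩
    exact ciSup_le fun h => average_deviationGain_le_one hU r p a h

lemma expect_obedienceGain_le [Finite A]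
    (hU : ∀ a p y, G.agentUtil a p y ∈ Set.Icc (0 : ℝ) 1) (hT : 0 < T)
    (r : Fin T → A) (p : Fin T → P) :
    expect (actionLaw L y T r p) (fun a => ∑ t : Fin T,
      (G.agentUtil (r t) (p t) (y t) - G.agentUtil (a t) (p t) (y t))) ≤
      T * G.swapReg L y T r p := by
  have hT' : (0 : ℝ) < T := by exact_mod_cast hT
  rw [swapReg, ← expect_const_mul]
  refine expect_mono _ (.of_finite _) (.of_finite _) fun a _ => ?_
  rw [← div_le_iff₀' hT', ← one_div_mul_eq_div]
  exact average_deviationGain_le_iSup hU r p a fun _ r _ => r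

variable [Fintype A] {r : Fin T → A} {p : Fin T → P}

lemma expect_sum_infoGap_le {Q : Finset P} {f : A → P → Y → ℝ} {K : ℝ} (hK : 0 ≤ K)
    (hf : ∀ p' r', expect (actionLaw L y T r p)
      (infoGap (fun b => f b p') y (roundsWith r p r' p')) ≤
        K * √((roundsWith r p r' p').card : ℝ)) :
    expect (actionLaw L y T r p) (fun a => ∑ x ∈ Q ×ˢ (Finset.univ : Finset A),
        infoGap (fun b => f b x.1) y (roundsWith r p x.2 x.1) a) ≤
      K * √((Q.card * Fintype.card A : ℝ) * T) := by
  rw [expect_sum _ _ fun _ _ => .of_finite _]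
  refine (Finset.sum_le_sum fun x _ => hf x.1 x.2).trans ?_
  rw [← Finset.mul_sum]
  exact mul_le_mul_of_nonneg_left (sum_sqrt_card_roundsWith_le Q r p) hK

variable [Fintype Y] {π : Fin T → stdSimplex ℝ Y} {g : A → P → Y → ℝ} {k : ℝ}
  {W : Fin T → ℝ}

-- The bound on single rounds is applied to the combined payoff `g + k U`, whose expectation under
-- every forecast is at most `W t + k U(r t, p t, π t)`.
lemma sum_roundsWith_payoff_le (hU : ∀ a p y, G.agentUtil a p y ∈ Set.Icc (0 : ℝ) 1)
    (hg : ∀ a p y, |g a p y| ≤ 1) (hk : 0 ≤ k)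
    (h : ∀ t b, ∑ z, π t z * g b (p t) z ≤
      W t + k * (G.U (r t) (p t) (π t) - G.U b (p t) (π t)))
    (a : Fin T → A) (p' : P) (r' : A) :
    ∑ t ∈ roundsWith r p r' p', g (a t) (p t) (y t) ≤
      ∑ t ∈ roundsWith r p r' p',
        (W t + k * (G.agentUtil (r t) (p t) (y t) - G.agentUtil (a t) (p t) (y t))) +
      (infoGap (fun b => g b p') y (roundsWith r p r' p') a +
        k * infoGap (fun b => G.agentUtil b p') y (roundsWith r p r' p') a) +
      (1 + 2 * k) * forecastBias (roundsWith r p r' p') π (fun t => y t) := by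
  set I := roundsWith r p r' p' with hI
  have hmem : ∀ t ∈ I, p t = p' ∧ r t = r' := fun t ht => by simpa [hI, roundsWith] using ht
  rcases I.eq_empty_or_nonempty with hempty | hne
  · simp [hempty, infoGap, forecastBias]
  have hUabs : ∀ b z, |G.agentUtil b p' z| ≤ 1 := fun b z =>
    abs_le.2 ⟨by linarith [(hU b p' z).1], (hU b p' z).2⟩
  have hφ : ∀ b z, |g b p' z + k * G.agentUtil b p' z| ≤ 1 + k := fun b z => by
    refine (abs_add_le _ _).trans (add_le_add (hg b p' z) ?_)
    rw [abs_mul, abs_of_nonneg hk]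
    exact mul_le_of_le_one_right hk (hUabs b z)
  have htarget : ∀ t ∈ I, ∀ b, ∑ z, π t z * (g b p' z + k * G.agentUtil b p' z) ≤
      W t + k * ∑ z, π t z * G.agentUtil r' p' z := fun t ht b => by
    have ht := hmem t ht
    have hb := h t b
    rw [ht.1, ht.2] at hb
    simp only [U] at hb
    simp only [mul_add, Finset.sum_add_distrib, mul_left_comm _ k, ← Finset.mul_sum]
    linarith
  have hpay := sum_payoff_le_sum_target I π (fun t => y t) a hφ (empirical_mem_stdSimplex hne a)
    htarget
  have hgap := infoGap_add_const_mul_le (fun b => g b p') (fun b => G.agentUtil b p') hk y I a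
  have hrec := mul_le_mul_of_nonneg_left
    (abs_le.1 (abs_sum_forecast_sub_le I π (fun t => y t) (hUabs r'))).2 hk
  have hctx : ∑ t ∈ I, (W t + k * (G.agentUtil (r t) (p t) (y t) -
      G.agentUtil (a t) (p t) (y t))) =
      ∑ t ∈ I, (W t + k * (G.agentUtil r' p' (y t) - G.agentUtil (a t) p' (y t))) :=
    Finset.sum_congr rfl fun t ht => by rw [(hmem t ht).1, (hmem t ht).2]
  rw [hctx, Finset.sum_congr rfl fun t ht => by rw [(hmem t ht).1]]
  simp only [infoGap] at hgap ⊢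
  simp only [Finset.sum_add_distrib, Finset.sum_sub_distrib, ← Finset.mul_sum] at hpay hrec hgap ⊢
  linarith

/-- The total `ℓ¹` bias of the forecasts over the contexts, i.e. the pairs of a policy in `Q` and a
recommendation. -/
noncomputable def contextBias (Q : Finset P) (r : Fin T → A) (p : Fin T → P)
    (π : Fin T → stdSimplex ℝ Y) (y : ℕ → Y) : ℝ :=
  ∑ x ∈ Q ×ˢ (Finset.univ : Finset A), forecastBias (roundsWith r p x.2 x.1) π (fun t => y t)

lemma contextBias_nonneg (Q : Finset P) (r : Fin T → A) (p : Fin T → P)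
    (π : Fin T → stdSimplex ℝ Y) (y : ℕ → Y) : 0 ≤ contextBias Q r p π y :=
  Finset.sum_nonneg fun _ _ => forecastBias_nonneg _ _ _

/-- The total error, over `T` rounds, of predicting the play of a learning Agent by obedience to the
recommendations under the forecasts: his swap regret, the information gaps (at most `K √n` on a
context with `n` rounds) and the bias of the forecasts. -/
noncomputable def behaviorError (G : StageGame A P Y) (L : Learner A P Y) (y : ℕ → Y) (Q : Finset P)
    (K : ℝ) (r : Fin T → A) (p : Fin T → P) (π : Fin T → stdSimplex ℝ Y) : ℝ :=
  T * G.swapReg L y T r p + K * √((Q.card * Fintype.card A : ℝ) * T) + 2 * contextBias Q r p π y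

lemma behaviorError_nonneg (hU : ∀ a p y, G.agentUtil a p y ∈ Set.Icc (0 : ℝ) 1) {K : ℝ}
    (hK : 0 ≤ K) (Q : Finset P) (r : Fin T → A) (p : Fin T → P) (π : Fin T → stdSimplex ℝ Y) :
    0 ≤ behaviorError G L y Q K r p π := by
  have hswap := (swapReg_mem_Icc (L := L) (y := y) hU r p).1
  have hbias := contextBias_nonneg Q r p π y
  unfold behaviorError
  positivity

lemma expect_payoff_le (hU : ∀ a p y, G.agentUtil a p y ∈ Set.Icc (0 : ℝ) 1) (hT : 0 < T)
    {Q : Finset P} (hp : ∀ t, p t ∈ Q) (hg : ∀ a p y, |g a p y| ≤ 1) {K : ℝ} (hk : 0 ≤ k)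
    (hK : 0 ≤ K)
    (h : ∀ t b, ∑ z, π t z * g b (p t) z ≤
      W t + k * (G.U (r t) (p t) (π t) - G.U b (p t) (π t)))
    (hinfoU : ∀ p' r', expect (actionLaw L y T r p)
      (infoGap (fun b => G.agentUtil b p') y (roundsWith r p r' p')) ≤
        K * √((roundsWith r p r' p').card : ℝ))
    (hinfo : ∀ p' r', expect (actionLaw L y T r p)
      (infoGap (fun b => g b p') y (roundsWith r p r' p')) ≤
        K * √((roundsWith r p r' p').card : ℝ)) :
    expect (actionLaw L y T r p) (fun a => ∑ t, g (a t) (p t) (y t)) ≤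
      ∑ t, W t + (k + 1) * behaviorError G L y Q K r p π := by
  set μ := actionLaw L y T r p
  set X := Q ×ˢ (Finset.univ : Finset A)
  set gapU := fun a : Fin T → A => ∑ x ∈ X, infoGap (fun b => G.agentUtil b x.1) y
    (roundsWith r p x.2 x.1) a
  set gap := fun a : Fin T → A => ∑ x ∈ X, infoGap (fun b => g b x.1) y
    (roundsWith r p x.2 x.1) a
  set gain := fun a : Fin T → A => ∑ t : Fin T,
    (G.agentUtil (r t) (p t) (y t) - G.agentUtil (a t) (p t) (y t))
  have hpoint : ∀ a : Fin T → A, ∑ t, g (a t) (p t) (y t) ≤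
      (∑ t, W t + (1 + 2 * k) * contextBias Q r p π y) + (k * gain a + (gap a + k * gapU a)) := by
    intro a
    have hctx := Finset.sum_le_sum fun x (_ : x ∈ X) =>
      sum_roundsWith_payoff_le (y := y) hU hg hk h a x.1 x.2
    simp only [Finset.sum_add_distrib (s := X), X, sum_roundsWith r hp] at hctx
    simp only [Finset.sum_add_distrib, ← Finset.mul_sum] at hctx
    simp only [contextBias, gain, gap, gapU, X]
    linarith
  have hexp := expect_mono μ (.of_finite _) (.of_finite _) fun a _ => hpoint a
  rw [expect_add μ (.of_finite _) (.of_finite _), expect_const,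
    expect_add μ (.of_finite _) (.of_finite _), expect_add μ (.of_finite _) (.of_finite _),
    expect_const_mul, expect_const_mul] at hexp
  have hgain : k * expect μ gain ≤ k * (T * G.swapReg L y T r p) :=
    mul_le_mul_of_nonneg_left (expect_obedienceGain_le hU hT r p) hk
  have hgapU : k * expect μ gapU ≤ k * (K * √((Q.card * Fintype.card A : ℝ) * T)) :=
    mul_le_mul_of_nonneg_left (expect_sum_infoGap_le hK hinfoU) hk
  have hgap : expect μ gap ≤ K * √((Q.card * Fintype.card A : ℝ) * T) :=
    expect_sum_infoGap_le hK hinfo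
  have hswap : 0 ≤ T * G.swapReg L y T r p :=
    mul_nonneg T.cast_nonneg (swapReg_mem_Icc hU r p).1
  have hbias := contextBias_nonneg Q r p π y
  simp only [behaviorError]
  linarith

end LearningAgent

end StageGame

/-! ## The Principal's regret -/

section ExpectedBias

variable {A P Y ι : Type*} [Fintype Y] [Fintype ι] {T : ℕ}

/-- The logarithmic factor `ln(|Y||𝓔|T)` of `HasLowBias`, for a family of events indexed by `ι`. -/
noncomputable def logFactor (Y ι : Type*) [Fintype Y] [Fintype ι] (T : ℕ) : ℝ :=
  Real.log ((Fintype.card Y : ℝ) * (Fintype.card ι : ℝ) * (T : ℝ))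

lemma logFactor_nonneg (Y ι : Type*) [Fintype Y] [Fintype ι] (T : ℕ) : 0 ≤ logFactor Y ι T := by
  rw [logFactor]
  exact_mod_cast Real.log_natCast_nonneg (Fintype.card Y * Fintype.card ι * T)

lemma isBoundedFun_forecastBias (I : (Fin T → stdSimplex ℝ Y) → Finset (Fin T)) (y : ℕ → Y) :
    IsBoundedFun fun π : Fin T → stdSimplex ℝ Y => forecastBias (I π) π fun t => y t := by
  refine .of_mem_Icc (a := 0) (b := Fintype.card Y * T) fun π => ⟨forecastBias_nonneg _ _ _, ?_⟩
  refine (forecastBias_le_card_mul_card _ _ _).trans ?_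
  gcongr
  simpa using Finset.card_le_univ (I π)

open Classical in
lemma hasLowBias_iff {F : Forecaster Y} {𝓔 : ι → Set (stdSimplex ℝ Y)} {κ : ℝ} (hT : 0 < T) :
    HasLowBias F 𝓔 T κ ↔ ∀ (y : ℕ → Y) (i : ι),
      expect (forecastLaw F y T)
          (fun π => forecastBias (Finset.univ.filter fun t => π t ∈ 𝓔 i) π fun t => y t) ≤
        expect (forecastLaw F y T) (fun π => κ * Fintype.card Y * (logFactor Y ι T +
          √(logFactor Y ι T) * √((Finset.univ.filter fun t : Fin T => π t ∈ 𝓔 i).card : ℝ))) := by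
  have hT' : (0 : ℝ) < T := by exact_mod_cast hT
  refine forall₂_congr fun y i => ?_
  simp only [forecastBias, Finset.sum_filter]
  rw [expect_const_mul, one_div, inv_mul_le_iff₀ hT', ← expect_const_mul]
  refine iff_of_eq (congrArg _ (congrArg _ (funext fun π => ?_)))
  rw [← logFactor, Real.sqrt_mul (logFactor_nonneg Y ι T)]
  field_simp

variable [Fintype A]

lemma expect_contextBias_le {F : Forecaster Y} {𝓔 : ι → Set (stdSimplex ℝ Y)} {κ : ℝ}
    (hF : HasLowBias F 𝓔 T κ) (hT : 0 < T) (y : ℕ → Y) {Q : Finset P}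
    (p : (Fin T → stdSimplex ℝ Y) → Fin T → P) (r : (Fin T → stdSimplex ℝ Y) → Fin T → A)
    (h𝓔 : ∀ x ∈ Q ×ˢ (Finset.univ : Finset A), ∃ i, ∀ π t, π t ∈ 𝓔 i ↔ p π t = x.1 ∧ r π t = x.2)
    {N : ℝ} (hN : (Q.card * Fintype.card A : ℝ) ≤ N) :
    expect (forecastLaw F y T) (fun π => StageGame.contextBias Q (r π) (p π) π y) ≤
      |κ| * Fintype.card Y *
        (N * logFactor Y ι T + √(logFactor Y ι T) * √(N * T)) := by
  classical
  have hℓ := logFactor_nonneg Y ι T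
  set ℓ := logFactor Y ι T with hℓdef
  set n : (Fin T → stdSimplex ℝ Y) → P × A → ℝ := fun π x =>
    (StageGame.roundsWith (r π) (p π) x.2 x.1).card
  have hn : ∀ x, IsBoundedFun fun π => √(n π x) := fun x =>
    .of_mem_Icc (a := 0) (b := √T) fun π => ⟨Real.sqrt_nonneg _, Real.sqrt_le_sqrt <| by
      simpa [n] using Finset.card_le_univ (StageGame.roundsWith (r π) (p π) x.2 x.1)⟩
  have hbdd : ∀ c x, IsBoundedFun fun π => c * Fintype.card Y * (ℓ + √ℓ * √(n π x)) :=
    fun c x => ((IsBoundedFun.const ℓ).add ((hn x).const_mul _)).const_mul _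
  have hcontext : ∀ x ∈ Q ×ˢ (Finset.univ : Finset A),
      expect (forecastLaw F y T)
        (fun π => forecastBias (StageGame.roundsWith (r π) (p π) x.2 x.1) π fun t => y t) ≤
      expect (forecastLaw F y T) (fun π => |κ| * Fintype.card Y * (ℓ + √ℓ * √(n π x))) := by
    intro x hx
    obtain ⟨i, hi⟩ := h𝓔 x hx
    have hrounds : ∀ π : Fin T → stdSimplex ℝ Y, (Finset.univ.filter fun t => π t ∈ 𝓔 i) =
        StageGame.roundsWith (r π) (p π) x.2 x.1 := fun π => by
      ext t; simp [StageGame.roundsWith, hi]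
    have h := (hasLowBias_iff hT).1 hF y i
    simp only [hrounds, ← hℓdef] at h
    refine h.trans (expect_mono _ (hbdd κ x) (hbdd |κ| x) fun π _ => ?_)
    gcongr
    exact le_abs_self κ
  simp only [StageGame.contextBias]
  rw [expect_sum _ _ fun x _ => isBoundedFun_forecastBias _ y]
  refine (Finset.sum_le_sum hcontext).trans ?_
  rw [← expect_sum _ _ fun x _ => hbdd _ x]
  refine (expect_mono _ (.sum _ fun x _ => hbdd _ x) (.const _) fun π _ => ?_).trans
    (expect_const _ _).le
  rw [← Finset.mul_sum, Finset.sum_add_distrib, ← Finset.mul_sum]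
  have hlog : ∑ _x ∈ Q ×ˢ (Finset.univ : Finset A), ℓ ≤ N * ℓ := by
    rw [Finset.sum_const, nsmul_eq_mul, Finset.card_product, Finset.card_univ, Nat.cast_mul]
    exact mul_le_mul_of_nonneg_right hN hℓ
  have hsqrt : ∑ x ∈ Q ×ˢ (Finset.univ : Finset A), √(n π x) ≤ √(N * T) :=
    (StageGame.sum_sqrt_card_roundsWith_le Q (r π) (p π)).trans (by gcongr)
  gcongr

end ExpectedBias

namespace StageGame

section SecretInformation

variable {A P Y : Type*} [Fintype A] {G : StageGame A P Y} {L : Learner A P Y} {y : ℕ → Y} {T : ℕ}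

lemma NoSecretInfo.infoGap_agentUtil_le {r : Fin T → A} {p : Fin T → P} {K : ℝ}
    (h : G.NoSecretInfo L y T r p K) (p' : P) (r' : A) :
    expect (actionLaw L y T r p) (infoGap (fun b => G.agentUtil b p') y (roundsWith r p r' p')) ≤
      |K| * √((roundsWith r p r' p').card : ℝ) :=
  (h p' r').1.trans (mul_le_mul_of_nonneg_right (le_abs_self K) (Real.sqrt_nonneg _))

lemma NoSecretInfo.infoGap_principalUtil_le {r : Fin T → A} {p : Fin T → P} {K : ℝ}
    (h : G.NoSecretInfo L y T r p K) (p' : P) (r' : A) :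
    expect (actionLaw L y T r p)
        (infoGap (fun b => G.principalUtil b p') y (roundsWith r p r' p')) ≤
      |K| * √((roundsWith r p r' p').card : ℝ) :=
  (h p' r').2.trans (mul_le_mul_of_nonneg_right (le_abs_self K) (Real.sqrt_nonneg _))

end SecretInformation

section Regret

variable {A P Y : Type*} [Fintype Y] {G : StageGame A P Y} {aStar : P → stdSimplex ℝ Y → A}

lemma expectedUtil_mem_Icc {f : Y → ℝ} (hf : ∀ z, f z ∈ Set.Icc (0 : ℝ) 1) (π : stdSimplex ℝ Y) :
    ∑ z, π z * f z ∈ Set.Icc (0 : ℝ) 1 :=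
  ⟨Finset.sum_nonneg fun z _ => mul_nonneg (π.2.1 z) (hf z).1,
    sum_weight_mul_le π.2 fun z => (hf z).2⟩

lemma IsStable.principalLoss_le (hV : ∀ a p y, G.principalUtil a p y ∈ Set.Icc (0 : ℝ) 1)
    (haStar : G.IsBestResponseRule aStar) {β γ : ℝ} (hβ : 0 < β) (hγ : 0 ≤ γ) {π : stdSimplex ℝ Y}
    {p : P} (hp : G.IsStable aStar β γ π p) (b : A) :
    G.V (aStar p π) p π - G.V b p π ≤ γ + 1 / β * (G.U (aStar p π) p π - G.U b p π) := by
  have hloss : 0 ≤ 1 / β * (G.U (aStar p π) p π - G.U b p π) :=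
    mul_nonneg (by positivity) (sub_nonneg.2 ((haStar p π).1 b))
  by_cases hb : b = aStar p π
  · rw [hb]; linarith
  rcases hp b hb with hU | hVb
  · have : 1 ≤ 1 / β * (G.U (aStar p π) p π - G.U b p π) := by
      rw [one_div_mul_eq_div, le_div_iff₀ hβ]; linarith
    have hb0 : 0 ≤ G.V b p π := (expectedUtil_mem_Icc (hV b p) π).1
    have h1 : G.V (aStar p π) p π ≤ 1 := (expectedUtil_mem_Icc (hV _ p) π).2
    linarith
  · linarith

lemma IsOptimalStable.benchmarkGain_le (hV : ∀ a p y, G.principalUtil a p y ∈ Set.Icc (0 : ℝ) 1)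
    (haStar : G.IsBestResponseRule aStar) {P₀ : Set P} {c ε β γ : ℝ} (hε : 0 < ε)
    {π : stdSimplex ℝ Y} {p p₀ : P} (hp : G.IsOptimalStable aStar P₀ c ε β γ π p) (hp₀ : p₀ ∈ P₀)
    (b : A) :
    G.V b p₀ π - G.V (aStar p π) p π ≤ c + 1 / ε * (G.U (aStar p₀ π) p₀ π - G.U b p₀ π) := by
  have hloss : 0 ≤ 1 / ε * (G.U (aStar p₀ π) p₀ π - G.U b p₀ π) :=
    mul_nonneg (by positivity) (sub_nonneg.2 ((haStar p₀ π).1 b))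
  by_cases hb : b ∈ G.epsBestResponses aStar p₀ π ε
  · linarith [hp.2 p₀ hp₀ b hb]
  · have hb' : G.U b p₀ π < G.U (aStar p₀ π) p₀ π - ε := not_le.1 hb
    have : 1 ≤ 1 / ε * (G.U (aStar p₀ π) p₀ π - G.U b p₀ π) := by
      rw [one_div_mul_eq_div, le_div_iff₀ hε]; linarith
    have hb1 : G.V b p₀ π ≤ 1 := (expectedUtil_mem_Icc (hV b p₀) π).2
    have h0 : 0 ≤ G.V (aStar p₀ π) p₀ π := (expectedUtil_mem_Icc (hV _ p₀) π).1
    linarith [hp.2 p₀ hp₀ (aStar p₀ π) (by simp [epsBestResponses, hε.le])]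

variable {L : Learner A P Y} {y : ℕ → Y} {T : ℕ}

lemma avgPrincipalUtil_mem_Icc (hV : ∀ a p y, G.principalUtil a p y ∈ Set.Icc (0 : ℝ) 1)
    (π : Fin T → stdSimplex ℝ Y) (p : Fin T → P) :
    G.avgPrincipalUtil aStar L y T π p ∈ Set.Icc (0 : ℝ) 1 :=
  expect_mem_Icc _ fun _ => average_mem_Icc fun _ => hV _ _ _

lemma policyRegret_mem_Icc (hV : ∀ a p y, G.principalUtil a p y ∈ Set.Icc (0 : ℝ) 1)
    (P₀ : Finset P) (hP₀ : P₀.Nonempty) (O : stdSimplex ℝ Y → P) (π : Fin T → stdSimplex ℝ Y) :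
    G.policyRegret aStar P₀ hP₀ O L y T π ∈ Set.Icc (-1 : ℝ) 1 := by
  have havg := avgPrincipalUtil_mem_Icc (aStar := aStar) (L := L) (y := y) hV π
  refine ⟨?_, Finset.sup'_le _ _ fun p₀ _ => ?_⟩
  · obtain ⟨p₀, hp₀⟩ := hP₀
    refine le_trans ?_ (Finset.le_sup' _ hp₀)
    linarith [(havg fun _ => p₀).1, (havg fun t => O (π t)).2]
  · linarith [(havg fun _ => p₀).2, (havg fun t => O (π t)).1]

lemma expect_sum_principalUtil (hT : 0 < T) (π : Fin T → stdSimplex ℝ Y) (p : Fin T → P) :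
    expect (actionLaw L y T (recommend aStar p π) p)
        (fun a => ∑ t, G.principalUtil (a t) (p t) (y t)) =
      T * G.avgPrincipalUtil aStar L y T π p := by
  have hT' : (T : ℝ) ≠ 0 := by exact_mod_cast hT.ne'
  rw [avgPrincipalUtil, expect_const_mul, one_div, mul_inv_cancel_left₀ hT']

variable [Fintype A]

/-- The `behaviorError` of the mechanism that offers `q ρ` and recommends `aStar (q ρ) ρ` under the
forecast `ρ`. The oracle mechanism is `q = O`, a constant mechanism is `q = fun _ => p₀`. -/
noncomputable def mechanismError (G : StageGame A P Y) (aStar : P → stdSimplex ℝ Y → A)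
    (L : Learner A P Y) (y : ℕ → Y) (Q : Finset P) (K : ℝ) (q : stdSimplex ℝ Y → P)
    (π : Fin T → stdSimplex ℝ Y) : ℝ :=
  behaviorError G L y Q K (recommend aStar (fun t => q (π t)) π) (fun t => q (π t)) π

lemma sum_V_le_of_isStable (hU : ∀ a p y, G.agentUtil a p y ∈ Set.Icc (0 : ℝ) 1)
    (hV : ∀ a p y, G.principalUtil a p y ∈ Set.Icc (0 : ℝ) 1) (haStar : G.IsBestResponseRule aStar)
    {β γ K : ℝ} (hβ : 0 < β) (hγ : 0 ≤ γ) (hT : 0 < T) {Q : Finset P} {q : stdSimplex ℝ Y → P}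
    {π : Fin T → stdSimplex ℝ Y} (hq : ∀ t, q (π t) ∈ Q)
    (hstable : ∀ t, G.IsStable aStar β γ (π t) (q (π t)))
    (hinfo : G.NoSecretInfo L y T (recommend aStar (fun t => q (π t)) π) (fun t => q (π t)) K) :
    ∑ t, G.V (aStar (q (π t)) (π t)) (q (π t)) (π t) ≤
      T * G.avgPrincipalUtil aStar L y T π (fun t => q (π t)) + γ * T +
        (1 / β + 1) * mechanismError G aStar L y Q |K| q π := by
  have h := expect_payoff_le (G := G) (L := L) (y := y) (π := π) (p := fun t => q (π t))
    (r := recommend aStar (fun t => q (π t)) π) (g := fun a p z => -G.principalUtil a p z)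
    (W := fun t => γ - G.V (aStar (q (π t)) (π t)) (q (π t)) (π t)) hU hT hq
    (fun a p z => abs_le.2 ⟨by linarith [(hV a p z).2], by linarith [(hV a p z).1]⟩)
    (one_div_nonneg.2 hβ.le) (abs_nonneg K)
    (fun t b => by
      have hb := (hstable t).principalLoss_le hV haStar hβ hγ b
      simp only [mul_neg, Finset.sum_neg_distrib]
      rw [← V]
      simp only [recommend]
      linarith)
    hinfo.infoGap_agentUtil_le
    (fun p' r' => (congrArg (expect _) (funext fun a => infoGap_neg _ y _ a)).trans_le
      (hinfo.infoGap_principalUtil_le p' r'))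
  have hneg : expect (actionLaw L y T (recommend aStar (fun t => q (π t)) π) fun t => q (π t))
      (fun a => ∑ t, -G.principalUtil (a t) (q (π t)) (y t)) =
      -(T * G.avgPrincipalUtil aStar L y T π fun t => q (π t)) := by
    rw [← expect_sum_principalUtil hT, ← neg_one_mul, ← expect_const_mul]
    simp only [Finset.sum_neg_distrib, neg_one_mul]
  rw [hneg] at h
  simp only [Finset.sum_sub_distrib, Finset.sum_const, Finset.card_univ, Fintype.card_fin,
    nsmul_eq_mul] at h
  simp only [mechanismError]
  linarith

lemma benchmark_le_sum_V (hU : ∀ a p y, G.agentUtil a p y ∈ Set.Icc (0 : ℝ) 1)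
    (hV : ∀ a p y, G.principalUtil a p y ∈ Set.Icc (0 : ℝ) 1) (haStar : G.IsBestResponseRule aStar)
    {P₀ : Set P} {c ε β γ K : ℝ} (hε : 0 < ε) (hT : 0 < T) {O : stdSimplex ℝ Y → P}
    {π : Fin T → stdSimplex ℝ Y} (hO : ∀ t, G.IsOptimalStable aStar P₀ c ε β γ (π t) (O (π t)))
    {p₀ : P} (hp₀ : p₀ ∈ P₀)
    (hinfo : G.NoSecretInfo L y T (recommend aStar (fun _ => p₀) π) (fun _ => p₀) K) :
    T * G.avgPrincipalUtil aStar L y T π (fun _ => p₀) ≤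
      ∑ t, G.V (aStar (O (π t)) (π t)) (O (π t)) (π t) + c * T +
        (1 / ε + 1) * mechanismError G aStar L y {p₀} |K| (fun _ => p₀) π := by
  have h := expect_payoff_le (G := G) (L := L) (y := y) (π := π) (p := fun _ => p₀) (Q := {p₀})
    (r := recommend aStar (fun _ => p₀) π) (g := G.principalUtil)
    (W := fun t => c + G.V (aStar (O (π t)) (π t)) (O (π t)) (π t)) hU hT
    (fun _ => Finset.mem_singleton_self _)
    (fun a p z => abs_le.2 ⟨by linarith [(hV a p z).1], (hV a p z).2⟩)
    (one_div_nonneg.2 hε.le) (abs_nonneg K)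
    (fun t b => by
      have hb := (hO t).benchmarkGain_le hV haStar hε hp₀ b
      rw [← V]
      simp only [recommend]
      linarith)
    hinfo.infoGap_agentUtil_le hinfo.infoGap_principalUtil_le
  rw [expect_sum_principalUtil hT] at h
  simp only [Finset.sum_add_distrib, Finset.sum_const, Finset.card_univ, Fintype.card_fin,
    nsmul_eq_mul] at h
  simp only [mechanismError]
  linarith

lemma isBoundedFun_mechanismError (hU : ∀ a p y, G.agentUtil a p y ∈ Set.Icc (0 : ℝ) 1)
    (Q : Finset P) (K : ℝ) (q : stdSimplex ℝ Y → P) :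
    IsBoundedFun fun π : Fin T → stdSimplex ℝ Y => mechanismError G aStar L y Q K q π :=
  ((IsBoundedFun.const_mul _ (.of_mem_Icc fun _ => swapReg_mem_Icc hU _ _)).add (.const _)).add
    (.const_mul _ (.sum _ fun _ _ => isBoundedFun_forecastBias _ y))

lemma expect_mechanismError_le (hU : ∀ a p y, G.agentUtil a p y ∈ Set.Icc (0 : ℝ) 1)
    {F : Forecaster Y} {Q : Finset P} {K : ℝ} (hK : 0 ≤ K) {q : stdSimplex ℝ Y → P} {εs N B : ℝ}
    (hN : (Q.card * Fintype.card A : ℝ) ≤ N)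
    (hswap : expect (forecastLaw F y T) (fun π =>
      G.swapReg L y T (recommend aStar (fun t => q (π t)) π) fun t => q (π t)) ≤ εs)
    (hbias : expect (forecastLaw F y T) (fun π =>
      contextBias Q (recommend aStar (fun t => q (π t)) π) (fun t => q (π t)) π y) ≤ B) :
    expect (forecastLaw F y T) (mechanismError G aStar L y Q K q) ≤
      T * εs + K * √(N * T) + 2 * B := by
  unfold mechanismError behaviorError
  have bddSwap : IsBoundedFun fun π : Fin T → stdSimplex ℝ Y =>
      G.swapReg L y T (recommend aStar (fun t => q (π t)) π) fun t => q (π t) :=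
    .of_mem_Icc fun _ => swapReg_mem_Icc hU _ _
  have bddBias : IsBoundedFun fun π : Fin T → stdSimplex ℝ Y =>
      contextBias Q (recommend aStar (fun t => q (π t)) π) (fun t => q (π t)) π y :=
    .sum _ fun _ _ => isBoundedFun_forecastBias _ y
  rw [expect_add _ ((bddSwap.const_mul _).add (.const _)) (bddBias.const_mul _),
    expect_add _ (bddSwap.const_mul _) (.const _), expect_const_mul, expect_const_mul _ 2,
    expect_const]
  gcongr

lemma policyRegret_le (hU : ∀ a p y, G.agentUtil a p y ∈ Set.Icc (0 : ℝ) 1)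
    (hV : ∀ a p y, G.principalUtil a p y ∈ Set.Icc (0 : ℝ) 1) (haStar : G.IsBestResponseRule aStar)
    {P₀ PO : Finset P} (hP₀ : P₀.Nonempty) {O : stdSimplex ℝ Y → P} {c ε β γ K : ℝ} (hε : 0 < ε)
    (hβ : 0 < β) (hγ : 0 ≤ γ) (hO : G.IsOptimalStableOracle aStar P₀ c ε β γ PO O) (hT : 0 < T)
    {π : Fin T → stdSimplex ℝ Y}
    (hinfoO : G.NoSecretInfo L y T (recommend aStar (fun t => O (π t)) π) (fun t => O (π t)) K)
    (hinfo : ∀ p₀ ∈ P₀, G.NoSecretInfo L y T (recommend aStar (fun _ => p₀) π) (fun _ => p₀) K) :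
    G.policyRegret aStar P₀ hP₀ O L y T π ≤ (c + γ) +
      (1 / T * (1 / β + 1) * mechanismError G aStar L y PO |K| O π +
        1 / T * (1 / ε + 1) *
          ∑ p₀ ∈ P₀, mechanismError G aStar L y {p₀} |K| (fun _ => p₀) π) := by
  refine Finset.sup'_le _ _ fun p₀ hp₀ => ?_
  have hT' : (0 : ℝ) < T := by exact_mod_cast hT
  have hdeployed := sum_V_le_of_isStable hU hV haStar hβ hγ hT (fun t => (hO (π t)).1)
    (fun t => (hO (π t)).2.1) hinfoO
  have hbenchmark := benchmark_le_sum_V hU hV haStar hε hT (fun t => (hO (π t)).2)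
    (Finset.mem_coe.2 hp₀) (hinfo p₀ hp₀)
  have herror : (1 / ε + 1) * mechanismError G aStar L y {p₀} |K| (fun _ => p₀) π ≤
      (1 / ε + 1) * ∑ p₀ ∈ P₀, mechanismError G aStar L y {p₀} |K| (fun _ => p₀) π :=
    mul_le_mul_of_nonneg_left (Finset.single_le_sum
      (f := fun p₀ => mechanismError G aStar L y {p₀} |K| (fun _ => p₀) π)
      (fun _ _ => behaviorError_nonneg hU (abs_nonneg K) _ _ _ _) hp₀) (by positivity)
  refine le_of_mul_le_mul_left ?_ hT'
  rw [mul_add (T : ℝ), mul_add (T : ℝ) (_ * _), mul_assoc (1 / (T : ℝ)), mul_assoc (1 / (T : ℝ)),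
    one_div (T : ℝ), mul_inv_cancel_left₀ hT'.ne', mul_inv_cancel_left₀ hT'.ne']
  linarith

lemma principalRegret_le_of_mechanismError_le (hU : ∀ a p y, G.agentUtil a p y ∈ Set.Icc (0 : ℝ) 1)
    (hV : ∀ a p y, G.principalUtil a p y ∈ Set.Icc (0 : ℝ) 1) (haStar : G.IsBestResponseRule aStar)
    {P₀ PO : Finset P} (hP₀ : P₀.Nonempty) {O : stdSimplex ℝ Y → P} {c ε β γ : ℝ} (hε : 0 < ε)
    (hβ : 0 < β) (hγ : 0 ≤ γ) (hO : G.IsOptimalStableOracle aStar P₀ c ε β γ PO O) (hT : 0 < T)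
    {F : Forecaster Y} {κn : ℝ} (hn : G.NoSecretInformation aStar P₀ O F L y T κn) {E : ℝ}
    (hO_error : expect (forecastLaw F y T) (mechanismError G aStar L y PO |κn| O) ≤ E)
    (hconst_error : ∀ p₀ ∈ P₀,
      expect (forecastLaw F y T) (mechanismError G aStar L y {p₀} |κn| fun _ => p₀) ≤ E) :
    G.principalRegret aStar P₀ hP₀ O F L y T ≤ c + γ +
      ((1 / β + 1) + P₀.card * (1 / ε + 1)) * (E / T) := by
  set μ := forecastLaw F y T
  have hsum_error : ∑ p₀ ∈ P₀, expect μ (mechanismError G aStar L y {p₀} |κn| fun _ => p₀) ≤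
      P₀.card * E := by
    rw [← nsmul_eq_mul]
    exact Finset.sum_le_card_nsmul _ _ _ hconst_error
  have bddO := isBoundedFun_mechanismError (T := T) (aStar := aStar) (L := L) (y := y) hU PO |κn| O
  have bddConst : ∀ p₀ ∈ P₀, IsBoundedFun fun π : Fin T → stdSimplex ℝ Y =>
      mechanismError G aStar L y {p₀} |κn| (fun _ => p₀) π :=
    fun p₀ _ => isBoundedFun_mechanismError hU _ _ _
  have bddSum := IsBoundedFun.sum P₀ bddConst
  calc G.principalRegret aStar P₀ hP₀ O F L y T
      ≤ expect μ fun π => (c + γ) +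
          (1 / T * (1 / β + 1) * mechanismError G aStar L y PO |κn| O π + 1 / T * (1 / ε + 1) *
            ∑ p₀ ∈ P₀, mechanismError G aStar L y {p₀} |κn| (fun _ => p₀) π) :=
        expect_mono μ (.of_mem_Icc fun π => policyRegret_mem_Icc hV P₀ hP₀ O π)
          ((IsBoundedFun.const _).add ((bddO.const_mul _).add (bddSum.const_mul _))) fun π hπ =>
            policyRegret_le hU hV haStar hP₀ hε hβ hγ hO hT (hn π hπ).1 (hn π hπ).2
    _ = (c + γ) + (1 / T * (1 / β + 1) * expect μ (mechanismError G aStar L y PO |κn| O) +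
          1 / T * (1 / ε + 1) *
            ∑ p₀ ∈ P₀, expect μ (mechanismError G aStar L y {p₀} |κn| fun _ => p₀)) := by
        rw [expect_add μ (.const _) ((bddO.const_mul _).add (bddSum.const_mul _)), expect_const,
          expect_add μ (bddO.const_mul _) (bddSum.const_mul _), expect_const_mul, expect_const_mul,
          expect_sum μ P₀ bddConst]
    _ ≤ (c + γ) + (1 / T * (1 / β + 1) * E +
          1 / T * (1 / ε + 1) * (P₀.card * E)) := by gcongr
    _ = _ := by ring

lemma principalRegret_le (hU : ∀ a p y, G.agentUtil a p y ∈ Set.Icc (0 : ℝ) 1)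
    (hV : ∀ a p y, G.principalUtil a p y ∈ Set.Icc (0 : ℝ) 1) (haStar : G.IsBestResponseRule aStar)
    {P₀ PO : Finset P} (hP₀ : P₀.Nonempty) {O : stdSimplex ℝ Y → P} {c ε β γ : ℝ} (hε : 0 < ε)
    (hβ : 0 < β) (hγ : 0 ≤ γ) (hO : G.IsOptimalStableOracle aStar P₀ c ε β γ PO O)
    {pOpt : stdSimplex ℝ Y → P} {aOpt : stdSimplex ℝ Y → A} {F : Forecaster Y} (hT : 0 < T)
    {κ : ℝ} (hF : HasLowBias F (events aStar P₀ PO O pOpt aOpt) T κ) {εs κn : ℝ}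
    (hs : G.NoSwapRegret aStar P₀ O F L y T εs)
    (hn : G.NoSecretInformation aStar P₀ O F L y T κn) {ℓ N : ℝ}
    (hℓ : logFactor Y (((PO × A) ⊕ (P₀ × A)) ⊕ (P₀ × A)) T = ℓ)
    (hN : (PO.card * Fintype.card A : ℝ) = N) :
    G.principalRegret aStar P₀ hP₀ O F L y T ≤ c + γ +
      ((1 / β + 1) + P₀.card * (1 / ε + 1)) *
        ((T * εs + |κn| * √(N * T) +
          2 * (|κ| * Fintype.card Y * (N * ℓ + √ℓ * √(N * T)))) / T) := by
  set μ := forecastLaw F y T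
  set B := |κ| * Fintype.card Y * (N * ℓ + √ℓ * √(N * T)) with hB
  have hN₀ : ∀ p₀ : P, (({p₀} : Finset P).card * Fintype.card A : ℝ) ≤ N := fun p₀ => by
    obtain ⟨π, _⟩ := μ.support_nonempty
    have hPO : 0 < PO.card := Finset.card_pos.2 ⟨_, (hO (π ⟨0, hT⟩)).1⟩
    rw [← hN, Finset.card_singleton]
    gcongr
    exact_mod_cast hPO
  have hO_error : expect μ (mechanismError G aStar L y PO |κn| O) ≤
      T * εs + |κn| * √(N * T) + 2 * B :=
    expect_mechanismError_le hU (abs_nonneg κn) hN.le hs.1 <| by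
      rw [hB, ← hℓ]
      exact expect_contextBias_le hF hT y _ _ (fun x hx =>
        ⟨.inl (.inl (⟨x.1, (Finset.mem_product.1 hx).1⟩, x.2)), fun π t => Iff.rfl⟩) hN.le
  have hconst_error : ∀ p₀ ∈ P₀,
      expect μ (mechanismError G aStar L y {p₀} |κn| fun _ => p₀) ≤
        T * εs + |κn| * √(N * T) + 2 * B := fun p₀ hp₀ =>
    expect_mechanismError_le hU (abs_nonneg κn) (hN₀ p₀) (hs.2 p₀ hp₀) <| by
      rw [hB, ← hℓ]
      refine expect_contextBias_le hF hT y _ _ (fun x hx =>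
        ⟨.inr (⟨p₀, hp₀⟩, x.2), fun π t => ?_⟩) (hN₀ p₀)
      have hx₁ : p₀ = x.1 := (Finset.mem_singleton.1 (Finset.mem_product.1 hx).1).symm
      simp [events, recommend, ← hx₁]
  exact principalRegret_le_of_mechanismError_le hU hV haStar hP₀ hε hβ hγ hO hT hn hO_error
    hconst_error

end Regret

end StageGame

/-! ## A forecasting algorithm for binary states -/

section Bind

variable {W X Z : Type*} {f : Z → ℝ}

lemma expect_pure (z : Z) (f : Z → ℝ) : expect (PMF.pure z) f = f z := by
  rw [expect, tsum_eq_single z fun x hx => by simp [PMF.pure_apply, hx]]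
  simp

lemma expect_bind (μ : PMF X) (k : X → PMF Z) (hf : IsBoundedFun f) :
    expect (μ.bind k) f = expect μ fun x => expect (k x) f := by
  obtain ⟨M, hM⟩ := hf
  have hprob : Summable fun w : X × Z => (μ w.1).toReal * (k w.1 w.2).toReal := by
    have hone : ∀ x, ∑' z, (k x z).toReal = 1 := fun x => by
      rw [← ENNReal.tsum_toReal_eq fun z => (k x).apply_ne_top z, (k x).tsum_coe,
        ENNReal.toReal_one]
    refine (summable_prod_of_nonneg fun w => mul_nonneg ENNReal.toReal_nonneg
      ENNReal.toReal_nonneg).2 ⟨fun x =>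
        (ENNReal.summable_toReal (k x).tsum_coe_ne_top).mul_left (μ x).toReal, ?_⟩
    simpa only [tsum_mul_left, hone, mul_one] using ENNReal.summable_toReal μ.tsum_coe_ne_top
  have hsum : Summable fun w : X × Z => (μ w.1).toReal * (k w.1 w.2).toReal * f w.2 := by
    refine (hprob.mul_right M).of_norm_bounded fun w => ?_
    have hw : 0 ≤ (μ w.1).toReal * (k w.1 w.2).toReal :=
      mul_nonneg ENNReal.toReal_nonneg ENNReal.toReal_nonneg
    rw [Real.norm_eq_abs, abs_mul, abs_of_nonneg hw]
    exact mul_le_mul_of_nonneg_left (hM w.2) hw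
  calc expect (μ.bind k) f
      = ∑' z, ∑' x, (μ x).toReal * (k x z).toReal * f z := tsum_congr fun z => by
        rw [PMF.bind_apply, ENNReal.tsum_toReal_eq fun x =>
          ENNReal.mul_ne_top (μ.apply_ne_top x) ((k x).apply_ne_top z), ← tsum_mul_right]
        simp only [ENNReal.toReal_mul]
    _ = ∑' x, ∑' z, (μ x).toReal * (k x z).toReal * f z := hsum.tsum_comm
    _ = expect μ fun x => expect (k x) f := tsum_congr fun x => by
        simp only [expect, mul_assoc, tsum_mul_left]

lemma IsBoundedFun.expect_comp (hf : IsBoundedFun f) (k : X → PMF W) (φ : X → W → Z) :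
    IsBoundedFun fun x => expect (k x) fun w => f (φ x w) := by
  obtain ⟨M, hM⟩ := hf
  exact .of_mem_Icc fun x => expect_mem_Icc (k x) fun w => abs_le.1 (hM (φ x w))

lemma expect_map (μ : PMF X) (g : X → Z) (hf : IsBoundedFun f) :
    expect (μ.map g) f = expect μ fun x => f (g x) := by
  simp only [← PMF.bind_pure_comp, expect_bind μ _ hf, Function.comp_apply, expect_pure]

lemma exists_pmf_expect_eq_mix (z₁ z₂ : Z) {θ : ℝ} (hθ : θ ∈ Set.Icc (0 : ℝ) 1) :
    ∃ μ : PMF Z, ∀ f, IsBoundedFun f → expect μ f = θ * f z₁ + (1 - θ) * f z₂ := by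
  have hθ' : 0 ≤ 1 - θ := sub_nonneg.2 hθ.2
  have hsum : ∑ b : Bool, ENNReal.ofReal (bif b then θ else 1 - θ) = 1 := by
    simp [← ENNReal.ofReal_add hθ.1 hθ']
  refine ⟨(PMF.ofFintype _ hsum).map fun b => bif b then z₁ else z₂, fun f hf => ?_⟩
  rw [expect_map _ _ hf, expect, tsum_fintype, Fintype.sum_bool]
  simp [ENNReal.toReal_ofReal hθ.1, ENNReal.toReal_ofReal hθ']

lemma expect_forecastLaw_succ {Y : Type*} [Fintype Y] (F : Forecaster Y) (y : ℕ → Y) (t : ℕ)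
    {f : (Fin (t + 1) → stdSimplex ℝ Y) → ℝ} (hf : IsBoundedFun f) :
    expect (forecastLaw F y (t + 1)) f = expect (forecastLaw F y t) fun π =>
      expect (F t (fun i => y i) π) fun q => f (Fin.snoc (α := fun _ => stdSimplex ℝ Y) π q) := by
  simp only [forecastLaw, expect_bind _ _ hf, expect_map _ _ hf]

end Bind

section Calibration

lemma exists_forecast_eq {r : ℝ} (hr : r ∈ Set.Icc (0 : ℝ) 1) :
    ∃ q : stdSimplex ℝ (Fin 2), q 1 = r :=
  ⟨⟨![1 - r, r], Fin.forall_fin_two.2 ⟨sub_nonneg.2 hr.2, hr.1⟩, by simp⟩, rfl⟩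

lemma exists_lt_neg_and_succ_nonneg {a : ℕ → ℝ} {m : ℕ} (h0 : a 0 < 0) (hm : 0 ≤ a m) :
    ∃ k < m, a k < 0 ∧ 0 ≤ a (k + 1) := by
  classical
  have hex : ∃ k, 0 ≤ a k := ⟨m, hm⟩
  have hpos : Nat.find hex ≠ 0 := fun h => (h ▸ Nat.find_spec hex).not_gt h0
  obtain ⟨k, hk⟩ := Nat.exists_eq_succ_of_ne_zero hpos
  refine ⟨k, ?_, not_le.1 (Nat.find_min hex (by omega)), ?_⟩
  · have := Nat.find_min' hex hm
    omega
  · simpa only [hk] using Nat.find_spec hex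

lemma exists_calibrating_mixture (g : stdSimplex ℝ (Fin 2) → ℝ) {B : ℝ} (hg : ∀ q, |g q| ≤ B)
    {m : ℕ} (hm : 0 < m) :
    ∃ (q₁ q₂ : stdSimplex ℝ (Fin 2)) (θ : ℝ), θ ∈ Set.Icc (0 : ℝ) 1 ∧
      ∀ z ∈ Set.Icc (0 : ℝ) 1,
        θ * (g q₁ * (q₁ 1 - z)) + (1 - θ) * (g q₂ * (q₂ 1 - z)) ≤ B / m := by
  have hm' : (0 : ℝ) < m := by exact_mod_cast hm
  have hmem : ∀ k ≤ m, (k / m : ℝ) ∈ Set.Icc (0 : ℝ) 1 := fun k hk =>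
    ⟨by positivity, (div_le_one hm').2 (by exact_mod_cast hk)⟩
  choose! q hq using fun k hk => exists_forecast_eq (hmem k hk)
  have hBm : 0 ≤ B / m := div_nonneg ((abs_nonneg _).trans (hg (q 0))) hm'.le
  rcases le_or_gt 0 (g (q 0)) with h0 | h0
  · refine ⟨q 0, q 0, 1, by simp, fun z hz => ?_⟩
    rw [hq 0 m.zero_le, Nat.cast_zero, zero_div]
    linarith [mul_nonneg h0 hz.1]
  rcases lt_or_ge (g (q m)) 0 with h1 | h1
  · refine ⟨q m, q m, 1, by simp, fun z hz => ?_⟩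
    rw [hq m le_rfl, div_self hm'.ne']
    linarith [mul_nonneg (neg_nonneg.2 h1.le) (sub_nonneg.2 hz.2)]
  obtain ⟨k, hkm, hneg, hnonneg⟩ := exists_lt_neg_and_succ_nonneg (a := fun k => g (q k)) h0 h1
  set a := -g (q k) with ha
  set b := g (q (k + 1)) with hb
  have hab : 0 < a + b := by linarith
  have ha1 : a / (a + b) ≤ 1 := (div_le_one hab).2 (by linarith)
  refine ⟨q (k + 1), q k, a / (a + b), ⟨div_nonneg (by linarith) hab.le, ha1⟩, fun z _ => ?_⟩
  have hmix : a / (a + b) * (b * ((k + 1 : ℕ) / m - z)) +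
      (1 - a / (a + b)) * (-a * (k / m - z)) = a / (a + b) * (b / m) := by
    push_cast
    field_simp
    ring
  rw [hq k hkm.le, hq _ hkm, ← hb, show g (q k) = -a by rw [ha, neg_neg], hmix]
  refine (mul_le_of_le_one_left (by positivity) ha1).trans ?_
  gcongr
  exact (le_abs_self _).trans (hg _)

lemma abs_forecast_sub_le_one (q : stdSimplex ℝ (Fin 2)) {z : ℝ} (hz : z ∈ Set.Icc (0 : ℝ) 1) :
    |q 1 - z| ≤ 1 := by
  have h0 : 0 ≤ q 1 := q.2.1 1
  have h1 : q 1 ≤ 1 := stdSimplex.le_one q 1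
  exact abs_le.2 ⟨by linarith [hz.2], by linarith [hz.1]⟩

lemma isBoundedFun_mul_forecast_sub {g : stdSimplex ℝ (Fin 2) → ℝ} (hg : IsBoundedFun g) {z : ℝ}
    (hz : z ∈ Set.Icc (0 : ℝ) 1) : IsBoundedFun fun q => g q * (q 1 - z) := by
  obtain ⟨B, hB⟩ := hg
  refine ⟨B, fun q => ?_⟩
  rw [abs_mul]
  exact (mul_le_of_le_one_right (abs_nonneg _) (abs_forecast_sub_le_one q hz)).trans (hB q)

lemma exists_calibrating_pmf (g : stdSimplex ℝ (Fin 2) → ℝ) {B : ℝ} (hg : ∀ q, |g q| ≤ B)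
    {m : ℕ} (hm : 0 < m) :
    ∃ μ : PMF (stdSimplex ℝ (Fin 2)), ∀ z ∈ Set.Icc (0 : ℝ) 1,
      expect μ (fun q => g q * (q 1 - z)) ≤ B / m := by
  obtain ⟨q₁, q₂, θ, hθ, hmix⟩ := exists_calibrating_mixture g hg hm
  obtain ⟨μ, hμ⟩ := exists_pmf_expect_eq_mix q₁ q₂ hθ
  exact ⟨μ, fun z hz =>
    (hμ _ (isBoundedFun_mul_forecast_sub ⟨B, hg⟩ hz)).trans_le (hmix z hz)⟩

end Calibration

section Potential

lemma exp_sub_two_mul_sq_le {x : ℝ} (hx : -(1 / 2) ≤ x) (hx' : x ≤ 1) :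
    Real.exp (x - 2 * x ^ 2) ≤ 1 + x := by
  have htaylor := (abs_le.1 (Real.abs_exp_sub_one_sub_id_le (abs_le.2 ⟨by linarith, hx'⟩))).2
  have hexp : (1 + x) * (2 * x ^ 2 + 1) ≤ (1 + x) * Real.exp (2 * x ^ 2) :=
    mul_le_mul_of_nonneg_left (Real.add_one_le_exp _) (by linarith)
  rw [Real.exp_sub, div_le_iff₀ (Real.exp_pos _)]
  linarith [mul_nonneg (sq_nonneg x) (show 0 ≤ 1 + 2 * x by linarith)]

/-- The indicator of state `1`. -/
def stateOne (y : Fin 2) : ℝ := if y = 1 then 1 else 0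

lemma stateOne_mem_Icc (y : Fin 2) : stateOne y ∈ Set.Icc (0 : ℝ) 1 := by
  unfold stateOne; split_ifs <;> simp

variable {t : ℕ}

open Classical in
/-- The number of forecasts in the event `E`. -/
noncomputable def visits (E : Set (stdSimplex ℝ (Fin 2))) (π : Fin t → stdSimplex ℝ (Fin 2)) : ℝ :=
  (Finset.univ.filter fun s => π s ∈ E).card

open Classical in
/-- The signed total bias of the forecasts of state `1` in the event `E`. -/
noncomputable def stateOneBias (E : Set (stdSimplex ℝ (Fin 2))) (y : Fin t → Fin 2)
    (π : Fin t → stdSimplex ℝ (Fin 2)) : ℝ :=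
  ∑ s with π s ∈ E, (π s 1 - stateOne (y s))

lemma visits_nonneg (E : Set (stdSimplex ℝ (Fin 2))) (π : Fin t → stdSimplex ℝ (Fin 2)) :
    0 ≤ visits E π := Nat.cast_nonneg _

lemma visits_le (E : Set (stdSimplex ℝ (Fin 2))) (π : Fin t → stdSimplex ℝ (Fin 2)) :
    visits E π ≤ t := by
  classical
  simpa [visits] using Finset.card_filter_le (Finset.univ : Finset (Fin t)) fun s => π s ∈ E

lemma abs_stateOneBias_le_visits (E : Set (stdSimplex ℝ (Fin 2))) (y : Fin t → Fin 2)
    (π : Fin t → stdSimplex ℝ (Fin 2)) : |stateOneBias E y π| ≤ visits E π := by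
  refine (Finset.abs_sum_le_sum_abs _ _).trans ?_
  simpa [visits] using Finset.sum_le_card_nsmul _ _ 1 fun s _ =>
    abs_forecast_sub_le_one (π s) (stateOne_mem_Icc (y s))

open Classical in
lemma visits_snoc (E : Set (stdSimplex ℝ (Fin 2))) (π : Fin t → stdSimplex ℝ (Fin 2))
    (q : stdSimplex ℝ (Fin 2)) :
    visits E (Fin.snoc (α := fun _ => stdSimplex ℝ (Fin 2)) π q) =
      visits E π + if q ∈ E then 1 else 0 := by
  simp only [visits, ← Finset.sum_boole, Fin.sum_univ_castSucc, Fin.snoc_castSucc, Fin.snoc_last]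

open Classical in
lemma stateOneBias_snoc (E : Set (stdSimplex ℝ (Fin 2))) (y : Fin (t + 1) → Fin 2)
    (π : Fin t → stdSimplex ℝ (Fin 2)) (q : stdSimplex ℝ (Fin 2)) :
    stateOneBias E y (Fin.snoc (α := fun _ => stdSimplex ℝ (Fin 2)) π q) =
      stateOneBias E (fun i => y i.castSucc) π +
        if q ∈ E then q 1 - stateOne (y (Fin.last t)) else 0 := by
  simp only [stateOneBias, Finset.sum_filter, Fin.sum_univ_castSucc, Fin.snoc_castSucc,
    Fin.snoc_last]

/-- The exponential weight of the event `E` at the learning rate `l`. The quadratic correction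
makes the weights supermartingale-like under calibrated forecasts. -/
noncomputable def expWeight (E : Set (stdSimplex ℝ (Fin 2))) (l : ℝ) (y : Fin t → Fin 2)
    (π : Fin t → stdSimplex ℝ (Fin 2)) : ℝ :=
  Real.exp (l * stateOneBias E y π - 2 * l ^ 2 * visits E π)

lemma expWeight_pos (E : Set (stdSimplex ℝ (Fin 2))) (l : ℝ) (y : Fin t → Fin 2)
    (π : Fin t → stdSimplex ℝ (Fin 2)) : 0 < expWeight E l y π := Real.exp_pos _

lemma expWeight_le (E : Set (stdSimplex ℝ (Fin 2))) {l : ℝ} (hl : |l| ≤ 1 / 2) (y : Fin t → Fin 2)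
    (π : Fin t → stdSimplex ℝ (Fin 2)) : expWeight E l y π ≤ Real.exp (1 / 2 * t) := by
  have hbias : l * stateOneBias E y π ≤ 1 / 2 * t := by
    refine (le_abs_self _).trans ?_
    rw [abs_mul]
    gcongr
    exact (abs_stateOneBias_le_visits E y π).trans (visits_le E π)
  have hvisits := mul_nonneg (show 0 ≤ 2 * l ^ 2 by positivity) (visits_nonneg E π)
  exact Real.exp_le_exp.2 (by linarith)

open Classical in
lemma expWeight_snoc_le (E : Set (stdSimplex ℝ (Fin 2))) {l : ℝ} (hl : |l| ≤ 1 / 2)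
    (y : Fin (t + 1) → Fin 2) (π : Fin t → stdSimplex ℝ (Fin 2)) (q : stdSimplex ℝ (Fin 2)) :
    expWeight E l y (Fin.snoc (α := fun _ => stdSimplex ℝ (Fin 2)) π q) ≤
      expWeight E l (fun i => y i.castSucc) π * (1 + (if q ∈ E then l else 0) *
        (q 1 - stateOne (y (Fin.last t)))) := by
  simp only [expWeight, visits_snoc, stateOneBias_snoc]
  set d := q 1 - stateOne (y (Fin.last t))
  split_ifs
  · have hd1 : |d| ≤ 1 := abs_forecast_sub_le_one q (stateOne_mem_Icc _)
    obtain ⟨hlow, hhigh⟩ := abs_le.1 <| show |l * d| ≤ 1 / 2 by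
      rw [abs_mul]
      exact (mul_le_of_le_one_right (abs_nonneg l) hd1).trans hl
    have hsq : (l * d) ^ 2 ≤ l ^ 2 := by
      rw [mul_pow]
      exact mul_le_of_le_one_right (sq_nonneg _) ((sq_le_one_iff_abs_le_one d).2 hd1)
    have hround : Real.exp (l * d - 2 * l ^ 2) ≤ 1 + l * d :=
      (Real.exp_le_exp.2 (by linarith)).trans (exp_sub_two_mul_sq_le hlow (by linarith))
    refine le_trans (le_of_eq ?_) (mul_le_mul_of_nonneg_left hround (Real.exp_pos _).le)
    rw [← Real.exp_add]
    ring_nf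
  · simp

variable {J : Type*} [Fintype J]

/-- The exponential potential of the biases on the events `E j` at the learning rates `l j`. -/
noncomputable def potential (E : J → Set (stdSimplex ℝ (Fin 2))) (l : J → ℝ) (y : Fin t → Fin 2)
    (π : Fin t → stdSimplex ℝ (Fin 2)) : ℝ :=
  ∑ j, expWeight (E j) (l j) y π

open Classical in
/-- The derivative of the potential in the bias of the next forecast, when that forecast is `q`. -/
noncomputable def potentialSlope (E : J → Set (stdSimplex ℝ (Fin 2))) (l : J → ℝ)
    (y : Fin t → Fin 2) (π : Fin t → stdSimplex ℝ (Fin 2)) (q : stdSimplex ℝ (Fin 2)) : ℝ :=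
  ∑ j, expWeight (E j) (l j) y π * if q ∈ E j then l j else 0

lemma expWeight_le_potential (E : J → Set (stdSimplex ℝ (Fin 2))) (l : J → ℝ) (y : Fin t → Fin 2)
    (π : Fin t → stdSimplex ℝ (Fin 2)) (j : J) :
    expWeight (E j) (l j) y π ≤ potential E l y π :=
  Finset.single_le_sum (f := fun j => expWeight (E j) (l j) y π)
    (fun _ _ => (expWeight_pos _ _ _ _).le) (Finset.mem_univ j)

lemma potential_nonneg (E : J → Set (stdSimplex ℝ (Fin 2))) (l : J → ℝ) (y : Fin t → Fin 2)
    (π : Fin t → stdSimplex ℝ (Fin 2)) : 0 ≤ potential E l y π :=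
  Finset.sum_nonneg fun _ _ => (expWeight_pos _ _ _ _).le

variable (E : J → Set (stdSimplex ℝ (Fin 2))) {l : J → ℝ}

lemma isBoundedFun_potential (hl : ∀ j, |l j| ≤ 1 / 2) (y : Fin t → Fin 2) :
    IsBoundedFun (potential E l y) :=
  .sum _ fun j _ => .of_mem_Icc fun π => ⟨(expWeight_pos _ _ _ π).le, expWeight_le _ (hl j) y π⟩

lemma abs_potentialSlope_le (hl : ∀ j, |l j| ≤ 1 / 2) (y : Fin t → Fin 2)
    (π : Fin t → stdSimplex ℝ (Fin 2)) (q : stdSimplex ℝ (Fin 2)) :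
    |potentialSlope E l y π q| ≤ potential E l y π := by
  refine (Finset.abs_sum_le_sum_abs _ _).trans (Finset.sum_le_sum fun j _ => ?_)
  rw [abs_mul, abs_of_pos (expWeight_pos _ _ _ _)]
  refine mul_le_of_le_one_right (expWeight_pos _ _ _ _).le ?_
  split_ifs
  · linarith [hl j]
  · simp

lemma potential_snoc_le (hl : ∀ j, |l j| ≤ 1 / 2) (y : Fin (t + 1) → Fin 2)
    (π : Fin t → stdSimplex ℝ (Fin 2)) (q : stdSimplex ℝ (Fin 2)) :
    potential E l y (Fin.snoc (α := fun _ => stdSimplex ℝ (Fin 2)) π q) ≤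
      potential E l (fun i => y i.castSucc) π +
        potentialSlope E l (fun i => y i.castSucc) π q * (q 1 - stateOne (y (Fin.last t))) := by
  rw [potential, potential, potentialSlope, Finset.sum_mul, ← Finset.sum_add_distrib]
  refine Finset.sum_le_sum fun j _ => (expWeight_snoc_le (E j) (hl j) y π q).trans_eq ?_
  ring

lemma exists_forecaster_expect_potential_le (hl : ∀ j, |l j| ≤ 1 / 2) {m : ℕ} (hm : 0 < m) :
    ∃ F : Forecaster (Fin 2), ∀ (y : ℕ → Fin 2) (t : ℕ),
      expect (forecastLaw F y t) (potential E l fun i => y i) ≤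
        Fintype.card J * (1 + 1 / (m : ℝ)) ^ t := by
  choose F hF using fun (t : ℕ) (y : Fin t → Fin 2) (π : Fin t → stdSimplex ℝ (Fin 2)) =>
    exists_calibrating_pmf _ (abs_potentialSlope_le E hl y π) hm
  refine ⟨F, fun y t => ?_⟩
  have bddPot := fun t => isBoundedFun_potential (t := t) E hl fun i => y i
  induction t with
  | zero => simp [forecastLaw, expect_pure, potential, expWeight, stateOneBias, visits]
  | succ t ih =>
    set Φ : (Fin t → stdSimplex ℝ (Fin 2)) → ℝ := potential E l fun i => y i
    have hround : ∀ π : Fin t → stdSimplex ℝ (Fin 2), expect (F t (fun i => y i) π) (fun q =>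
        potential E l (fun i : Fin (t + 1) => y i)
          (Fin.snoc (α := fun _ => stdSimplex ℝ (Fin 2)) π q)) ≤ (1 + 1 / (m : ℝ)) * Φ π := by
      intro π
      have bddSlope := isBoundedFun_mul_forecast_sub
        ⟨_, abs_potentialSlope_le E hl (fun i => y i) π⟩ (stateOne_mem_Icc (y t))
      have hstep := expect_mono (F t (fun i => y i) π)
        ((bddPot (t + 1)).comp _) ((IsBoundedFun.const _).add bddSlope)
        fun q _ => potential_snoc_le E hl (fun i : Fin (t + 1) => y i) π q
      rw [expect_add _ (.const _) bddSlope, expect_const] at hstep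
      have hcal := hF t (fun i => y i) π _ (stateOne_mem_Icc (y t))
      calc _ ≤ Φ π + Φ π / m := hstep.trans (add_le_add_right hcal _)
        _ = (1 + 1 / (m : ℝ)) * Φ π := by ring
    calc _ ≤ expect (forecastLaw F y t) fun π => (1 + 1 / (m : ℝ)) * Φ π := by
          rw [expect_forecastLaw_succ _ _ _ (bddPot _)]
          exact expect_mono _ ((bddPot (t + 1)).expect_comp _ _) ((bddPot t).const_mul _)
            fun π _ => hround π
      _ ≤ (1 + 1 / (m : ℝ)) * (Fintype.card J * (1 + 1 / (m : ℝ)) ^ t) := by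
          rw [expect_const_mul]
          gcongr
      _ = Fintype.card J * (1 + 1 / (m : ℝ)) ^ (t + 1) := by ring

end Potential

section LowBias

open Classical in
lemma forecastBias_filter_eq {t : ℕ} (E : Set (stdSimplex ℝ (Fin 2))) (y : Fin t → Fin 2)
    (π : Fin t → stdSimplex ℝ (Fin 2)) :
    forecastBias (Finset.univ.filter fun s => π s ∈ E) π y = 2 * |stateOneBias E y π| := by
  have hone : ∀ s [Decidable (y s = 1)], (if y s = 1 then 1 else 0 : ℝ) = stateOne (y s) := by
    intro s _
    rw [stateOne]
    congr
  have hzero : ∀ s [Decidable (y s = 0)],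
      π s 0 - (if y s = 0 then 1 else 0) = -(π s 1 - stateOne (y s)) := by
    intro s _
    have hπ : π s 0 + π s 1 = 1 := stdSimplex.add_eq_one (π s)
    have hy : (if y s = 0 then (1 : ℝ) else 0) = 1 - stateOne (y s) := by
      rw [stateOne]
      rcases Fin.exists_fin_two.1 ⟨y s, rfl⟩ with h | h <;> simp [h]
    linarith
  simp only [forecastBias, Fin.sum_univ_two, hzero, hone, Finset.sum_neg_distrib, abs_neg,
    stateOneBias, two_mul]

lemma le_of_exp_sqrt_div_mul_sub_le {b n ℓ Φ : ℝ} (hn : 0 < n) (hℓ : 0 < ℓ)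
    (h : Real.exp (√(ℓ / n) * b - 2 * ℓ) ≤ Φ) :
    b ≤ 4 * √(ℓ * n) + √(n / ℓ) * (Φ * Real.exp (-(2 * ℓ))) := by
  have hlinear : √(ℓ / n) * b ≤ 4 * ℓ + Φ * Real.exp (-(2 * ℓ)) := by
    have hexp := Real.add_one_le_exp (√(ℓ / n) * b - 2 * ℓ + -(2 * ℓ))
    rw [Real.exp_add] at hexp
    linarith [mul_le_mul_of_nonneg_right h (Real.exp_pos (-(2 * ℓ))).le]
  have hinv : √(n / ℓ) * √(ℓ / n) = 1 := by
    rw [← Real.sqrt_mul (by positivity), div_mul_div_cancel₀ hℓ.ne', div_self hn.ne',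
      Real.sqrt_one]
  have hsqrt : √(n / ℓ) * ℓ = √(ℓ * n) := by
    rw [show ℓ * n = n / ℓ * ℓ ^ 2 by field_simp, Real.sqrt_mul (by positivity),
      Real.sqrt_sq hℓ.le]
  calc b = √(n / ℓ) * (√(ℓ / n) * b) := by rw [← mul_assoc, hinv, one_mul]
    _ ≤ √(n / ℓ) * (4 * ℓ + Φ * Real.exp (-(2 * ℓ))) := by gcongr
    _ = 4 * √(ℓ * n) + √(n / ℓ) * (Φ * Real.exp (-(2 * ℓ))) := by rw [← hsqrt]; ring

/-- The learning rate that is optimal for an event visited `j + 1` times, capped at `1 / 2`. -/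
noncomputable def learningRate (ℓ : ℝ) (j : ℕ) : ℝ := min (1 / 2) √(ℓ / (j + 1))

lemma learningRate_nonneg (ℓ : ℝ) (j : ℕ) : 0 ≤ learningRate ℓ j :=
  le_min (by norm_num) (Real.sqrt_nonneg _)

lemma le_of_forall_learningRate {b ℓ Φ : ℝ} {N T : ℕ} (hNT : N ≤ T) (hℓ : 1 ≤ ℓ) (hΦ : 0 ≤ Φ)
    (hb : b ≤ N) (h : ∀ j : Fin T,
      Real.exp (learningRate ℓ j * b - 2 * learningRate ℓ j ^ 2 * N) ≤ Φ) :
    b ≤ 4 * √(ℓ * N) + √T * (Φ * Real.exp (-(2 * ℓ))) := by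
  rcases lt_or_ge (N : ℝ) (4 * ℓ) with hfew | hmany
  · have hsqrt : (N : ℝ) / 2 ≤ √(ℓ * N) := Real.le_sqrt_of_sq_le (by
      linarith [mul_le_mul_of_nonneg_left hfew.le N.cast_nonneg])
    linarith [show 0 ≤ √T * (Φ * Real.exp (-(2 * ℓ))) by positivity]
  have hN : (0 : ℝ) < N := by linarith
  obtain ⟨j, rfl⟩ := Nat.exists_eq_succ_of_ne_zero (Nat.cast_pos.1 hN).ne'
  have hrate : learningRate ℓ j = √(ℓ / (j + 1 : ℕ)) := by
    rw [learningRate, Nat.cast_succ]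
    refine min_eq_right ((Real.sqrt_le_left (by norm_num)).2 ?_)
    rw [← Nat.cast_succ, div_le_iff₀ hN]
    linarith
  have hj := h ⟨j, hNT⟩
  rw [hrate, Real.sq_sqrt (by positivity), mul_assoc 2, div_mul_cancel₀ _ hN.ne'] at hj
  refine (le_of_exp_sqrt_div_mul_sub_le hN (by linarith) hj).trans ?_
  gcongr
  exact (div_le_self hN.le hℓ).trans (by exact_mod_cast hNT)

/-- The rate `learningRate ℓ j`, or its negative, which penalizes the opposite bias. -/
noncomputable def signedRate (ℓ : ℝ) (s : Bool) (j : ℕ) : ℝ :=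
  bif s then learningRate ℓ j else -learningRate ℓ j

lemma abs_signedRate_le (ℓ : ℝ) (s : Bool) (j : ℕ) : |signedRate ℓ s j| ≤ 1 / 2 := by
  have hrate : |learningRate ℓ j| ≤ 1 / 2 := by
    rw [abs_of_nonneg (learningRate_nonneg ℓ j)]
    exact min_le_left _ _
  cases s <;> simpa [signedRate] using hrate

variable {ι : Type*} [Fintype ι] {T : ℕ} (𝓔 : ι → Set (stdSimplex ℝ (Fin 2)))

lemma exp_learningRate_mul_abs_le_potential (ℓ : ℝ) (y : Fin T → Fin 2)
    (π : Fin T → stdSimplex ℝ (Fin 2)) (i : ι) (j : Fin T) :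
    Real.exp (learningRate ℓ j * |stateOneBias (𝓔 i) y π| -
        2 * learningRate ℓ j ^ 2 * visits (𝓔 i) π) ≤
      potential (fun x : ι × Bool × Fin T => 𝓔 x.1) (fun x => signedRate ℓ x.2.1 x.2.2) y π := by
  have hterm := fun s : Bool => expWeight_le_potential (fun x : ι × Bool × Fin T => 𝓔 x.1)
    (fun x => signedRate ℓ x.2.1 x.2.2) y π (i, s, j)
  rcases abs_choice (stateOneBias (𝓔 i) y π) with h | h <;> rw [h]
  · simpa [expWeight, signedRate] using hterm true
  · simpa [expWeight, signedRate] using hterm false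

lemma one_add_one_div_pow_le_three {T : ℕ} (hT : 0 < T) : (1 + 1 / (T : ℝ)) ^ T ≤ 3 := by
  have hT' : (T : ℝ) ≠ 0 := by exact_mod_cast hT.ne'
  calc (1 + 1 / (T : ℝ)) ^ T ≤ Real.exp (1 / T) ^ T := by
        gcongr
        rw [add_comm]
        exact Real.add_one_le_exp _
    _ = Real.exp 1 := by rw [← Real.exp_nat_mul, mul_one_div_cancel hT']
    _ ≤ 3 := by linarith [Real.exp_one_lt_d9]

variable [Nonempty ι]

lemma two_mul_le_card_mul_card_mul (T : ℕ) :
    2 * (T : ℝ) ≤ Fintype.card (Fin 2) * Fintype.card ι * T := by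
  rw [Fintype.card_fin]
  have hι : (1 : ℝ) ≤ Fintype.card ι := by exact_mod_cast Fintype.card_pos (α := ι)
  push_cast
  gcongr
  linarith

lemma exp_logFactor (hT : 0 < T) :
    Real.exp (logFactor (Fin 2) ι T) = Fintype.card (Fin 2) * Fintype.card ι * T :=
  Real.exp_log (by have := Fintype.card_pos (α := ι); positivity)

lemma one_le_logFactor (hT : 2 ≤ T) : 1 ≤ logFactor (Fin 2) ι T := by
  have hT' : (2 : ℝ) ≤ T := by exact_mod_cast hT
  rw [← Real.exp_le_exp, exp_logFactor (by omega)]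
  linarith [Real.exp_one_lt_d9, two_mul_le_card_mul_card_mul (ι := ι) T]

lemma sqrt_mul_card_mul_exp_neg_le (hT : 2 ≤ T) :
    √T * (Fintype.card (ι × Bool × Fin T) * (1 + 1 / (T : ℝ)) ^ T *
      Real.exp (-(2 * logFactor (Fin 2) ι T))) ≤ 4 * logFactor (Fin 2) ι T := by
  have hT' : (2 : ℝ) ≤ T := by exact_mod_cast hT
  have hM := two_mul_le_card_mul_card_mul (ι := ι) T
  have hcard : (Fintype.card (ι × Bool × Fin T) : ℝ) =
      Fintype.card (Fin 2) * Fintype.card ι * T := by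
    simp only [Fintype.card_prod, Fintype.card_bool, Fintype.card_fin]
    push_cast
    ring
  have hexp := exp_logFactor (ι := ι) (T := T) (by omega)
  set M : ℝ := Fintype.card (Fin 2) * Fintype.card ι * T
  have hsqrt : √T ≤ T := Real.sqrt_le_self_iff.2 (.inr (by linarith))
  rw [hcard, Real.exp_neg, two_mul, Real.exp_add, hexp]
  calc √T * (M * (1 + 1 / (T : ℝ)) ^ T * (M * M)⁻¹) ≤ M * (M * 3 * (M * M)⁻¹) := by
        gcongr
        · linarith
        · exact one_add_one_div_pow_le_three (by omega)
    _ = 3 := by have : M ≠ 0 := by linarith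
                field_simp
    _ ≤ 4 * logFactor (Fin 2) ι T := by linarith [one_le_logFactor (ι := ι) hT]

open Classical in
lemma forecastBias_le_add_potential (hT : 2 ≤ T) (y : ℕ → Fin 2)
    (π : Fin T → stdSimplex ℝ (Fin 2)) (i : ι) :
    forecastBias (Finset.univ.filter fun t => π t ∈ 𝓔 i) π (fun t => y t) ≤
      8 * (√(logFactor (Fin 2) ι T) * √(visits (𝓔 i) π)) +
        2 * √T * Real.exp (-(2 * logFactor (Fin 2) ι T)) *
          potential (fun x : ι × Bool × Fin T => 𝓔 x.1)
            (fun x => signedRate (logFactor (Fin 2) ι T) x.2.1 x.2.2) (fun t => y t) π := by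
  have hrate := le_of_forall_learningRate (N := (Finset.univ.filter fun t => π t ∈ 𝓔 i).card)
    (by simpa using Finset.card_le_univ (Finset.univ.filter fun t => π t ∈ 𝓔 i))
    (one_le_logFactor (ι := ι) hT) (potential_nonneg _ _ _ π)
    (abs_stateOneBias_le_visits (𝓔 i) (fun t => y t) π)
    (exp_learningRate_mul_abs_le_potential 𝓔 _ (fun t => y t) π i)
  rw [Real.sqrt_mul (logFactor_nonneg _ _ _)] at hrate
  refine (forecastBias_filter_eq (𝓔 i) _ π).trans_le
    ((mul_le_mul_of_nonneg_left hrate zero_le_two).trans_eq ?_)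
  rw [visits]
  ring

lemma exists_hasLowBias (hT : 2 ≤ T) : ∃ F : Forecaster (Fin 2), HasLowBias F 𝓔 T 4 := by
  classical
  have hT0 : 0 < T := by omega
  set ℓ := logFactor (Fin 2) ι T
  set E : ι × Bool × Fin T → Set (stdSimplex ℝ (Fin 2)) := fun x => 𝓔 x.1
  set l : ι × Bool × Fin T → ℝ := fun x => signedRate ℓ x.2.1 x.2.2
  have hl : ∀ x, |l x| ≤ 1 / 2 := fun x => abs_signedRate_le _ _ _
  obtain ⟨F, hF⟩ := exists_forecaster_expect_potential_le E hl hT0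
  refine ⟨F, (hasLowBias_iff hT0).2 fun y i => ?_⟩
  set Φ : (Fin T → stdSimplex ℝ (Fin 2)) → ℝ := potential E l fun s => y s
  have bddVisits : IsBoundedFun fun π : Fin T → stdSimplex ℝ (Fin 2) =>
      8 * (√ℓ * √(visits (𝓔 i) π)) :=
    .const_mul _ (.const_mul _ (.of_mem_Icc (a := 0) (b := √T) fun π =>
      ⟨Real.sqrt_nonneg _, Real.sqrt_le_sqrt (visits_le _ _)⟩))
  have bddΦ : IsBoundedFun Φ := isBoundedFun_potential E hl _
  have herror : 2 * √T * Real.exp (-(2 * ℓ)) * expect (forecastLaw F y T) Φ ≤ 8 * ℓ := by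
    have hsum := sqrt_mul_card_mul_exp_neg_le (ι := ι) hT
    calc 2 * √T * Real.exp (-(2 * ℓ)) * expect (forecastLaw F y T) Φ
        ≤ 2 * √T * Real.exp (-(2 * ℓ)) *
          (Fintype.card (ι × Bool × Fin T) * (1 + 1 / (T : ℝ)) ^ T) := by
          gcongr
          exact hF y T
      _ ≤ 8 * ℓ := by linarith
  refine (expect_mono _ (isBoundedFun_forecastBias _ y) (bddVisits.add (bddΦ.const_mul _))
    fun π _ => forecastBias_le_add_potential 𝓔 hT y π i).trans ?_
  rw [expect_add _ bddVisits (bddΦ.const_mul _), expect_const_mul _ _ Φ]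
  refine (add_le_add_right herror _).trans_eq ?_
  rw [← expect_const (forecastLaw F y T) (8 * ℓ), ← expect_add _ bddVisits (.const _)]
  refine congrArg _ (funext fun π => ?_)
  rw [Fintype.card_fin, visits]
  push_cast
  ring

end LowBias

/-! ## Trimming signals and merging schemes -/

section Trim

variable {K : Type*} [Finite K] {d₀ d₁ : K → ℝ} {C τ m₀ m₁ α β g : ℝ}

lemma exists_maximal_ratio (hτ : 0 ≤ τ) (hτC : τ < C)
    (hsign : ∀ k, (C ≤ d₀ k ∧ d₁ k ≤ -C) ∨ (d₀ k ≤ -C ∧ C ≤ d₁ k))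
    (hm₁ : 0 ≤ m₁) (hm : m₀ + m₁ = 1) (hmC : ∀ k, C ≤ m₀ * d₀ k + m₁ * d₁ k)
    (hpos : ∃ k, C ≤ d₀ k) :
    ∃ ρ, 0 ≤ ρ ∧ (∀ k, τ * (1 + ρ) ≤ d₀ k + ρ * d₁ k) ∧
      ∃ k, d₁ k ≤ -C ∧ d₀ k + ρ * d₁ k = τ * (1 + ρ) := by
  have hneg : ∀ k, C ≤ d₀ k → d₁ k ≤ -C := fun k hk =>
    (hsign k).elim And.right fun h => by linarith [h.1]
  obtain ⟨k, hkC, hkmin⟩ := Set.exists_min_image {k | C ≤ d₀ k}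
    (fun k => (d₀ k - τ) / (τ - d₁ k)) (Set.toFinite _) hpos
  have hk₁ := hneg k hkC
  have hk₀ : C ≤ d₀ k := hkC
  have hden : 0 < τ - d₁ k := by linarith
  set ρ := (d₀ k - τ) / (τ - d₁ k)
  have hρ : ρ * (τ - d₁ k) = d₀ k - τ := div_mul_cancel₀ _ hden.ne'
  have hm₀ : 0 < m₀ := by
    by_contra! hm₀
    linarith [hmC k, mul_nonneg hm₁ (show 0 ≤ -d₁ k by linarith),
      mul_nonneg (neg_nonneg.2 hm₀) (show 0 ≤ d₀ k by linarith)]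
  have hratio : m₁ ≤ m₀ * ρ := by
    refine le_of_mul_le_mul_right ?_ hden
    rw [mul_assoc, hρ]
    linarith [hmC k, congrArg (τ * ·) hm]
  refine ⟨ρ, div_nonneg (by linarith) hden.le, fun k' => ?_, k, hk₁, by linarith⟩
  rcases hsign k' with h | h
  · have hmin := (le_div_iff₀ (by linarith [h.2])).1 (hkmin k' h.1)
    linarith
  · have hpart : m₁ * (d₁ k' - τ) ≤ m₀ * ρ * (d₁ k' - τ) :=
      mul_le_mul_of_nonneg_right hratio (by linarith)
    have hscaled : 0 ≤ m₀ * (d₀ k' - τ + ρ * (d₁ k' - τ)) := by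
      linarith [hmC k', congrArg (τ * ·) hm]
    linarith [nonneg_of_mul_nonneg_right hscaled hm₀]

lemma exists_trim_of_violated (hτ : 0 ≤ τ) (hτC : τ < C)
    (hsign : ∀ k, (C ≤ d₀ k ∧ d₁ k ≤ -C) ∨ (d₀ k ≤ -C ∧ C ≤ d₁ k))
    (hm₁ : 0 ≤ m₁) (hm : m₀ + m₁ = 1) (hmC : ∀ k, C ≤ m₀ * d₀ k + m₁ * d₁ k)
    (hα : 0 ≤ α) (hg : ∀ k, -(α * d₀ k + β * d₁ k) ≤ g)
    {k₀ : K} (hk₀ : C ≤ d₀ k₀) (hviol : α * d₀ k₀ + β * d₁ k₀ < τ * (α + β)) :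
    ∃ b, 0 ≤ b ∧ b ≤ β ∧ (∀ k, τ * (α + b) ≤ α * d₀ k + b * d₁ k) ∧
      C * (β - b) ≤ τ * (α + β) + g := by
  obtain ⟨ρ, hρ, hobey, k, hk₁, hk⟩ := exists_maximal_ratio hτ hτC hsign hm₁ hm hmC ⟨k₀, hk₀⟩
  have hle : α * ρ ≤ β := by
    have hk₀₁ : d₁ k₀ ≤ -C := (hsign k₀).elim And.right fun h => by linarith [h.1]
    refine le_of_mul_le_mul_right ?_ (show 0 < τ - d₁ k₀ by linarith)
    linarith [mul_le_mul_of_nonneg_left (hobey k₀) hα]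
  refine ⟨α * ρ, by positivity, hle, fun k' => ?_, ?_⟩
  · linarith [mul_le_mul_of_nonneg_left (hobey k') hα]
  · calc C * (β - α * ρ) ≤ (τ - d₁ k) * (β - α * ρ) := by
          gcongr
          linarith
      _ = τ * (α + β) - (α * d₀ k + β * d₁ k) := by linear_combination α * hk
      _ ≤ τ * (α + β) + g := by linarith [hg k]

/-- One of the two weights is decreased until the strategy is obedient: the other strategies
that are attractive in one state all lose when that state becomes less likely. -/
lemma exists_trim (hτ : 0 ≤ τ) (hτC : τ < C)
    (hsign : ∀ k, (C ≤ d₀ k ∧ d₁ k ≤ -C) ∨ (d₀ k ≤ -C ∧ C ≤ d₁ k)) (hm₀ : 0 ≤ m₀)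
    (hm₁ : 0 ≤ m₁) (hm : m₀ + m₁ = 1) (hmC : ∀ k, C ≤ m₀ * d₀ k + m₁ * d₁ k)
    (hα : 0 ≤ α) (hβ : 0 ≤ β) (hg0 : 0 ≤ g) (hg : ∀ k, -(α * d₀ k + β * d₁ k) ≤ g) :
    ∃ a b, 0 ≤ a ∧ a ≤ α ∧ 0 ≤ b ∧ b ≤ β ∧ (∀ k, τ * (a + b) ≤ a * d₀ k + b * d₁ k) ∧
      C * (α + β - (a + b)) ≤ τ * (α + β) + g := by
  by_cases hobey : ∀ k, τ * (α + β) ≤ α * d₀ k + β * d₁ k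
  · exact ⟨α, β, hα, le_rfl, hβ, le_rfl, hobey, by rw [sub_self, mul_zero]; positivity⟩
  push Not at hobey
  obtain ⟨k₀, hk₀⟩ := hobey
  rcases hsign k₀ with h | h
  · obtain ⟨b, hb, hbβ, hobey, hmass⟩ :=
      exists_trim_of_violated hτ hτC hsign hm₁ hm hmC hα hg h.1 hk₀
    exact ⟨α, b, hα, le_rfl, hb, hbβ, hobey, by linarith⟩
  · obtain ⟨a, ha, haα, hobey, hmass⟩ :=
      exists_trim_of_violated (d₀ := d₁) (d₁ := d₀) (m₀ := m₁) (m₁ := m₀) (β := α) (g := g) hτ hτC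
        (fun k => (hsign k).symm.imp And.symm And.symm) hm₀ (by linarith)
        (fun k => by linarith [hmC k]) hβ (fun k => by linarith [hg k]) h.2 (by linarith)
    exact ⟨a, β, ha, haα, hβ, le_rfl, fun k => by linarith [hobey k], by linarith⟩

end Trim

section Caratheodory

variable {S V : Type*} [AddCommGroup V] [Module ℝ V]

lemma exists_neg_of_sum_smul_eq_zero {z : S → V} {s : Finset S} (φ : V →ₗ[ℝ] ℝ)
    (hφ : ∀ i ∈ s, 0 < φ (z i)) {η : S → ℝ} (hη : ∑ i ∈ s, η i • z i = 0)
    (hne : ∃ i ∈ s, η i ≠ 0) : ∃ i ∈ s, η i < 0 := by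
  by_contra! hη0
  obtain ⟨i, hi, hηi⟩ := hne
  have hsum : ∑ i ∈ s, η i * φ (z i) = 0 := by simpa using congrArg φ hη
  have hterm := (Finset.sum_eq_zero_iff_of_nonneg fun j hj =>
    mul_nonneg (hη0 j hj) (hφ j hj).le).1 hsum i hi
  exact (mul_ne_zero hηi (hφ i hi).ne') hterm

lemma exists_smul_relation_drop {s : Finset S} {w η : S → ℝ} (hw : ∀ i ∈ s, 0 ≤ w i)
    (hη : ∃ i ∈ s, η i < 0) :
    ∃ c, 0 ≤ c ∧ (∀ i ∈ s, 0 ≤ w i + c * η i) ∧ ∃ i ∈ s, w i + c * η i = 0 := by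
  classical
  obtain ⟨i, hi, hmin⟩ := Finset.exists_min_image (s.filter fun i => η i < 0)
    (fun i => w i / -η i) (by simpa [Finset.Nonempty] using hη)
  obtain ⟨his, hηi⟩ := Finset.mem_filter.1 hi
  have hc : 0 ≤ w i / -η i := div_nonneg (hw i his) (by linarith)
  refine ⟨w i / -η i, hc, fun j hj => ?_, i, his, ?_⟩
  · rcases lt_or_ge (η j) 0 with hηj | hηj
    · have := (le_div_iff₀ (neg_pos.2 hηj)).1 (hmin j (Finset.mem_filter.2 ⟨hj, hηj⟩))
      linarith
    · exact add_nonneg (hw j hj) (mul_nonneg hc hηj)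
  · rw [div_neg, neg_mul, div_mul_cancel₀ _ hηi.ne, add_neg_cancel]

/-- Carathéodory's theorem for pointed cones, with a linear objective. -/
lemma exists_subset_card_le_finrank_sum_smul_eq [FiniteDimensional ℝ V] (z : S → V) (f : S → ℝ)
    (φ : V →ₗ[ℝ] ℝ) (s : Finset S) (hφ : ∀ i ∈ s, 0 < φ (z i)) {w : S → ℝ}
    (hw : ∀ i ∈ s, 0 ≤ w i) :
    ∃ t ⊆ s, t.card ≤ Module.finrank ℝ V ∧ ∃ w' : S → ℝ, (∀ i ∈ t, 0 ≤ w' i) ∧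
      ∑ i ∈ t, w' i • z i = ∑ i ∈ s, w i • z i ∧ ∑ i ∈ s, w i * f i ≤ ∑ i ∈ t, w' i * f i := by
  classical
  induction s using Finset.strongInduction generalizing w with
  | H s ih =>
    rcases le_or_gt s.card (Module.finrank ℝ V) with hcard | hcard
    · exact ⟨s, subset_rfl, hcard, w, hw, rfl, le_rfl⟩
    have hdep : ¬ LinearIndepOn ℝ z (s : Set S) := fun h => by
      have := LinearIndependent.fintype_card_le_finrank h
      simp at this
      omega
    obtain ⟨η, hη, hne, hobj⟩ : ∃ η : S → ℝ, ∑ i ∈ s, η i • z i = 0 ∧ (∃ i ∈ s, η i ≠ 0) ∧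
        0 ≤ ∑ i ∈ s, η i * f i := by
      obtain ⟨η, hη, hne⟩ := not_linearIndepOn_finset_iff.1 hdep
      rcases le_total 0 (∑ i ∈ s, η i * f i) with h | h
      · exact ⟨η, hη, hne, h⟩
      · exact ⟨-η, by simp [hη], by simpa using hne, by simpa using h⟩
    obtain ⟨c, hc, hw', i, hi, hwi⟩ :=
      exists_smul_relation_drop hw (exists_neg_of_sum_smul_eq_zero φ hφ hη hne)
    obtain ⟨t, hts, htcard, w', hw'0, hz, hf⟩ := ih (s.erase i) (Finset.erase_ssubset hi)
      (fun j hj => hφ j (Finset.mem_of_mem_erase hj)) (w := fun j => w j + c * η j)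
      fun j hj => hw' j (Finset.mem_of_mem_erase hj)
    refine ⟨t, hts.trans (Finset.erase_subset _ _), htcard, w', hw'0, hz.trans ?_, le_trans ?_ hf⟩
    · rw [Finset.sum_erase s (by rw [hwi, zero_smul])]
      simp only [add_smul, mul_smul, Finset.sum_add_distrib, ← Finset.smul_sum, hη, smul_zero,
        add_zero]
    · rw [Finset.sum_erase s (by rw [hwi, zero_mul])]
      simp only [add_mul, mul_assoc, Finset.sum_add_distrib, ← Finset.mul_sum]
      linarith [mul_nonneg hc hobj]

lemma exists_pair_combination [Fintype S] [Nonempty S] {z : S → Fin 2 → ℝ}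
    (hz : ∀ s y, 0 ≤ z s y) {f : S → ℝ} (hf : ∀ s, z s = 0 → f s = 0) :
    ∃ i j : S, ∃ a b : ℝ, 0 ≤ a ∧ 0 ≤ b ∧ a • z i + b • z j = ∑ s, z s ∧
      ∑ s, f s ≤ a * f i + b * f j := by
  classical
  set φ : (Fin 2 → ℝ) →ₗ[ℝ] ℝ := ∑ y, LinearMap.proj y
  have hφ : ∀ s, z s ≠ 0 → 0 < φ (z s) := fun s hs => by
    rw [LinearMap.sum_apply]
    exact (Finset.sum_nonneg fun y _ => hz s y).lt_of_ne fun h =>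
      hs (funext fun y => (Finset.sum_eq_zero_iff_of_nonneg fun y _ => hz s y).1 h.symm y
        (Finset.mem_univ y))
  obtain ⟨t, -, hcard, w, hw, hsum, hobj⟩ := exists_subset_card_le_finrank_sum_smul_eq z f φ
    (Finset.univ.filter fun s => z s ≠ 0) (fun s hs => hφ s (Finset.mem_filter.1 hs).2)
    (w := fun _ => 1) fun _ _ => zero_le_one
  simp only [one_smul, one_mul] at hsum hobj
  rw [Finset.sum_filter_ne_zero] at hsum
  rw [Finset.sum_filter_of_ne (p := fun s => z s ≠ 0) fun s _ hs h => hs (hf s h)] at hobj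
  rw [Module.finrank_fin_fun] at hcard
  obtain ⟨k⟩ := ‹Nonempty S›
  obtain h | h | h : t.card = 0 ∨ t.card = 1 ∨ t.card = 2 := by omega
  · obtain rfl := Finset.card_eq_zero.1 h
    exact ⟨k, k, 0, 0, le_rfl, le_rfl, by simpa using hsum, by simpa using hobj⟩
  · obtain ⟨i, rfl⟩ := Finset.card_eq_one.1 h
    exact ⟨i, i, w i, 0, hw i (by simp), le_rfl, by simpa using hsum, by simpa using hobj⟩
  · obtain ⟨i, j, hij, rfl⟩ := Finset.card_eq_two.1 h
    rw [Finset.sum_pair hij] at hsum hobj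
    exact ⟨i, j, w i, w j, hw i (by simp), hw j (by simp), hsum, hobj⟩

end Caratheodory

/-! ## Obedient joint distributions -/

section Obedience

variable {S : Type*}

/-- Receiver's utility of the strategy `s` at the unnormalized belief `z`. -/
def beliefUtil (u : S → Fin 2 → ℝ) (s : S) (z : Fin 2 → ℝ) : ℝ := z 0 * u s 0 + z 1 * u s 1

/-- Following the recommendation `s` at the unnormalized belief `z` beats every other strategy by
`τ` per unit of mass. -/
def ObedientBy (u : S → Fin 2 → ℝ) (τ : ℝ) (s : S) (z : Fin 2 → ℝ) : Prop :=
  ∀ s', s' ≠ s → τ * (z 0 + z 1) ≤ beliefUtil u s z - beliefUtil u s' z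

namespace ObedientBy

variable {u : S → Fin 2 → ℝ} {τ : ℝ} {s : S} {z z' : Fin 2 → ℝ}

lemma zero : ObedientBy u τ s 0 := fun s' _ => by simp [beliefUtil]

lemma add (h : ObedientBy u τ s z) (h' : ObedientBy u τ s z') : ObedientBy u τ s (z + z') :=
  fun s' hs' => by
    have hz := h s' hs'
    have hz' := h' s' hs'
    simp only [beliefUtil, Pi.add_apply] at *
    linarith

lemma smul (h : ObedientBy u τ s z) {c : ℝ} (hc : 0 ≤ c) : ObedientBy u τ s (c • z) :=
  fun s' hs' => by
    have hz := mul_le_mul_of_nonneg_left (h s' hs') hc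
    simp only [beliefUtil, Pi.smul_apply, smul_eq_mul] at *
    linarith

lemma of_near (hu : ∀ s y, u s y ∈ Set.Icc (0 : ℝ) 1) {σ d : ℝ} (hτ : 0 ≤ τ)
    (h : ObedientBy u τ s z) (hd : |z' 0 - z 0| + |z' 1 - z 1| ≤ d)
    (hmass : (1 + τ) * d ≤ (τ - σ) * (z' 0 + z' 1)) : ObedientBy u σ s z' := by
  intro s' hs'
  have hloss : ∀ y, -|z' y - z y| ≤ (z' y - z y) * (u s y - u s' y) := fun y => by
    refine (abs_le.1 ?_).1
    rw [abs_mul]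
    refine mul_le_of_le_one_right (abs_nonneg _) (abs_le.2 ⟨?_, ?_⟩) <;>
      linarith [(hu s y).1, (hu s y).2, (hu s' y).1, (hu s' y).2]
  have hgain : τ * (z' 0 + z' 1 - d) ≤ τ * (z 0 + z 1) :=
    mul_le_mul_of_nonneg_left (by linarith [le_abs_self (z' 0 - z 0), le_abs_self (z' 1 - z 1)]) hτ
  have hz := h s' hs'
  simp only [beliefUtil] at hz ⊢
  linarith [hloss 0, hloss 1]

end ObedientBy

/-- Any two strategies differ by at least `C` in each state, with opposite signs, and each strategy
beats all others by `C` at some belief. -/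
structure SeparatedBy (u : S → Fin 2 → ℝ) (C : ℝ) : Prop where
  pos : 0 < C
  le_one : C ≤ 1
  sign : ∀ s s', s' ≠ s → (C ≤ u s 0 - u s' 0 ∧ u s 1 - u s' 1 ≤ -C) ∨
    (u s 0 - u s' 0 ≤ -C ∧ C ≤ u s 1 - u s' 1)
  margin : ∀ s, ∃ m₀ m₁ : ℝ, 0 ≤ m₀ ∧ 0 ≤ m₁ ∧ m₀ + m₁ = 1 ∧
    ∀ s', s' ≠ s → C ≤ m₀ * (u s 0 - u s' 0) + m₁ * (u s 1 - u s' 1)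

lemma EveryStrategyStrictlyOptimal.sign {u : S → Fin 2 → ℝ} (hu : EveryStrategyStrictlyOptimal u)
    {s s' : S} (hs : s' ≠ s) :
    (0 < u s 0 - u s' 0 ∧ u s 1 - u s' 1 < 0) ∨ (u s 0 - u s' 0 < 0 ∧ 0 < u s 1 - u s' 1) := by
  obtain ⟨μ, ⟨hμ0, hμ1⟩, hμ⟩ := hu s
  obtain ⟨ν, ⟨hν0, hν1⟩, hν⟩ := hu s'
  have hwin : 0 < (1 - μ) * (u s 0 - u s' 0) + μ * (u s 1 - u s' 1) := by linarith [hμ s' hs]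
  have hlose : (1 - ν) * (u s 0 - u s' 0) + ν * (u s 1 - u s' 1) < 0 := by
    linarith [hν s hs.symm]
  have hsome : 0 < u s 0 - u s' 0 ∨ 0 < u s 1 - u s' 1 := by
    by_contra! h
    linarith [mul_nonpos_of_nonneg_of_nonpos (sub_nonneg.2 hμ1) h.1,
      mul_nonpos_of_nonneg_of_nonpos hμ0 h.2]
  have hnot : u s 0 - u s' 0 < 0 ∨ u s 1 - u s' 1 < 0 := by
    by_contra! h
    linarith [mul_nonneg (sub_nonneg.2 hν1) h.1, mul_nonneg hν0 h.2]
  rcases hsome with h | h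
  · exact .inl ⟨h, hnot.resolve_left h.not_gt⟩
  · exact .inr ⟨hnot.resolve_right h.not_gt, h⟩

lemma exists_pos_le_one_forall_le {ι : Type*} [Finite ι] {f : ι → ℝ} (hf : ∀ i, 0 < f i) :
    ∃ C, 0 < C ∧ C ≤ 1 ∧ ∀ i, C ≤ f i := by
  rcases isEmpty_or_nonempty ι with h | h
  · exact ⟨1, one_pos, le_rfl, h.elim⟩
  · obtain ⟨i, hi⟩ := Finite.exists_min f
    exact ⟨min 1 (f i), lt_min one_pos (hf i), min_le_left _ _, fun j => min_le_of_right_le (hi j)⟩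

lemma exists_separatedBy [Finite S] {u : S → Fin 2 → ℝ} (hu : EveryStrategyStrictlyOptimal u) :
    ∃ C, SeparatedBy u C := by
  choose μ hμ hopt using hu
  have hsign : ∀ {s s' : S}, s' ≠ s → _ := fun hs =>
    EveryStrategyStrictlyOptimal.sign (u := u) (fun s => ⟨μ s, hμ s, hopt s⟩) hs
  obtain ⟨C, hC, hC1, hle⟩ := exists_pos_le_one_forall_le (ι := {x : S × S // x.2 ≠ x.1})
    (f := fun x => min (min |u x.1.1 0 - u x.1.2 0| |u x.1.1 1 - u x.1.2 1|)
      ((1 - μ x.1.1) * (u x.1.1 0 - u x.1.2 0) + μ x.1.1 * (u x.1.1 1 - u x.1.2 1))) <| by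
    rintro ⟨⟨s, s'⟩, hs : s' ≠ s⟩
    refine lt_min (lt_min (abs_pos.2 ?_) (abs_pos.2 ?_)) (by linarith [hopt s s' hs])
    · exact (hsign hs).elim (fun h => h.1.ne') fun h => h.1.ne
    · exact (hsign hs).elim (fun h => h.2.ne) fun h => h.2.ne'
  refine ⟨C, hC, hC1, fun s s' hs => ?_, fun s => ⟨1 - μ s, μ s, sub_nonneg.2 (hμ s).2, (hμ s).1,
    by ring, fun s' hs => (hle ⟨(s, s'), hs⟩).trans (min_le_right _ _)⟩⟩
  obtain ⟨h0, h1⟩ := le_min_iff.1 ((hle ⟨(s, s'), hs⟩).trans (min_le_left _ _))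
  rcases hsign hs with h | h
  · rw [abs_of_pos h.1] at h0
    rw [abs_of_neg h.2] at h1
    exact .inl ⟨h0, by linarith⟩
  · rw [abs_of_neg h.1] at h0
    rw [abs_of_pos h.2] at h1
    exact .inr ⟨by linarith, h1⟩

namespace SeparatedBy

variable {u : S → Fin 2 → ℝ} {C τ : ℝ}

lemma exists_best [Finite S] [Nonempty S] (hC : SeparatedBy u C) (y : Fin 2) :
    ∃ s, ∀ s', s' ≠ s → C ≤ u s y - u s' y := by
  obtain ⟨s, hs⟩ := Finite.exists_max fun s => u s y
  refine ⟨s, fun s' hs' => ?_⟩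
  have hmax : u s' y ≤ u s y := hs s'
  have hpos := hC.pos
  fin_cases y <;> dsimp only [Fin.zero_eta, Fin.mk_one] at hmax ⊢ <;>
    rcases hC.sign s s' hs' with h | h <;> linarith [h.1, h.2]

lemma exists_trimmed_signal (hC : SeparatedBy u C) [Finite S] (hτ : 0 ≤ τ) (hτC : τ < C) {s : S}
    {z : Fin 2 → ℝ} (hz : 0 ≤ z) {g : ℝ} (hg0 : 0 ≤ g)
    (hg : ∀ s', beliefUtil u s' z - beliefUtil u s z ≤ g) :
    ∃ x, 0 ≤ x ∧ x ≤ z ∧ ObedientBy u τ s x ∧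
      C * (z 0 + z 1 - (x 0 + x 1)) ≤ τ * (z 0 + z 1) + g := by
  obtain ⟨m₀, m₁, hm₀, hm₁, hm, hmC⟩ := hC.margin s
  simp only [beliefUtil] at hg
  obtain ⟨a, b, ha, haz, hb, hbz, hobey, hmass⟩ := exists_trim (K := {s' // s' ≠ s})
    (d₀ := fun k => u s 0 - u k.1 0) (d₁ := fun k => u s 1 - u k.1 1) hτ hτC
    (fun k => hC.sign s k.1 k.2) hm₀ hm₁ hm (fun k => hmC k.1 k.2) (hz 0) (hz 1) hg0
    (fun k => by linarith [hg k.1])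
  refine ⟨![a, b], Fin.forall_fin_two.2 ⟨ha, hb⟩, Fin.forall_fin_two.2 ⟨haz, hbz⟩,
    fun s' hs' => ?_, by simpa using hmass⟩
  have hk := hobey ⟨s', hs'⟩
  simp only [beliefUtil, Matrix.cons_val_zero, Matrix.cons_val_one]
  linarith

open Classical in
/-- The missing mass of each state is recommended to the best strategy of that state. -/
lemma exists_obedient_completion [Fintype S] [Nonempty S] (hC : SeparatedBy u C) (hτC : τ < C)
    {q : Fin 2 → ℝ} {x : S → Fin 2 → ℝ} (hxq : ∑ s, x s ≤ q) (hx : ∀ s, ObedientBy u τ s (x s)) :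
    ∃ z, x ≤ z ∧ ∑ s, z s = q ∧ ∀ s, ObedientBy u τ s (z s) := by
  choose r hr using hC.exists_best
  set e : S → Fin 2 → ℝ := fun s y => if s = r y then q y - ∑ s, x s y else 0
  have hrest : ∀ y, 0 ≤ q y - ∑ s, x s y := fun y => by simpa using hxq y
  have he : ∀ s y, 0 ≤ e s y := fun s y => by
    dsimp only [e]
    split_ifs
    exacts [hrest y, le_rfl]
  have hgain : ∀ s s', s' ≠ s → ∀ y, τ * e s y ≤ e s y * (u s y - u s' y) := by
    intro s s' hs' y
    dsimp only [e]
    split_ifs with h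
    · subst h
      rw [mul_comm]
      exact mul_le_mul_of_nonneg_left (hτC.le.trans (hr y s' hs')) (hrest y)
    · rw [mul_zero, zero_mul]
  refine ⟨fun s => x s + e s, fun s => le_add_of_nonneg_right (he s), ?_, fun s =>
    (hx s).add fun s' hs' => ?_⟩
  · ext y
    simp [e, Finset.sum_add_distrib]
  · simp only [beliefUtil]
    linarith [hgain s s' hs' 0, hgain s s' hs' 1]

end SeparatedBy

variable [Fintype S]

/-- Sender's value when Receiver follows all recommendations of the joint distribution `z` of
recommended strategies and states. -/
def obedientValue (v : S → ℝ) (z : S → Fin 2 → ℝ) : ℝ := ∑ s, (z s 0 + z s 1) * v s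

lemma obedientValue_mono {v : S → ℝ} (hv : ∀ s, v s ∈ Set.Icc (0 : ℝ) 1) {x z : S → Fin 2 → ℝ}
    (h : x ≤ z) : obedientValue v x ≤ obedientValue v z :=
  Finset.sum_le_sum fun s _ =>
    mul_le_mul_of_nonneg_right (add_le_add (h s 0) (h s 1)) (hv s).1

lemma obedientValue_sub_le {v : S → ℝ} (hv : ∀ s, v s ∈ Set.Icc (0 : ℝ) 1) {x z : S → Fin 2 → ℝ}
    (h : x ≤ z) :
    obedientValue v z - obedientValue v x ≤ ∑ s, (z s 0 + z s 1 - (x s 0 + x s 1)) := by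
  rw [obedientValue, obedientValue, ← Finset.sum_sub_distrib]
  refine Finset.sum_le_sum fun s _ => ?_
  rw [← sub_mul]
  exact mul_le_of_le_one_right (by linarith [h s 0, h s 1]) (hv s).2

lemma SeparatedBy.exists_obedient [Nonempty S] {u : S → Fin 2 → ℝ} {C : ℝ}
    (hC : SeparatedBy u C) {v : S → ℝ} (hv : ∀ s, v s ∈ Set.Icc (0 : ℝ) 1) {τ ε : ℝ} (hτ : 0 ≤ τ)
    (hτC : τ < C) {z : S → Fin 2 → ℝ} (hz : 0 ≤ z) (hmass : ∑ s, (z s 0 + z s 1) = 1) {g : S → ℝ}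
    (hg0 : ∀ s, 0 ≤ g s) (hg : ∀ s s', beliefUtil u s' (z s) - beliefUtil u s (z s) ≤ g s)
    (hgε : ∑ s, g s ≤ ε) :
    ∃ z', 0 ≤ z' ∧ ∑ s, z' s = ∑ s, z s ∧ (∀ s, ObedientBy u τ s (z' s)) ∧
      obedientValue v z - (τ + ε) / C ≤ obedientValue v z' := by
  choose x hx0 hxz hx hcost using fun s => hC.exists_trimmed_signal hτ hτC (hz s) (hg0 s) (hg s)
  obtain ⟨z', hxz', hsum, hz'⟩ :=
    hC.exists_obedient_completion hτC (Finset.sum_le_sum fun s _ => hxz s) hx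
  refine ⟨z', le_trans (fun s => hx0 s) hxz', hsum, hz', ?_⟩
  have htrim : C * ∑ s, (z s 0 + z s 1 - (x s 0 + x s 1)) ≤ τ + ε := by
    calc _ ≤ ∑ s, (τ * (z s 0 + z s 1) + g s) := by
          rw [Finset.mul_sum]
          exact Finset.sum_le_sum fun s _ => hcost s
      _ = τ + ∑ s, g s := by rw [Finset.sum_add_distrib, ← Finset.mul_sum, hmass, mul_one]
      _ ≤ τ + ε := by gcongr
  rw [← le_div_iff₀' hC.pos] at htrim
  linarith [obedientValue_mono hv hxz', obedientValue_sub_le hv (x := x) hxz]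

end Obedience

/-! ## Persuasion in terms of joint distributions -/

section Persuasion

variable {S : Type*} [Fintype S]

/-- Joint probability of the signal `s` and the state `y`. -/
def jointProb (p : SignalScheme S) (π : stdSimplex ℝ (Fin 2)) (s : S) (y : Fin 2) : ℝ := π y * p y s

lemma jointProb_nonneg (p : SignalScheme S) (π : stdSimplex ℝ (Fin 2)) (s : S) (y : Fin 2) :
    0 ≤ jointProb p π s y := mul_nonneg (π.2.1 y) ((p y).2.1 s)

lemma sum_jointProb (p : SignalScheme S) (π : stdSimplex ℝ (Fin 2)) :
    ∑ s, jointProb p π s = π := by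
  ext y
  simp only [Finset.sum_apply, jointProb, ← Finset.mul_sum]
  rw [stdSimplex.sum_eq_one (p y), mul_one]

lemma persuasionGame_U (u : S → Fin 2 → ℝ) (v : S → ℝ) (a : S → S) (p : SignalScheme S)
    (π : stdSimplex ℝ (Fin 2)) :
    (persuasionGame u v).U a p π = ∑ s, beliefUtil u (a s) (jointProb p π s) := by
  simp only [StageGame.U, persuasionGame, Fin.sum_univ_two, Finset.mul_sum,
    ← Finset.sum_add_distrib]
  exact Finset.sum_congr rfl fun s _ => by simp only [beliefUtil, jointProb]; ring

lemma persuasionGame_V (u : S → Fin 2 → ℝ) (v : S → ℝ) (a : S → S) (p : SignalScheme S)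
    (π : stdSimplex ℝ (Fin 2)) :
    (persuasionGame u v).V a p π = ∑ s, (jointProb p π s 0 + jointProb p π s 1) * v (a s) := by
  simp only [StageGame.V, persuasionGame, Fin.sum_univ_two, Finset.mul_sum,
    ← Finset.sum_add_distrib]
  exact Finset.sum_congr rfl fun s _ => by simp only [jointProb]; ring

lemma obedientValue_jointProb (u : S → Fin 2 → ℝ) (v : S → ℝ) (p : SignalScheme S)
    (π : stdSimplex ℝ (Fin 2)) :
    obedientValue v (jointProb p π) = (persuasionGame u v).V id p π :=
  (persuasionGame_V u v id p π).symm

section DirectScheme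

variable (p : SignalScheme S) (π : stdSimplex ℝ (Fin 2)) (a : S → S)

open Classical in
/-- Joint probability of the played strategy `s` and the state when Receiver plays `a`: the direct
scheme that replaces each signal by the strategy it induces. -/
noncomputable def directProb (s : S) : Fin 2 → ℝ := ∑ s' with a s' = s, jointProb p π s'

lemma directProb_nonneg : 0 ≤ directProb p π a := fun s => by
  rw [directProb]
  exact Finset.sum_nonneg fun s' _ => jointProb_nonneg p π s'

lemma sum_directProb : ∑ s, directProb p π a s = π := by
  classical
  simp only [directProb]
  exact (Finset.sum_fiberwise Finset.univ a _).trans (sum_jointProb p π)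

lemma persuasionGame_U_comp (u : S → Fin 2 → ℝ) (v : S → ℝ) (c : S → S) :
    (persuasionGame u v).U (c ∘ a) p π = ∑ s, beliefUtil u (c s) (directProb p π a s) := by
  classical
  rw [persuasionGame_U, ← Finset.sum_fiberwise Finset.univ a]
  refine Finset.sum_congr rfl fun s _ => ?_
  simp only [beliefUtil, directProb, Finset.sum_apply, Finset.sum_mul, ← Finset.sum_add_distrib]
  exact Finset.sum_congr rfl fun s' hs' => by
    rw [Function.comp_apply, (Finset.mem_filter.1 hs').2]

lemma obedientValue_directProb (u : S → Fin 2 → ℝ) (v : S → ℝ) :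
    obedientValue v (directProb p π a) = (persuasionGame u v).V a p π := by
  classical
  rw [persuasionGame_V, ← Finset.sum_fiberwise Finset.univ a]
  refine Finset.sum_congr rfl fun s _ => ?_
  simp only [directProb, Finset.sum_apply, ← Finset.sum_add_distrib, Finset.sum_mul]
  exact Finset.sum_congr rfl fun s' hs' => by rw [(Finset.mem_filter.1 hs').2]

end DirectScheme

variable {u : S → Fin 2 → ℝ} {v : S → ℝ} {p : SignalScheme S} {π : stdSimplex ℝ (Fin 2)}

lemma beliefUtil_le_of_isBestResponse {a : S → S} (h : (persuasionGame u v).IsBestResponse p π a)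
    (s s' : S) : beliefUtil u s' (jointProb p π s) ≤ beliefUtil u (a s) (jointProb p π s) := by
  classical
  have hdev := h.1 (Function.update a s s')
  rw [persuasionGame_U, persuasionGame_U, ← sub_nonneg, ← Finset.sum_sub_distrib,
    Finset.sum_eq_single s (fun r _ hr => by simp [hr]) (by simp)] at hdev
  simpa using hdev

lemma beliefUtil_sub_le_U_sub {a : S → S} (h : (persuasionGame u v).IsBestResponse p π a)
    (b : S → S) (s : S) :
    beliefUtil u (a s) (jointProb p π s) - beliefUtil u (b s) (jointProb p π s) ≤
      (persuasionGame u v).U a p π - (persuasionGame u v).U b p π := by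
  rw [persuasionGame_U, persuasionGame_U, ← Finset.sum_sub_distrib]
  exact Finset.single_le_sum (f := fun s => beliefUtil u (a s) (jointProb p π s) -
    beliefUtil u (b s) (jointProb p π s)) (fun r _ => sub_nonneg.2
      (beliefUtil_le_of_isBestResponse h r (b r))) (Finset.mem_univ s)

lemma exists_disobedienceGain_directProb [Nonempty S]
    {aStar : SignalScheme S → stdSimplex ℝ (Fin 2) → (S → S)}
    (hStar : (persuasionGame u v).IsBestResponse p π (aStar p π)) {ε : ℝ} {a : S → S}
    (ha : a ∈ (persuasionGame u v).epsBestResponses aStar p π ε) :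
    ∃ g : S → ℝ, (∀ s, 0 ≤ g s) ∧ ∑ s, g s ≤ ε ∧ ∀ s s',
      beliefUtil u s' (directProb p π a s) - beliefUtil u s (directProb p π a s) ≤ g s := by
  choose b hb using fun s => Finite.exists_max fun s' => beliefUtil u s' (directProb p π a s)
  refine ⟨fun s => beliefUtil u (b s) (directProb p π a s) - beliefUtil u s (directProb p π a s),
    fun s => sub_nonneg.2 (hb s s), ?_, fun s s' => sub_le_sub_right (hb s s') _⟩
  have hbest := hStar.1 (b ∘ a)
  have hnear : (persuasionGame u v).U (aStar p π) p π - ε ≤ (persuasionGame u v).U (id ∘ a) p π :=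
    ha
  rw [persuasionGame_U_comp] at hbest hnear
  rw [Finset.sum_sub_distrib]
  simp only [id_eq] at hnear
  linarith

lemma exists_obedient_of_epsBestResponse [Nonempty S] (hv : ∀ s, v s ∈ Set.Icc (0 : ℝ) 1) {C : ℝ}
    (hC : SeparatedBy u C) {aStar : SignalScheme S → stdSimplex ℝ (Fin 2) → (S → S)}
    (hStar : (persuasionGame u v).IsBestResponse p π (aStar p π)) {τ ε : ℝ} (hτ : 0 ≤ τ)
    (hτC : τ < C) {a : S → S} (ha : a ∈ (persuasionGame u v).epsBestResponses aStar p π ε) :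
    ∃ z : S → Fin 2 → ℝ, 0 ≤ z ∧ ∑ s, z s = π ∧ (∀ s, ObedientBy u τ s (z s)) ∧
      (persuasionGame u v).V a p π - (τ + ε) / C ≤ obedientValue v z := by
  obtain ⟨g, hg0, hgε, hg⟩ := exists_disobedienceGain_directProb hStar ha
  have hmass : ∑ s, (directProb p π a s 0 + directProb p π a s 1) = 1 := by
    simp only [Finset.sum_add_distrib, ← Finset.sum_apply, sum_directProb]
    exact stdSimplex.add_eq_one π
  rw [← sum_directProb p π a, ← obedientValue_directProb]
  exact hC.exists_obedient hv hτ hτC (directProb_nonneg p π a) hmass hg0 hg hgε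

end Persuasion

/-! ## Rounding to a grid -/

section PairSignal

variable {S : Type*}

open Classical in
/-- The joint distribution of signals and states whose only signals are `i` and `j`, with
unnormalized beliefs `x` and `x'`, which are added up if `i = j`. -/
noncomputable def pairSignal (i j : S) (x x' : Fin 2 → ℝ) : S → Fin 2 → ℝ :=
  Pi.single i x + Pi.single j x'

lemma pairSignal_of_ne {i j s : S} (hi : s ≠ i) (hj : s ≠ j) (x x' : Fin 2 → ℝ) :
    pairSignal i j x x' s = 0 := by
  simp [pairSignal, hi, hj]

lemma le_pairSignal_left (i j : S) (x : Fin 2 → ℝ) {x' : Fin 2 → ℝ} (hx' : 0 ≤ x') :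
    x ≤ pairSignal i j x x' i := by
  classical
  have hj : 0 ≤ (Pi.single j x' : S → Fin 2 → ℝ) := Pi.single_nonneg.2 hx'
  simpa [pairSignal] using hj i

lemma le_pairSignal_right (i j : S) {x : Fin 2 → ℝ} (hx : 0 ≤ x) (x' : Fin 2 → ℝ) :
    x' ≤ pairSignal i j x x' j := by
  classical
  have hi : 0 ≤ (Pi.single i x : S → Fin 2 → ℝ) := Pi.single_nonneg.2 hx
  simpa [pairSignal] using hi j

lemma ObedientBy.pairSignal {u : S → Fin 2 → ℝ} {τ : ℝ} {i j : S} {x x' : Fin 2 → ℝ}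
    (hi : ObedientBy u τ i x) (hj : ObedientBy u τ j x') (s : S) :
    ObedientBy u τ s (pairSignal i j x x' s) := by
  classical
  refine .add ?_ ?_
  · rcases eq_or_ne s i with rfl | h
    · rwa [Pi.single_eq_same]
    · rw [Pi.single_eq_of_ne h]
      exact .zero
  · rcases eq_or_ne s j with rfl | h
    · rwa [Pi.single_eq_same]
    · rw [Pi.single_eq_of_ne h]
      exact .zero

lemma abs_pairSignal_sub_le (i j s : S) (q x z : Fin 2 → ℝ) (y : Fin 2) :
    |pairSignal i j x (q - x) s y - pairSignal i j z (q - z) s y| ≤ |x y - z y| := by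
  classical
  simp only [pairSignal, Pi.add_apply, Pi.single_apply]
  split_ifs
  · simp
  · simp
  · rw [← abs_neg]
    simp
  · simp

lemma obedientValue_pairSignal [Fintype S] (v : S → ℝ) (i j : S) (x x' : Fin 2 → ℝ) :
    obedientValue v (pairSignal i j x x') = (x 0 + x 1) * v i + (x' 0 + x' 1) * v j := by
  classical
  have hmass : ∀ s, pairSignal i j x x' s 0 + pairSignal i j x x' s 1 =
      (if s = i then x 0 + x 1 else 0) + if s = j then x' 0 + x' 1 else 0 := fun s => by
    simp only [pairSignal, Pi.add_apply, Pi.single_apply]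
    split_ifs <;> simp [add_add_add_comm]
  simp only [obedientValue, hmass, add_mul, ite_mul, zero_mul, Finset.sum_add_distrib,
    Finset.sum_ite_eq', Finset.mem_univ, if_true]

end PairSignal

section Grid

variable {S : Type*} [Fintype S]

open Classical in
/-- The scheme that sends the signal `i` with probability `k y / N` in state `y`, and else `j`. -/
noncomputable def gridScheme (N : ℕ) (i j : S) (k : Fin 2 → Fin (N + 1)) : SignalScheme S :=
  fun y => ⟨((k y : ℝ) / N) • Pi.single i 1 + (1 - (k y : ℝ) / N) • Pi.single j 1,
    convex_stdSimplex ℝ S (single_mem_stdSimplex ℝ i) (single_mem_stdSimplex ℝ j) (by positivity)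
      (sub_nonneg.2 (div_le_one_of_le₀ (mod_cast (k y).is_le) N.cast_nonneg))
      (add_sub_cancel _ _)⟩

open Classical in
/-- All schemes with at most two signals and probabilities that are multiples of `1/N`. -/
noncomputable def gridSchemes (S : Type*) [Fintype S] (N : ℕ) : Finset (SignalScheme S) :=
  Finset.univ.image fun x : S × S × (Fin 2 → Fin (N + 1)) => gridScheme N x.1 x.2.1 x.2.2

lemma gridScheme_mem_gridSchemes (N : ℕ) (i j : S) (k : Fin 2 → Fin (N + 1)) :
    gridScheme N i j k ∈ gridSchemes S N := by
  classical
  exact Finset.mem_image.2 ⟨(i, j, k), Finset.mem_univ _, rfl⟩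

lemma card_gridSchemes_le (S : Type*) [Fintype S] {δ : ℝ} (hδ : 0 < δ) (hδ1 : δ ≤ 1) :
    ((gridSchemes S ⌈1 / δ⌉₊).card : ℝ) ≤ 9 * ((Fintype.card S : ℝ) ^ 2 / δ ^ 2) := by
  classical
  have hcard : (gridSchemes S ⌈1 / δ⌉₊).card ≤ Fintype.card S ^ 2 * (⌈1 / δ⌉₊ + 1) ^ 2 := by
    refine Finset.card_image_le.trans (le_of_eq ?_)
    simp only [Finset.card_univ, Fintype.card_prod, Fintype.card_fun, Fintype.card_fin]
    ring
  have hceil : (⌈1 / δ⌉₊ : ℝ) + 1 ≤ 3 * (1 / δ) := by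
    have hle : (1 : ℝ) ≤ 1 / δ := (one_le_div hδ).2 hδ1
    linarith [Nat.ceil_lt_add_one (show 0 ≤ 1 / δ by positivity)]
  calc ((gridSchemes S ⌈1 / δ⌉₊).card : ℝ)
      ≤ (Fintype.card S : ℝ) ^ 2 * ((⌈1 / δ⌉₊ : ℝ) + 1) ^ 2 := mod_cast hcard
    _ ≤ (Fintype.card S : ℝ) ^ 2 * (3 * (1 / δ)) ^ 2 := by gcongr
    _ = 9 * ((Fintype.card S : ℝ) ^ 2 / δ ^ 2) := by ring

lemma jointProb_gridScheme (N : ℕ) (i j : S) (k : Fin 2 → Fin (N + 1))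
    (π : stdSimplex ℝ (Fin 2)) :
    jointProb (gridScheme N i j k) π =
      pairSignal i j (fun y => π y * (k y / N)) (π - fun y => π y * (k y / N)) := by
  classical
  ext s y
  change π y * (((k y : ℝ) / N) • Pi.single i 1 + (1 - (k y : ℝ) / N) • Pi.single j 1 : S → ℝ) s = _
  simp only [pairSignal, Pi.add_apply, Pi.smul_apply, Pi.single_apply, smul_eq_mul]
  split_ifs <;> simp [mul_sub]

lemma exists_fin_mul_div_mem_Icc {N : ℕ} (hN : 0 < N) {q a : ℝ} (ha : 0 ≤ a) (haq : a ≤ q) :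
    ∃ k : Fin (N + 1), q * (k / N) ∈ Set.Icc (a - q / N) a := by
  have hN' : (0 : ℝ) < N := mod_cast hN
  rcases (ha.trans haq).eq_or_lt with rfl | hq
  · exact ⟨0, by simp [le_antisymm haq ha]⟩
  · have hq' : a / q * N * q = a * N := by rw [mul_right_comm, div_mul_cancel₀ _ hq.ne']
    have hle : a / q * N ≤ N := mul_le_of_le_one_left hN'.le ((div_le_one hq).2 haq)
    have hlower := mul_le_mul_of_nonneg_right
      (Nat.floor_le (show 0 ≤ a / q * N by positivity)) hq.le
    have hupper := mul_le_mul_of_nonneg_right (Nat.lt_floor_add_one (a / q * N)).le hq.le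
    refine ⟨⟨⌊a / q * N⌋₊, Nat.lt_succ_of_le (Nat.floor_le_of_le hle)⟩, ?_, ?_⟩
    · rw [sub_le_iff_le_add, mul_div_assoc', ← add_div, le_div_iff₀ hN']
      linarith
    · rw [mul_div_assoc', div_le_iff₀ hN']
      linarith

lemma exists_gridScheme_near {N : ℕ} (hN : 0 < N) (i j : S) {π : stdSimplex ℝ (Fin 2)}
    {z : Fin 2 → ℝ} (hz : 0 ≤ z) (hzπ : z ≤ π) :
    ∃ k w, jointProb (gridScheme N i j k) π = pairSignal i j w (π - w) ∧ 0 ≤ w ∧ w ≤ z ∧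
      z 0 - w 0 + (z 1 - w 1) ≤ 1 / N := by
  choose k hk using fun y => exists_fin_mul_div_mem_Icc hN (hz y) (hzπ y)
  refine ⟨k, _, jointProb_gridScheme N i j k π, fun y => mul_nonneg (π.2.1 y) (by positivity),
    fun y => (hk y).2, ?_⟩
  rw [← stdSimplex.add_eq_one π, add_div]
  linarith [(hk 0).1, (hk 1).1]

/-- The signals of `p` that are not rare are obedient by `τ`, and all signals but `k` and `l` have
probability zero, where `k` has probability at least one half. -/
structure IsRobust (u : S → Fin 2 → ℝ) (τ θ : ℝ) (p : SignalScheme S) (π : stdSimplex ℝ (Fin 2))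
    (k l : S) : Prop where
  half : 1 / 2 ≤ jointProb p π k 0 + jointProb p π k 1
  zero : ∀ s, s ≠ k → s ≠ l → jointProb p π s = 0
  obedient : ∀ s, θ ≤ jointProb p π s 0 + jointProb p π s 1 → ObedientBy u τ s (jointProb p π s)

namespace IsRobust

variable {u : S → Fin 2 → ℝ} {v : S → ℝ} {τ θ : ℝ} {p : SignalScheme S} {π : stdSimplex ℝ (Fin 2)}
  {k l : S} {aStar : SignalScheme S → stdSimplex ℝ (Fin 2) → (S → S)}

lemma aStar_eq (h : IsRobust u τ θ p π k l) (hτ : 0 < τ) (hθ : 0 < θ)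
    (hStar : (persuasionGame u v).IsBestResponse p π (aStar p π)) {s : S}
    (hs : θ ≤ jointProb p π s 0 + jointProb p π s 1) : aStar p π s = s := by
  by_contra hne
  linarith [h.obedient s hs _ hne, beliefUtil_le_of_isBestResponse hStar s s,
    mul_pos hτ (hθ.trans_le hs)]

lemma V_sub_le (h : IsRobust u τ θ p π k l) (hv : ∀ s, v s ∈ Set.Icc (0 : ℝ) 1) {a b : S → S}
    {m : ℝ} (hm : 0 ≤ m) (hk : a k = b k)
    (hl : a l = b l ∨ jointProb p π l 0 + jointProb p π l 1 ≤ m) :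
    (persuasionGame u v).V a p π - (persuasionGame u v).V b p π ≤ m := by
  rw [persuasionGame_V, persuasionGame_V, ← Finset.sum_sub_distrib, Finset.sum_eq_single l]
  · rw [← mul_sub]
    rcases hl with hl | hl
    · rwa [hl, sub_self, mul_zero]
    · refine (mul_le_of_le_one_right ?_ ?_).trans hl
      · exact add_nonneg (jointProb_nonneg p π l 0) (jointProb_nonneg p π l 1)
      · linarith [(hv (a l)).2, (hv (b l)).1]
  · intro s _ hs
    by_cases hsk : s = k
    · rw [hsk, hk, sub_self]
    · simp [h.zero s hsk hs]
  · simp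

lemma value_le (h : IsRobust u τ θ p π k l) (hτ : 0 < τ) (hθ : 0 < θ) (hθ' : θ ≤ 1 / 2)
    (hv : ∀ s, v s ∈ Set.Icc (0 : ℝ) 1)
    (hStar : (persuasionGame u v).IsBestResponse p π (aStar p π)) :
    obedientValue v (jointProb p π) - θ ≤ (persuasionGame u v).V (aStar p π) p π := by
  rw [obedientValue_jointProb u, sub_le_comm]
  refine h.V_sub_le hv hθ.le (h.aStar_eq hτ hθ hStar (hθ'.trans h.half)).symm ?_
  rcases le_total θ (jointProb p π l 0 + jointProb p π l 1) with hl | hl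
  · exact .inl (h.aStar_eq hτ hθ hStar hl).symm
  · exact .inr hl

lemma isStable (h : IsRobust u τ θ p π k l) (hτ : 0 < τ) (hθ : 0 < θ) (hθ' : θ ≤ 1 / 2)
    (hv : ∀ s, v s ∈ Set.Icc (0 : ℝ) 1) {x : ℝ} (hx : x ∈ Set.Icc (0 : ℝ) 1)
    (hStar : (persuasionGame u v).IsBestResponse p π (aStar p π)) :
    (persuasionGame u v).IsStable aStar (x / 2 * τ) (max x θ) π p := by
  intro a _
  by_cases hbig : ∃ s, a s ≠ aStar p π s ∧ max θ (x / 2) ≤ jointProb p π s 0 + jointProb p π s 1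
  · obtain ⟨s, hs, hmass⟩ := hbig
    have hfollow : aStar p π s = s := h.aStar_eq hτ hθ hStar ((le_max_left _ _).trans hmass)
    have hloss := beliefUtil_sub_le_U_sub hStar a s
    rw [hfollow] at hs hloss
    have hobey := h.obedient s ((le_max_left _ _).trans hmass) (a s) hs
    left
    linarith [mul_le_mul_of_nonneg_left ((le_max_right θ (x / 2)).trans hmass) hτ.le]
  · push Not at hbig
    have hagree : a k = aStar p π k := by
      by_contra hk
      exact (hbig k hk).not_ge ((max_le hθ' (by linarith [hx.2])).trans h.half)
    right
    refine sub_le_comm.1 (h.V_sub_le hv (hx.1.trans (le_max_left _ _)) hagree.symm ?_)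
    by_cases hl : a l = aStar p π l
    · exact .inl hl.symm
    · refine .inr ((hbig l hl).le.trans ?_)
      exact max_le (le_max_right _ _) ((half_le_self hx.1).trans (le_max_left _ _))

end IsRobust

variable {u : S → Fin 2 → ℝ} {v : S → ℝ} {π : stdSimplex ℝ (Fin 2)}
  {aStar : SignalScheme S → stdSimplex ℝ (Fin 2) → (S → S)}

lemma isRobust_of_jointProb_eq_pairSignal (hu : ∀ s y, u s y ∈ Set.Icc (0 : ℝ) 1) {β δ : ℝ}
    (hβ : 0 < β) (hβ1 : β ≤ 1) (hδ : 0 < δ) (hδβ : √δ ≤ β / 4) {p : SignalScheme S} {i j : S}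
    {w z : Fin 2 → ℝ} (hp : jointProb p π = pairSignal i j w (π - w)) (hw : 0 ≤ w) (hwz : w ≤ z)
    (hzπ : z ≤ π) (hnear : z 0 - w 0 + (z 1 - w 1) ≤ δ) (hi : ObedientBy u β i z)
    (hj : ObedientBy u β j (π - z)) : ∃ k l, IsRobust u (β / 2) √δ p π k l := by
  have hobey : ∀ s, √δ ≤ jointProb p π s 0 + jointProb p π s 1 →
      ObedientBy u (β / 2) s (jointProb p π s) := fun s hs => by
    rw [hp] at hs ⊢
    refine (hi.pairSignal hj s).of_near hu (d := δ) hβ.le ?_ ?_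
    · refine (add_le_add (abs_pairSignal_sub_le i j s π w z 0)
        (abs_pairSignal_sub_le i j s π w z 1)).trans ?_
      rwa [abs_sub_comm, abs_sub_comm (w 1), abs_of_nonneg (sub_nonneg.2 (hwz 0)),
        abs_of_nonneg (sub_nonneg.2 (hwz 1))]
    · calc (1 + β) * δ ≤ 2 * (√δ * √δ) := by rw [Real.mul_self_sqrt hδ.le]; gcongr; linarith
        _ ≤ 2 * (β / 4 * (_ + _)) := by gcongr
        _ = (β - β / 2) * (_ + _) := by ring
  have hzero : ∀ s, s ≠ i → s ≠ j → jointProb p π s = 0 := fun s hsi hsj => by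
    rw [hp, pairSignal_of_ne hsi hsj]
  have hmass := stdSimplex.add_eq_one π
  rcases le_total (1 / 2) (w 0 + w 1) with h | h
  · have hle := le_pairSignal_left i j w (sub_nonneg.2 (hwz.trans hzπ))
    exact ⟨i, j, by rw [hp]; linarith [hle 0, hle 1], hzero, hobey⟩
  · have hle := le_pairSignal_right i j hw (π - w)
    simp only [Pi.le_def, Pi.sub_apply] at hle
    exact ⟨j, i, by rw [hp]; linarith [hle 0, hle 1], fun s hsj hsi => hzero s hsi hsj, hobey⟩

lemma exists_robust_gridScheme (hu : ∀ s y, u s y ∈ Set.Icc (0 : ℝ) 1)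
    (hv : ∀ s, v s ∈ Set.Icc (0 : ℝ) 1) {β δ : ℝ} (hβ : 0 < β) (hβ1 : β ≤ 1) (hδ : 0 < δ)
    (hδβ : √δ ≤ β / 4) {i j : S} {z : Fin 2 → ℝ} (hz : 0 ≤ z) (hzπ : z ≤ π)
    (hi : ObedientBy u β i z) (hj : ObedientBy u β j (π - z)) :
    ∃ p ∈ gridSchemes S ⌈1 / δ⌉₊, (∃ k l, IsRobust u (β / 2) √δ p π k l) ∧
      obedientValue v (pairSignal i j z (π - z)) - √δ ≤ obedientValue v (jointProb p π) := by
  have hN : 0 < ⌈1 / δ⌉₊ := Nat.ceil_pos.2 (by positivity)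
  obtain ⟨k, w, hp, hw, hwz, hnear⟩ := exists_gridScheme_near hN i j hz hzπ
  have hmesh : z 0 - w 0 + (z 1 - w 1) ≤ δ :=
    hnear.trans ((one_div_le (by positivity) hδ).2 (Nat.le_ceil _))
  refine ⟨_, gridScheme_mem_gridSchemes _ i j k,
    isRobust_of_jointProb_eq_pairSignal hu hβ hβ1 hδ hδβ hp hw hwz hzπ hmesh hi hj, ?_⟩
  have hδle : δ ≤ √δ := (Real.mul_self_sqrt hδ.le).symm.le.trans
    (mul_le_of_le_one_left (Real.sqrt_nonneg δ) (by linarith))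
  have hshift : (z 0 - w 0 + (z 1 - w 1)) * (v i - v j) ≤ z 0 - w 0 + (z 1 - w 1) :=
    mul_le_of_le_one_right (by linarith [hwz 0, hwz 1]) (by linarith [(hv i).2, (hv j).1])
  rw [hp, obedientValue_pairSignal, obedientValue_pairSignal]
  simp only [Pi.sub_apply]
  linarith

lemma exists_stable_gridScheme [Nonempty S] (hu : ∀ s y, u s y ∈ Set.Icc (0 : ℝ) 1)
    (hv : ∀ s, v s ∈ Set.Icc (0 : ℝ) 1) {C : ℝ} (hC : SeparatedBy u C)
    (hStar : (persuasionGame u v).IsBestResponseRule aStar) {β ε x δ : ℝ} (hβ : 0 < β)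
    (hβC : β < C) (hx : x ∈ Set.Icc (0 : ℝ) 1) (hδ : 0 < δ) (hδβ : √δ ≤ β / 4)
    {p₀ : SignalScheme S} {a : S → S}
    (ha : a ∈ (persuasionGame u v).epsBestResponses aStar p₀ π ε) :
    ∃ p ∈ gridSchemes S ⌈1 / δ⌉₊,
      (persuasionGame u v).IsStable aStar (x / 2 * (β / 2)) (max x √δ) π p ∧
      (persuasionGame u v).V a p₀ π - ((β + ε) / C + 2 * √δ) ≤
        (persuasionGame u v).V (aStar p π) p π := by
  have hβ1 : β ≤ 1 := hβC.le.trans hC.le_one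
  obtain ⟨z, hz, hzπ, hobey, hvalue⟩ :=
    exists_obedient_of_epsBestResponse hv hC (hStar p₀ π) hβ.le hβC ha
  obtain ⟨i, j, b, c, hb, hc, hbc, hpair⟩ := exists_pair_combination hz
    (f := fun s => (z s 0 + z s 1) * v s) fun s hs => by simp [hs]
  rw [hzπ, ← eq_sub_iff_add_eq'] at hbc
  have hcz : 0 ≤ c • z j := smul_nonneg hc (hz j)
  obtain ⟨p, hp, ⟨k, l, hrobust⟩, hround⟩ := exists_robust_gridScheme (v := v) (π := π) hu hv hβ
    hβ1 hδ hδβ (i := i) (j := j) (smul_nonneg hb (hz i)) (sub_nonneg.1 (hbc ▸ hcz))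
    ((hobey i).smul hb) (hbc ▸ (hobey j).smul hc)
  have hθ : √δ ≤ 1 / 2 := by linarith
  have hθ0 := Real.sqrt_pos.2 hδ
  refine ⟨p, hp, hrobust.isStable (half_pos hβ) hθ0 hθ hv hx (hStar p π), ?_⟩
  rw [← hbc, obedientValue_pairSignal] at hround
  simp only [Pi.smul_apply, smul_eq_mul] at hround
  rw [obedientValue] at hvalue
  linarith [hrobust.value_le (half_pos hβ) hθ0 hθ hv (hStar p π)]

lemma exists_isOptimalStable_gridScheme [Nonempty S] (hu : ∀ s y, u s y ∈ Set.Icc (0 : ℝ) 1)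
    (hv : ∀ s, v s ∈ Set.Icc (0 : ℝ) 1) {C : ℝ} (hC : SeparatedBy u C)
    (hStar : (persuasionGame u v).IsBestResponseRule aStar) (P₀ : Set (SignalScheme S))
    {β ε x δ : ℝ} (hβ : 0 < β) (hβC : β < C) (hε : 0 ≤ ε) (hx : x ∈ Set.Icc (0 : ℝ) 1)
    (hδ : 0 < δ) (hδβ : √δ ≤ β / 4) (π : stdSimplex ℝ (Fin 2)) :
    ∃ p ∈ gridSchemes S ⌈1 / δ⌉₊, (persuasionGame u v).IsOptimalStable aStar P₀
      ((β + ε) / C + 2 * √δ) ε (x / 2 * (β / 2)) (max x √δ) π p := by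
  classical
  set G := (gridSchemes S ⌈1 / δ⌉₊).filter
    ((persuasionGame u v).IsStable aStar (x / 2 * (β / 2)) (max x √δ) π)
  have hcompete : ∀ p₀, ∀ a ∈ (persuasionGame u v).epsBestResponses aStar p₀ π ε, ∃ p ∈ G,
      (persuasionGame u v).V a p₀ π - ((β + ε) / C + 2 * √δ) ≤
        (persuasionGame u v).V (aStar p π) p π := fun p₀ a ha => by
    obtain ⟨p, hp, hstable, hvalue⟩ := exists_stable_gridScheme hu hv hC hStar hβ hβC hx hδ hδβ ha
    exact ⟨p, Finset.mem_filter.2 ⟨hp, hstable⟩, hvalue⟩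
  have hG : G.Nonempty := by
    obtain ⟨s⟩ := ‹Nonempty S›
    obtain ⟨p, hp, -⟩ := hcompete (gridScheme 0 s s 0) (aStar (gridScheme 0 s s 0) π)
      (sub_le_self _ hε)
    exact ⟨p, hp⟩
  obtain ⟨p, hp, hmax⟩ := G.exists_max_image (fun p => (persuasionGame u v).V (aStar p π) p π) hG
  refine ⟨p, (Finset.mem_filter.1 hp).1, (Finset.mem_filter.1 hp).2, fun p₀ _ a ha => ?_⟩
  obtain ⟨p', hp', hvalue⟩ := hcompete p₀ a ha
  exact hvalue.trans (hmax p' hp')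

lemma exists_optimalStableOracle [Nonempty S] (hu : ∀ s y, u s y ∈ Set.Icc (0 : ℝ) 1)
    (hv : ∀ s, v s ∈ Set.Icc (0 : ℝ) 1) {C : ℝ} (hC : SeparatedBy u C)
    (hStar : (persuasionGame u v).IsBestResponseRule aStar) (P₀ : Set (SignalScheme S))
    {β ε x δ : ℝ} (hβ : β ∈ Set.Ico 0 C) (hε : ε ∈ Set.Icc (0 : ℝ) 1)
    (hx : x ∈ Set.Icc (0 : ℝ) 1) (hδ : 0 < δ) (hδβ : δ ≤ β ^ 2 / 16) :
    ∃ (PO : Finset (SignalScheme S)) (O : stdSimplex ℝ (Fin 2) → SignalScheme S),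
      (PO.card : ℝ) ≤ 9 * ((Fintype.card S : ℝ) ^ 2 / δ ^ 2) ∧
      (persuasionGame u v).IsOptimalStableOracle aStar P₀
        (3 * β / C + 1 / C * √ε + 2 * √δ) ε (x * (1 / 2) * β / 2) (max x √δ) PO O := by
  have hC0 := hC.pos
  have hβ0 : 0 < β := hβ.1.lt_of_ne' fun h => by simp [h] at hδβ; linarith
  have hβ1 : β ≤ 1 := hβ.2.le.trans hC.le_one
  have hδβ' : √δ ≤ β / 4 := Real.sqrt_le_iff.2 ⟨by positivity, by linarith⟩
  choose O hO hstable hvalue using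
    exists_isOptimalStable_gridScheme hu hv hC hStar P₀ hβ0 hβ.2 hε.1 hx hδ hδβ'
  have hparam : x * (1 / 2) * β / 2 = x / 2 * (β / 2) := by ring
  have hcost : (β + ε) / C ≤ 3 * β / C + 1 / C * √ε := by
    have hsqrt : ε ≤ √ε := Real.le_sqrt_of_sq_le (by nlinarith [hε.1, hε.2])
    rw [one_div_mul_eq_div, ← add_div]
    gcongr
    linarith
  refine ⟨_, O, card_gridSchemes_le S hδ (hδβ.trans (by nlinarith)), fun π =>
    ⟨hO π, hparam ▸ hstable π, fun p₀ hp₀ a ha => le_trans ?_ (hvalue π p₀ hp₀ a ha)⟩⟩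
  linarith

end Grid

/-! ## Rates -/

section Rates

variable {T τ Z : ℝ}

lemma one_le_two_mul_log (hT : 2 ≤ T) : 1 ≤ 2 * Real.log T := by
  linarith [Real.log_two_gt_d9, Real.log_le_log two_pos hT]

lemma sqrt_mul_eq_mul_sqrt_div (hT : 0 < T) (N : ℝ) : √(N * T) = T * √(N / T) := by
  rw [← Real.sqrt_sq hT.le, ← Real.sqrt_mul (sq_nonneg T), Real.sqrt_sq hT.le]
  congr 1
  field_simp

lemma div_le_mul_pow_six (hT : T * τ ^ 10 = 1) (hτ : 0 < τ) {N : ℝ} (hN : N ≤ Z / τ ^ 4) :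
    N / T ≤ Z * τ ^ 6 := by
  rw [eq_one_div_of_mul_eq_one_left hT]
  calc N / (1 / τ ^ 10) ≤ Z / τ ^ 4 / (1 / τ ^ 10) := by gcongr
    _ = Z * τ ^ 6 := by field_simp

lemma div_le_mul_pow_three (hT : T * τ ^ 10 = 1) (hτ : τ ∈ Set.Ioc 0 1) (hZ : 1 ≤ Z) {N : ℝ}
    (hN : N ≤ Z / τ ^ 4) : N / T ≤ Z * τ ^ 3 :=
  (div_le_mul_pow_six hT hτ.1 hN).trans <|
    mul_le_mul_of_nonneg_left (pow_le_pow_of_le_one hτ.1.le hτ.2 (by norm_num)) (by linarith)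

lemma sqrt_div_le_mul_pow_three (hT : T * τ ^ 10 = 1) (hτ : 0 < τ) (hZ : 1 ≤ Z) {N : ℝ}
    (hN : N ≤ Z / τ ^ 4) : √(N / T) ≤ Z * τ ^ 3 :=
  Real.sqrt_le_iff.2 ⟨by positivity,
    calc N / T ≤ Z * τ ^ 6 := div_le_mul_pow_six hT hτ hN
      _ ≤ Z ^ 2 * τ ^ 6 := by gcongr; exact le_self_pow₀ hZ two_ne_zero
      _ = (Z * τ ^ 3) ^ 2 := by ring⟩

lemma mul_rpow_neg_one_tenth_pow_ten (hT : 0 < T) : T * (T ^ (-(1 / 10) : ℝ)) ^ 10 = 1 := by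
  rw [← Real.rpow_mul_natCast hT.le]
  norm_num [Real.rpow_neg_one, hT.ne']

lemma rpow_neg_one_fifth (hT : 0 ≤ T) : T ^ (-(1 / 5) : ℝ) = (T ^ (-(1 / 10) : ℝ)) ^ 2 := by
  rw [← Real.rpow_mul_natCast hT]
  norm_num

lemma regret_error_le (hT : 0 < T) {M N R ℓ : ℝ} (hℓ : 1 ≤ ℓ) (hM : √(M / T) ≤ R) (hN : N / T ≤ R)
    (hN' : √(N / T) ≤ R) (κs κn κ : ℝ) :
    (T * (κs * √(M / T)) + |κn| * √(N * T) + 2 * (|κ| * 2 * (N * ℓ + √ℓ * √(N * T)))) / T ≤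
      (|κs| + |κn| + 8 * |κ|) * R * ℓ := by
  have hR : 0 ≤ R := (Real.sqrt_nonneg _).trans hM
  have hRℓ : R ≤ R * ℓ := le_mul_of_one_le_right hR hℓ
  have hsqrtℓ : √ℓ ≤ ℓ := Real.sqrt_le_self_iff.2 (.inr hℓ)
  have hswap : κs * √(M / T) ≤ |κs| * (R * ℓ) :=
    mul_le_mul (le_abs_self _) (hM.trans hRℓ) (Real.sqrt_nonneg _) (abs_nonneg _)
  have hinfo : |κn| * √(N / T) ≤ |κn| * (R * ℓ) := by
    gcongr
    exact hN'.trans hRℓ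
  have hbias : |κ| * (N / T * ℓ + √ℓ * √(N / T)) ≤ |κ| * (R * ℓ + ℓ * R) := by gcongr
  calc _ = κs * √(M / T) + |κn| * √(N / T) + 4 * (|κ| * (N / T * ℓ + √ℓ * √(N / T))) := by
        rw [sqrt_mul_eq_mul_sqrt_div hT]
        field_simp
        ring
    _ ≤ |κs| * (R * ℓ) + |κn| * (R * ℓ) + 4 * (|κ| * (R * ℓ + ℓ * R)) := by gcongr
    _ = (|κs| + |κn| + 8 * |κ|) * R * ℓ := by ring

lemma regret_factor_le (hτ : τ ∈ Set.Ioc 0 1) {p : ℝ} (hp : 0 ≤ p) :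
    1 / (τ ^ 2 / 4) + 1 + p * (1 / τ ^ 2 + 1) ≤ (5 + 2 * p) / τ ^ 2 := by
  have hτ0 := hτ.1
  have hτ2 : 1 ≤ 1 / τ ^ 2 := one_le_one_div (by positivity) (pow_le_one₀ hτ0.le hτ.2)
  calc 1 / (τ ^ 2 / 4) + 1 + p * (1 / τ ^ 2 + 1)
      ≤ 1 / (τ ^ 2 / 4) + 1 / τ ^ 2 + p * (1 / τ ^ 2 + 1 / τ ^ 2) := by gcongr
    _ = (5 + 2 * p) / τ ^ 2 := by field_simp; ring

lemma logFactor_le {ι : Type*} [Fintype ι] [Nonempty ι] {T : ℕ} (hT : 2 ≤ T) (hZ : 1 ≤ Z)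
    (hι : (Fintype.card ι : ℝ) ≤ Z * T) :
    logFactor (Fin 2) ι T ≤ (2 * Real.log (2 * Z) + 2) * Real.log T := by
  have hT' : (2 : ℝ) ≤ T := by exact_mod_cast hT
  have hlogZ : 0 ≤ Real.log (2 * Z) := Real.log_nonneg (by linarith)
  calc logFactor (Fin 2) ι T ≤ Real.log (2 * Z * T ^ 2) := by
        rw [logFactor]
        have := Fintype.card_pos (α := ι)
        refine Real.log_le_log (by positivity) ?_
        rw [Fintype.card_fin, Nat.cast_ofNat, show 2 * Z * (T : ℝ) ^ 2 = 2 * (Z * T) * T by ring]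
        gcongr
    _ = Real.log (2 * Z) + 2 * Real.log T := by
        rw [Real.log_mul (by positivity) (by positivity), Real.log_pow, Nat.cast_ofNat]
    _ ≤ Real.log (2 * Z) * (2 * Real.log T) + 2 * Real.log T := by
        gcongr
        exact le_mul_of_one_le_right hlogZ (one_le_two_mul_log hT')
    _ = (2 * Real.log (2 * Z) + 2) * Real.log T := by ring

/-- The constant in the Principal's regret against `p` benchmark policies, for an oracle of
suboptimality `c₀ τ` and at most `Z / τ ^ 4` events, where `τ = T ^ (-1 / 10)`; `κ`, `κs` and `κn`
are the constants in the bounds on bias, swap regret and secret information. -/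
noncomputable def regretConstant (c₀ p Z κ κs κn : ℝ) : ℝ :=
  2 * (c₀ + 1) + (5 + 2 * p) * ((|κs| + |κn| + 8 * |κ|) * Z) * (2 * Real.log (2 * Z) + 2)

-- `τ` balances the oracle's cost `τ` against the learning error `τ ^ 3`, which is amplified by
-- `1 / ε` and `1 / β`, both of order `1 / τ ^ 2`.
lemma add_factor_mul_error_le (hτ : τ ∈ Set.Ioc 0 1) (hT : 2 ≤ T) (hZ : 1 ≤ Z) {c₀ p E : ℝ}
    (hc₀ : 0 ≤ c₀) (hp : 0 ≤ p) {κ κs κn : ℝ}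
    (hE : E ≤ (|κs| + |κn| + 8 * |κ|) * (Z * τ ^ 3) * ((2 * Real.log (2 * Z) + 2) * Real.log T)) :
    c₀ * τ + τ + (1 / (τ ^ 2 / 4) + 1 + p * (1 / τ ^ 2 + 1)) * E ≤
      regretConstant c₀ p Z κ κs κn * τ * Real.log T := by
  have hτ0 := hτ.1
  have hlogZ : 0 ≤ Real.log (2 * Z) := Real.log_nonneg (by linarith)
  have hlogT : 0 ≤ Real.log T := Real.log_nonneg (by linarith)
  set Λ := |κs| + |κn| + 8 * |κ|
  set q := 2 * Real.log (2 * Z) + 2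
  calc _ ≤ c₀ * τ + τ + (5 + 2 * p) / τ ^ 2 * (Λ * (Z * τ ^ 3) * (q * Real.log T)) := by
        refine add_le_add_right ((mul_le_mul_of_nonneg_left hE (by positivity)).trans ?_) _
        exact mul_le_mul_of_nonneg_right (regret_factor_le hτ hp) (by positivity)
    _ = (c₀ + 1) * τ * 1 + (5 + 2 * p) * (Λ * Z) * q * τ * Real.log T := by field_simp
    _ ≤ (c₀ + 1) * τ * (2 * Real.log T) + (5 + 2 * p) * (Λ * Z) * q * τ * Real.log T := by
        gcongr
        exact one_le_two_mul_log hT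
    _ = regretConstant c₀ p Z κ κs κn * τ * Real.log T := by rw [regretConstant]; ring

end Rates

section Main

lemma card_mul_card_le_card_events {A P : Type*} [Fintype A] (P₀ PO : Finset P) :
    PO.card * Fintype.card A ≤ Fintype.card (((PO × A) ⊕ (P₀ × A)) ⊕ (P₀ × A)) := by
  simp only [Fintype.card_sum, Fintype.card_prod, Fintype.card_coe]
  omega

lemma card_events_le {A P : Type*} [Fintype A] {τ m : ℝ} (hτ : τ ∈ Set.Ioc 0 1) {P₀ PO : Finset P}
    (hPO : (PO.card : ℝ) ≤ m / τ ^ 4) :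
    (Fintype.card (((PO × A) ⊕ (P₀ × A)) ⊕ (P₀ × A)) : ℝ) ≤
      (m + 2 * P₀.card) * Fintype.card A / τ ^ 4 := by
  have hP₀ : (P₀.card : ℝ) ≤ P₀.card / τ ^ 4 :=
    le_div_self (Nat.cast_nonneg _) (pow_pos hτ.1 4) (pow_le_one₀ hτ.1.le hτ.2)
  calc (Fintype.card (((PO × A) ⊕ (P₀ × A)) ⊕ (P₀ × A)) : ℝ)
      = (PO.card + 2 * P₀.card) * Fintype.card A := by
        simp only [Fintype.card_sum, Fintype.card_prod, Fintype.card_coe]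
        push_cast
        ring
    _ ≤ (m / τ ^ 4 + 2 * (P₀.card / τ ^ 4)) * Fintype.card A := by gcongr
    _ = (m + 2 * P₀.card) * Fintype.card A / τ ^ 4 := by ring

lemma StageGame.principalRegret_le_regretConstant {A P : Type*} [Fintype A] [Nonempty A]
    {G : StageGame A P (Fin 2)} (hU : ∀ a p y, G.agentUtil a p y ∈ Set.Icc (0 : ℝ) 1)
    (hV : ∀ a p y, G.principalUtil a p y ∈ Set.Icc (0 : ℝ) 1)
    {aStar : P → stdSimplex ℝ (Fin 2) → A} (haStar : G.IsBestResponseRule aStar)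
    {P₀ PO : Finset P} (hP₀ : P₀.Nonempty) {O : stdSimplex ℝ (Fin 2) → P} {T : ℕ} (hT : 2 ≤ T)
    {c₀ τ Z : ℝ} (hc₀ : 0 ≤ c₀) (hτ : τ ∈ Set.Ioc 0 1) (hTτ : T * τ ^ 10 = 1) (hZ : 1 ≤ Z)
    (hcard : (Fintype.card (((PO × A) ⊕ (P₀ × A)) ⊕ (P₀ × A)) : ℝ) ≤ Z / τ ^ 4)
    (hO : G.IsOptimalStableOracle aStar P₀ (c₀ * τ) (τ ^ 2) (τ ^ 2 / 4) τ PO O)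
    {pOpt : stdSimplex ℝ (Fin 2) → P} {aOpt : stdSimplex ℝ (Fin 2) → A} {F : Forecaster (Fin 2)}
    {κ : ℝ} (hF : HasLowBias F (events aStar P₀ PO O pOpt aOpt) T κ)
    {L : Learner A P (Fin 2)} {y : ℕ → Fin 2} {κs κn : ℝ}
    (hs : G.NoSwapRegret aStar P₀ O F L y T (κs * √((PO.card : ℝ) / T)))
    (hn : G.NoSecretInformation aStar P₀ O F L y T κn) :
    G.principalRegret aStar P₀ hP₀ O F L y T ≤
      regretConstant c₀ P₀.card Z κ κs κn * τ * Real.log T := by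
  have hτ0 := hτ.1
  have hT' : (2 : ℝ) ≤ T := by exact_mod_cast hT
  obtain ⟨p₀, hp₀⟩ := hP₀
  set ι := ((PO × A) ⊕ (P₀ × A)) ⊕ (P₀ × A)
  have : Nonempty ι := ⟨.inr (⟨p₀, hp₀⟩, Classical.arbitrary A)⟩
  have hN : (PO.card * Fintype.card A : ℝ) ≤ Z / τ ^ 4 :=
    le_trans (by exact_mod_cast card_mul_card_le_card_events P₀ PO) hcard
  have hPO : (PO.card : ℝ) ≤ Z / τ ^ 4 :=
    le_trans (le_mul_of_one_le_right (Nat.cast_nonneg _) (Nat.one_le_cast.2 Fintype.card_pos)) hN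
  have hcardT : (Fintype.card ι : ℝ) ≤ Z * T := hcard.trans <| by
    rw [eq_one_div_of_mul_eq_one_left hTτ, mul_one_div]
    gcongr Z / ?_
    exact pow_le_pow_of_le_one hτ0.le hτ.2 (by norm_num)
  have hregret := G.principalRegret_le hU hV haStar ⟨p₀, hp₀⟩ (ε := τ ^ 2) (β := τ ^ 2 / 4)
    (by positivity) (by positivity) hτ0.le hO (by omega) hF hs hn rfl rfl
  rw [Fintype.card_fin, Nat.cast_ofNat] at hregret
  have herror := regret_error_le (by linarith) (one_le_logFactor (ι := ι) hT)
    (sqrt_div_le_mul_pow_three hTτ hτ0 hZ hPO) (div_le_mul_pow_three hTτ hτ hZ hN)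
    (sqrt_div_le_mul_pow_three hTτ hτ0 hZ hN) κs κn κ
  exact hregret.trans <| add_factor_mul_error_le hτ hT' hZ hc₀ (Nat.cast_nonneg _) <|
    herror.trans <| mul_le_mul_of_nonneg_left (logFactor_le hT hZ hcardT) (by positivity)

lemma persuasionGame_principalRegret_le {S : Type*} [Fintype S] [DecidableEq S]
    {u : S → Fin 2 → ℝ} {v : S → ℝ} (hu : ∀ s y, u s y ∈ Set.Icc (0 : ℝ) 1)
    (hv : ∀ s, v s ∈ Set.Icc (0 : ℝ) 1) {aStar : SignalScheme S → stdSimplex ℝ (Fin 2) → (S → S)}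
    (hStar : (persuasionGame u v).IsBestResponseRule aStar) {P₀ PO : Finset (SignalScheme S)}
    (hP₀ : P₀.Nonempty) {O : stdSimplex ℝ (Fin 2) → SignalScheme S} {T : ℕ} (hT : 2 ≤ T)
    {C β ε x δ : ℝ} (hC : 0 < C) (hε : ε = (T : ℝ) ^ (-(1 / 5) : ℝ)) (hx : x = √ε) (hβ : β = √ε)
    (hδ : δ = β ^ 2 / 16) (hPO : (PO.card : ℝ) ≤ 9 * ((Fintype.card S : ℝ) ^ 2 / δ ^ 2))
    (hO : (persuasionGame u v).IsOptimalStableOracle aStar P₀ (3 * β / C + 1 / C * √ε + 2 * √δ) ε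
      (x * (1 / 2) * β / 2) (max x √δ) PO O)
    {pOpt : stdSimplex ℝ (Fin 2) → SignalScheme S} {aOpt : stdSimplex ℝ (Fin 2) → (S → S)}
    {F : Forecaster (Fin 2)} {κ : ℝ}
    (hF : HasLowBias F (StageGame.events aStar P₀ PO O pOpt aOpt) T κ)
    {L : Learner (S → S) (SignalScheme S) (Fin 2)} {y : ℕ → Fin 2} {κs κn : ℝ}
    (hs : (persuasionGame u v).NoSwapRegret aStar P₀ O F L y T (κs * √((PO.card : ℝ) / T)))
    (hn : (persuasionGame u v).NoSecretInformation aStar P₀ O F L y T κn) :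
    (persuasionGame u v).principalRegret aStar P₀ hP₀ O F L y T ≤
      regretConstant (4 / C + 1 / 2) P₀.card
        ((2304 * Fintype.card S ^ 2 + 2 * P₀.card) * Fintype.card (S → S)) κ κs κn *
          (T : ℝ) ^ (-(1 / 10) : ℝ) * Real.log T := by
  have hT' : (1 : ℝ) ≤ T := by exact_mod_cast one_le_two.trans hT
  have hT0 : (0 : ℝ) < T := by linarith
  have : Nonempty (S → S) := ⟨id⟩
  set τ := (T : ℝ) ^ (-(1 / 10) : ℝ)
  have hτ : τ ∈ Set.Ioc 0 1 :=
    ⟨Real.rpow_pos_of_pos hT0 _, Real.rpow_le_one_of_one_le_of_nonpos hT' (by norm_num)⟩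
  have hτ0 := hτ.1
  have hετ : ε = τ ^ 2 := hε.trans (rpow_neg_one_fifth hT0.le)
  have hsqrtε : √ε = τ := by rw [hετ, Real.sqrt_sq hτ0.le]
  have hsqrtδ : √δ = τ / 4 := by
    rw [hδ, hβ, hsqrtε, show τ ^ 2 / 16 = (τ / 4) ^ 2 by ring, Real.sqrt_sq (by positivity)]
  have hm : 9 * ((Fintype.card S : ℝ) ^ 2 / δ ^ 2) = 2304 * Fintype.card S ^ 2 / τ ^ 4 := by
    rw [hδ, hβ, hsqrtε]
    field_simp
    ring
  have hZ : 1 ≤ (2304 * Fintype.card S ^ 2 + 2 * P₀.card : ℝ) * Fintype.card (S → S) := by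
    exact_mod_cast Nat.mul_pos (by have := hP₀.card_pos; omega) Fintype.card_pos
  have hcost : 3 * β / C + 1 / C * √ε + 2 * √δ = (4 / C + 1 / 2) * τ := by
    rw [hsqrtδ, hβ, hsqrtε]
    ring
  have hgap : x * (1 / 2) * β / 2 = τ ^ 2 / 4 := by
    rw [hx, hβ, hsqrtε]
    ring
  rw [hcost, hgap, hx, hsqrtε, hsqrtδ, max_eq_left (by linarith), hετ] at hO
  exact StageGame.principalRegret_le_regretConstant
    (fun a p z => StageGame.expectedUtil_mem_Icc (fun s => hu (a s) z) (p z))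
    (fun a p z => StageGame.expectedUtil_mem_Icc (fun s => hv (a s)) (p z)) hStar hP₀ hT
    (by positivity) hτ (mul_rpow_neg_one_tenth_pow_ten hT0) hZ (card_events_le hτ (hm ▸ hPO)) hO hF hs
    hn

end Main

/-- `K₀` is the constant in the bound on the size of the oracle's output space and `κ₀` the constant
in the bound on the bias of the forecasts. -/
theorem theorem4 :
    ∃ K₀ κ₀ : ℝ, 0 < K₀ ∧ 0 < κ₀ ∧
    ∀ (S : Type*) [Fintype S] [DecidableEq S] [Nonempty S] (u : S → Fin 2 → ℝ) (v : S → ℝ),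
      (∀ s y, u s y ∈ Set.Icc (0 : ℝ) 1) → (∀ s, v s ∈ Set.Icc (0 : ℝ) 1) →
      EveryStrategyStrictlyOptimal u →
    ∃ C c₁ c₂ : ℝ, 0 < C ∧ 0 < c₁ ∧ 0 < c₂ ∧
      -- existence of the oracle
      (∀ aStar : SignalScheme S → stdSimplex ℝ (Fin 2) → (S → S),
        (persuasionGame u v).IsBestResponseRule aStar →
        ∀ (P₀ : Set (SignalScheme S)) (β ε x δ : ℝ), β ∈ Set.Ico 0 (C / 4) →
          ε ∈ Set.Icc (0 : ℝ) 1 → x ∈ Set.Icc (0 : ℝ) 1 → 0 < δ → δ ≤ β ^ 2 / 16 →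
          ∃ (PO : Finset (SignalScheme S)) (O : stdSimplex ℝ (Fin 2) → SignalScheme S),
            (PO.card : ℝ) ≤ K₀ * ((Fintype.card S : ℝ) ^ 2 / δ ^ 2) ∧
            (persuasionGame u v).IsOptimalStableOracle aStar P₀
              (3 * β / C + c₂ * √ε + 2 * √δ) ε (x * c₁ * β / 2) (max x (√δ)) PO O) ∧
      -- the Principal's regret
      (∀ (P₀ : Finset (SignalScheme S)) (hP₀ : P₀.Nonempty),
        ∃ (K : ℝ → ℝ → ℝ → ℝ) (k : ℕ),
        ∀ aStar : SignalScheme S → stdSimplex ℝ (Fin 2) → (S → S),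
          (persuasionGame u v).IsBestResponseRule aStar →
        ∀ (T : ℕ) (β ε x δ : ℝ), 2 ≤ T →
          ε = (T : ℝ) ^ (-(1 / 5) : ℝ) → x = √ε → β = √ε → δ = β ^ 2 / 16 → β < C / 4 →
          ∀ (PO : Finset (SignalScheme S)) (O : stdSimplex ℝ (Fin 2) → SignalScheme S),
            (PO.card : ℝ) ≤ K₀ * ((Fintype.card S : ℝ) ^ 2 / δ ^ 2) →
            (persuasionGame u v).IsOptimalStableOracle aStar P₀
              (3 * β / C + c₂ * √ε + 2 * √δ) ε (x * c₁ * β / 2) (max x (√δ)) PO O →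
          ∀ (pOpt : stdSimplex ℝ (Fin 2) → SignalScheme S) (aOpt : stdSimplex ℝ (Fin 2) → (S → S)),
            (persuasionGame u v).IsOptimisticRule aStar P₀ ε pOpt aOpt →
            (∃ F : Forecaster (Fin 2),
              HasLowBias F (StageGame.events aStar P₀ PO O pOpt aOpt) T κ₀) ∧
            ∀ (F : Forecaster (Fin 2)) (κ : ℝ),
              HasLowBias F (StageGame.events aStar P₀ PO O pOpt aOpt) T κ →
              ∀ (L : Learner (S → S) (SignalScheme S) (Fin 2)) (y : ℕ → Fin 2) (κs κn : ℝ),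
                (persuasionGame u v).NoSwapRegret aStar P₀ O F L y T
                  (κs * √((PO.card : ℝ) / (T : ℝ))) →
                (persuasionGame u v).NoSecretInformation aStar P₀ O F L y T κn →
                (persuasionGame u v).principalRegret aStar P₀ hP₀ O F L y T ≤
                  K κ κs κn * (T : ℝ) ^ (-(1 / 10) : ℝ) * (Real.log T) ^ k) := by
  refine ⟨9, 4, by norm_num, by norm_num, fun S _ _ _ u v hu hv hopt => ?_⟩
  obtain ⟨C, hC⟩ := exists_separatedBy hopt
  have hC0 := hC.pos
  refine ⟨C, 1 / 2, 1 / C, hC0, by norm_num, by positivity, ?_, ?_⟩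
  · intro aStar hStar P₀ β ε x δ hβ hε hx hδ hδβ
    have hβC : β ∈ Set.Ico 0 C := ⟨hβ.1, by linarith [hβ.2]⟩
    exact exists_optimalStableOracle hu hv hC hStar P₀ hβC hε hx hδ hδβ
  · intro P₀ hP₀
    refine ⟨regretConstant (4 / C + 1 / 2) P₀.card
      ((2304 * Fintype.card S ^ 2 + 2 * P₀.card) * Fintype.card (S → S)), 1, ?_⟩
    intro aStar hStar T β ε x δ hT hε hx hβ hδ _ PO O hPO hO pOpt aOpt _
    obtain ⟨p₀, hp₀⟩ := hP₀
    have : Nonempty (((PO × (S → S)) ⊕ (P₀ × (S → S))) ⊕ (P₀ × (S → S))) :=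
      ⟨.inr (⟨p₀, hp₀⟩, id)⟩
    refine ⟨exists_hasLowBias _ hT, fun F κ hF L y κs κn hs hn => ?_⟩
    rw [pow_one]
    exact persuasionGame_principalRegret_le hu hv hStar _ hT hC0 hε hx hβ hδ hPO hO hF hs hn
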